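/- Let $\Phi,\Psi:\mathbb R\to\mathbb R$ be bounded (Lebesgue measurable) functions that vanish outside $[-1,1]$, and let $\alpha,\beta\in\mathbb R$. Assume that $\alpha$ is resonant for $\Phi$, i.e. that the equation $-u''+\alpha\Phi u=0$ has a nontrivial bounded solution $u:\mathbb R\to\mathbb R$ (a half-bound state). Then there is exactly one half-bound state $u_\alpha$ with $u_\alpha=1$ on $(-\infty,-1]$. It is equal to a nonzero constant $\theta_\alpha$ on $[1,\infty)$. Put $$\zeta_\alpha=\theta_\alpha\int_0^{\infty}\Psi\,dt+\theta_\alpha^{-1}\int_{-\infty}^0\Psi\,dt .$$ For $\varepsilon,\nu>0$ let $S_{\varepsilon\nu}$ be the operator $$S_{\varepsilon\nu}=-\frac{d^2}{dx^2}+\frac{\alpha}{\varepsilon^{2}}\Phi\Bigl(\frac{x}{\varepsilon}\Bigr)+\frac{\beta}{\nu}\Psi\Bigl(\frac{x}{\nu}\Bigr)$$ in $L_2(\mathbb R)$ with domain $W_2^2(\mathbb R)$, and let $S=S(\theta_\alpha,\beta\zeta_\alpha)$ be the operator $S\phi=-\phi''$ in $L_2(\mathbb R)$ whose domain consists of the $\phi\in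 W_2^2(\mathbb R\setminus\{0\})$ with $$\phi(+0)=\theta_\alpha\,\phi(-0),\qquad \phi'(+0)=\theta_\alpha^{-1}\phi'(-0)+\beta\zeta_\alpha\,\phi(-0).$$ Then $S_{\varepsilon\nu}$ converges to $S$ in the norm resolvent sense as $\nu\to0$ and $\nu/\varepsilon\to\infty$, with rate $\nu^{1/2}+\varepsilon/\nu$. That is, for every $z\in\mathbb C\setminus\mathbb R$ the resolvents $(S_{\varepsilon\nu}-z)^{-1}$ (for all $\varepsilon,\nu>0$) and $(S-z)^{-1}$ exist as bounded operators on $L_2(\mathbb R)$, $(S_{\varepsilon\nu}-z)^{-1}\to(S-z)^{-1}$ in operator norm, and $$\bigl\|(S_{\varepsilon\nu}-z)^{-1}-(S-z)^{-1}\bigr\|=O\bigl(\nu^{1/2}+\varepsilon/\nu\bigr)\qquad(\nu\to0,\ \nu/\varepsilon\to\infty),$$ where the constant in $O$ may depend on $\Phi,\Psi,\alpha,\beta,z$. -/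

import Mathlib

open MeasureTheory Filter Topology Set
open scoped ContDiff

namespace PointInteraction

/-- The class `𝒫` of bounded real-valued (Lebesgue measurable) functions with support
in `[-1, 1]`. -/
structure IsPotential (Φ : ℝ → ℝ) : Prop where
  aestronglyMeasurable : AEStronglyMeasurable Φ volume
  bounded : ∃ M : ℝ, ∀ x, |Φ x| ≤ M
  support_subset : Function.support Φ ⊆ Icc (-1) 1

/-- `g` is the weak derivative of `f` on the open set `Ω ⊆ ℝ`. Both functions are locally
integrable on `Ω`; what they do outside `Ω` is irrelevant. -/
def HasWeakDerivOn {E : Type*} [NormedAddCommGroup E] [NormedSpace ℝ E]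
    (Ω : Set ℝ) (f g : ℝ → E) : Prop :=
  LocallyIntegrableOn f Ω ∧ LocallyIntegrableOn g Ω ∧
    ∀ τ : ℝ → ℝ, ContDiff ℝ ∞ τ → HasCompactSupport τ → tsupport τ ⊆ Ω →
      ∫ x, deriv τ x • f x = -∫ x, τ x • g x

/-! ### Resonances -/

/-- `u` is a half-bound state of `-d²/dx² + α Φ`: a nontrivial bounded solution of
`-u'' + α Φ u = 0` on the line (the equation is understood in the sense of weak derivatives and
`u` is the continuous representative). -/
def IsHalfBoundState (Φ : ℝ → ℝ) (α : ℝ) (u : ℝ → ℝ) : Prop :=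
  Continuous u ∧ (∃ M : ℝ, ∀ x, |u x| ≤ M) ∧ (∃ x, u x ≠ 0) ∧
    ∃ u' : ℝ → ℝ, HasWeakDerivOn univ u u' ∧ HasWeakDerivOn univ u' (fun x => α * Φ x * u x)

/-- The resonant set `Λ_Φ`. -/
def resonantSet (Φ : ℝ → ℝ) : Set ℝ := {α | ∃ u, IsHalfBoundState Φ α u}

/-- A half-bound state that equals `1` on `(-∞, -1]`. -/
def IsNormalizedHalfBoundState (Φ : ℝ → ℝ) (α : ℝ) (u : ℝ → ℝ) : Prop :=
  IsHalfBoundState Φ α u ∧ ∀ x ≤ -1, u x = 1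

/-- `θ ∫_{ℝ₊} Ψ + θ⁻¹ ∫_{ℝ₋} Ψ`. -/
noncomputable def zeta (Ψ : ℝ → ℝ) (θ : ℝ) : ℝ :=
  θ * (∫ t in Ioi 0, Ψ t) + θ⁻¹ * ∫ t in Iio 0, Ψ t

/-! ### The Hilbert space and Sobolev spaces -/

/-- The Hilbert space `L²(ℝ)`. -/
abbrev L2 : Type := Lp ℂ 2 (volume : Measure ℝ)

theorem locallyIntegrableOn_L2 (f : L2) (Ω : Set ℝ) :
    LocallyIntegrableOn (f : ℝ → ℂ) Ω :=
  ((Lp.memLp f).locallyIntegrable (by norm_num)).locallyIntegrableOn Ω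

theorem integrable_smul_L2 (f : L2) {τ : ℝ → ℝ} (hτ : Continuous τ) (hc : HasCompactSupport τ) :
    Integrable (fun x => τ x • (f : ℝ → ℂ) x) :=
  ((Lp.memLp f).locallyIntegrable (by norm_num)).integrable_smul_left_of_hasCompactSupport hτ hc

theorem hasWeakDerivOn_zero (Ω : Set ℝ) : HasWeakDerivOn Ω ((0 : L2) : ℝ → ℂ) (0 : L2) := by
  refine ⟨locallyIntegrableOn_L2 _ _, locallyIntegrableOn_L2 _ _, fun τ _ _ _ => ?_⟩
  have h := Lp.coeFn_zero ℂ 2 (volume : Measure ℝ)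
  rw [integral_eq_zero_of_ae, integral_eq_zero_of_ae, neg_zero]
  · filter_upwards [h] with x hx; simp only [hx, Pi.zero_apply, smul_zero]
  · filter_upwards [h] with x hx; simp only [hx, Pi.zero_apply, smul_zero]

theorem HasWeakDerivOn.add {Ω : Set ℝ} {f f' g g' : L2}
    (hf : HasWeakDerivOn Ω f f') (hg : HasWeakDerivOn Ω g g') :
    HasWeakDerivOn Ω ((f + g : L2) : ℝ → ℂ) ((f' + g' : L2) : ℝ → ℂ) := by
  refine ⟨locallyIntegrableOn_L2 _ _, locallyIntegrableOn_L2 _ _, fun τ h1 h2 h3 => ?_⟩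
  have hd : Continuous (deriv τ) := h1.continuous_deriv (by simp)
  have e1 : ∫ x, deriv τ x • ((f + g : L2) : ℝ → ℂ) x
      = ∫ x, (deriv τ x • (f : ℝ → ℂ) x + deriv τ x • (g : ℝ → ℂ) x) := by
    refine integral_congr_ae ?_
    filter_upwards [Lp.coeFn_add f g] with x hx
    simp only [hx, Pi.add_apply, smul_add]
  have e2 : ∫ x, τ x • ((f' + g' : L2) : ℝ → ℂ) x
      = ∫ x, (τ x • (f' : ℝ → ℂ) x + τ x • (g' : ℝ → ℂ) x) := by
    refine integral_congr_ae ?_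
    filter_upwards [Lp.coeFn_add f' g'] with x hx
    simp only [hx, Pi.add_apply, smul_add]
  rw [e1, e2, integral_add (integrable_smul_L2 f hd h2.deriv) (integrable_smul_L2 g hd h2.deriv),
    integral_add (integrable_smul_L2 f' h1.continuous h2) (integrable_smul_L2 g' h1.continuous h2),
    hf.2.2 τ h1 h2 h3, hg.2.2 τ h1 h2 h3, neg_add]

theorem HasWeakDerivOn.smul {Ω : Set ℝ} {f f' : L2} (c : ℂ) (hf : HasWeakDerivOn Ω f f') :
    HasWeakDerivOn Ω ((c • f : L2) : ℝ → ℂ) ((c • f' : L2) : ℝ → ℂ) := by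
  refine ⟨locallyIntegrableOn_L2 _ _, locallyIntegrableOn_L2 _ _, fun τ h1 h2 h3 => ?_⟩
  have e1 : ∫ x, deriv τ x • ((c • f : L2) : ℝ → ℂ) x
      = ∫ x, c • (deriv τ x • (f : ℝ → ℂ) x) := by
    refine integral_congr_ae ?_
    filter_upwards [Lp.coeFn_smul c f] with x hx
    simp only [hx, Pi.smul_apply]
    exact smul_comm _ _ _
  have e2 : ∫ x, τ x • ((c • f' : L2) : ℝ → ℂ) x
      = ∫ x, c • (τ x • (f' : ℝ → ℂ) x) := by
    refine integral_congr_ae ?_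
    filter_upwards [Lp.coeFn_smul c f'] with x hx
    simp only [hx, Pi.smul_apply]
    exact smul_comm _ _ _
  rw [e1, e2, integral_smul, integral_smul, hf.2.2 τ h1 h2 h3, smul_neg]

/-- Weak derivatives are unique. -/
theorem HasWeakDerivOn.unique {Ω : Set ℝ} (hΩ : IsOpen Ω) (h0 : volume Ωᶜ = 0) {f g g' : L2}
    (hg : HasWeakDerivOn Ω f g) (hg' : HasWeakDerivOn Ω f g') : g = g' := by
  have key : ∀ᵐ x : ℝ, x ∈ Ω → ((g : ℝ → ℂ) - (g' : ℝ → ℂ)) x = 0 := by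
    refine hΩ.ae_eq_zero_of_integral_contDiff_smul_eq_zero
      ((locallyIntegrableOn_L2 g Ω).sub (locallyIntegrableOn_L2 g' Ω)) fun τ h1 h2 h3 => ?_
    have e : ∫ x, τ x • ((g : ℝ → ℂ) - (g' : ℝ → ℂ)) x
        = ∫ x, (τ x • (g : ℝ → ℂ) x - τ x • (g' : ℝ → ℂ) x) := by
      congr 1; ext x; simp [mul_sub]
    have a := hg.2.2 τ h1 h2 h3
    have b := hg'.2.2 τ h1 h2 h3
    rw [e, integral_sub (integrable_smul_L2 g h1.continuous h2)
      (integrable_smul_L2 g' h1.continuous h2)]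
    rw [a] at b
    rw [neg_injective b, sub_self]
  have hΩ' : ∀ᵐ x : ℝ, x ∈ Ω := h0
  refine Lp.ext ?_
  filter_upwards [key, hΩ'] with x hx hx'
  exact sub_eq_zero.mp (hx hx')

/-- The Sobolev space `W₂²(Ω)` of functions in `L²` whose first and second weak derivatives on `Ω`
are in `L²`. It is used for open sets `Ω` with null complement, so that `L²(Ω) = L²(ℝ)`. -/
def sobolevW22 (Ω : Set ℝ) : Submodule ℂ L2 where
  carrier := {φ | ∃ φ₁ φ₂ : L2, HasWeakDerivOn Ω φ φ₁ ∧ HasWeakDerivOn Ω φ₁ φ₂}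
  zero_mem' := ⟨0, 0, hasWeakDerivOn_zero Ω, hasWeakDerivOn_zero Ω⟩
  add_mem' := by
    rintro a b ⟨a₁, a₂, h1, h2⟩ ⟨b₁, b₂, k1, k2⟩
    exact ⟨a₁ + b₁, a₂ + b₂, h1.add k1, h2.add k2⟩
  smul_mem' := by
    rintro c a ⟨a₁, a₂, h1, h2⟩
    exact ⟨c • a₁, c • a₂, h1.smul c, h2.smul c⟩

/-- The second weak derivative on `Ω` of an element of `W₂²(Ω)`. -/
noncomputable def secondDeriv {Ω : Set ℝ} (φ : sobolevW22 Ω) : L2 :=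
  φ.2.choose_spec.choose

theorem secondDeriv_eq {Ω : Set ℝ} (hΩ : IsOpen Ω) (h0 : volume Ωᶜ = 0) (φ : sobolevW22 Ω)
    {φ₁ φ₂ : L2} (h1 : HasWeakDerivOn Ω (φ : L2) φ₁) (h2 : HasWeakDerivOn Ω φ₁ φ₂) :
    secondDeriv φ = φ₂ := by
  have s := φ.2.choose_spec.choose_spec
  have e : φ.2.choose = φ₁ := s.1.unique hΩ h0 h1
  have s2 : HasWeakDerivOn Ω (φ.2.choose : L2) (secondDeriv φ) := s.2
  rw [e] at s2
  exact s2.unique hΩ h0 h2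

/-- The unbounded operator `φ ↦ -φ''` in `L²(ℝ)` with domain `W₂²(Ω)`, for an open set `Ω` with
null complement. -/
noncomputable def negSecondDeriv (Ω : Set ℝ) (hΩ : IsOpen Ω) (h0 : volume Ωᶜ = 0) :
    L2 →ₗ.[ℂ] L2 where
  domain := sobolevW22 Ω
  toFun :=
    { toFun := fun φ => -secondDeriv φ
      map_add' := by
        intro φ ψ
        obtain ⟨a₁, a₂, h1, h2⟩ := φ.2
        obtain ⟨b₁, b₂, k1, k2⟩ := ψ.2
        rw [secondDeriv_eq hΩ h0 φ h1 h2, secondDeriv_eq hΩ h0 ψ k1 k2,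
          secondDeriv_eq hΩ h0 (φ + ψ) (h1.add k1) (h2.add k2), neg_add]
      map_smul' := by
        intro c φ
        obtain ⟨a₁, a₂, h1, h2⟩ := φ.2
        rw [secondDeriv_eq hΩ h0 φ h1 h2, secondDeriv_eq hΩ h0 (c • φ) (h1.smul c) (h2.smul c),
          smul_neg, RingHom.id_apply] }

/-! ### The Schrödinger operators `S_{εν}` -/

/-- Multiplication by an essentially bounded real function in `L²(ℝ)`. -/
noncomputable def mulOp (V : ℝ → ℝ) (hV : MemLp V ⊤ volume) : L2 →ₗ[ℂ] L2 where
  toFun φ := ((Lp.memLp φ).smul hV : MemLp (V • (φ : ℝ → ℂ)) 2 volume).toLp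
  map_add' φ ψ := by
    refine Lp.ext ?_
    refine (MemLp.coeFn_toLp _).trans (EventuallyEq.trans ?_ (Lp.coeFn_add _ _).symm)
    filter_upwards [Lp.coeFn_add φ ψ,
      MemLp.coeFn_toLp ((Lp.memLp φ).smul hV : MemLp (V • (φ : ℝ → ℂ)) 2 volume),
      MemLp.coeFn_toLp ((Lp.memLp ψ).smul hV : MemLp (V • (ψ : ℝ → ℂ)) 2 volume)]
      with x h1 h2 h3
    simp only [h1, h2, h3, Pi.add_apply, Pi.smul_apply', smul_add]
  map_smul' c φ := by
    refine Lp.ext ?_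
    refine (MemLp.coeFn_toLp _).trans (EventuallyEq.trans ?_ (Lp.coeFn_smul _ _).symm)
    filter_upwards [Lp.coeFn_smul c φ,
      MemLp.coeFn_toLp ((Lp.memLp φ).smul hV : MemLp (V • (φ : ℝ → ℂ)) 2 volume)]
      with x h1 h2
    simp only [h1, h2, Pi.smul_apply, Pi.smul_apply', RingHom.id_apply]
    exact smul_comm _ _ _

/-- The potential `α ε⁻² Φ(x/ε) + β ν⁻¹ Ψ(x/ν)`. -/
noncomputable def twoScalePotential (Φ Ψ : ℝ → ℝ) (α β ε ν : ℝ) (x : ℝ) : ℝ :=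
  α / ε ^ 2 * Φ (x / ε) + β / ν * Ψ (x / ν)

theorem IsPotential.memLp_comp_div {Φ : ℝ → ℝ} (hΦ : IsPotential Φ) (ε : ℝ) :
    MemLp (fun x => Φ (x / ε)) ⊤ volume := by
  obtain ⟨M, hM⟩ := hΦ.bounded
  rcases eq_or_ne ε 0 with rfl | hε
  · simpa using (memLp_top_const (Φ 0) : MemLp (fun _ : ℝ => Φ 0) ⊤ volume)
  · refine memLp_top_of_bound ?_ M (Eventually.of_forall fun x => hM _)
    have hq : Measure.QuasiMeasurePreserving (fun x : ℝ => x / ε) volume volume := by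
      refine ⟨by fun_prop, ?_⟩
      have : (fun x : ℝ => x / ε) = fun x => x * ε⁻¹ := by ext; rw [div_eq_mul_inv]
      rw [this, Real.map_volume_mul_right (inv_ne_zero hε)]
      exact Measure.smul_absolutelyContinuous
    exact hΦ.aestronglyMeasurable.comp_quasiMeasurePreserving hq

theorem memLp_twoScalePotential {Φ Ψ : ℝ → ℝ} (hΦ : IsPotential Φ) (hΨ : IsPotential Ψ)
    (α β ε ν : ℝ) : MemLp (twoScalePotential Φ Ψ α β ε ν) ⊤ volume :=
  ((hΦ.memLp_comp_div ε).const_mul (α / ε ^ 2)).add ((hΨ.memLp_comp_div ν).const_mul (β / ν))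

/-- The operator `S_{εν} = -d²/dx² + α ε⁻² Φ(x/ε) + β ν⁻¹ Ψ(x/ν)` in `L²(ℝ)`
with domain `W₂²(ℝ)`. -/
noncomputable def schrodinger {Φ Ψ : ℝ → ℝ} (hΦ : IsPotential Φ) (hΨ : IsPotential Ψ)
    (α β ε ν : ℝ) : L2 →ₗ.[ℂ] L2 :=
  mulOp (twoScalePotential Φ Ψ α β ε ν) (memLp_twoScalePotential hΦ hΨ α β ε ν) +ᵥ
    negSecondDeriv univ isOpen_univ (by simp)

/-! ### The point interaction `S(γ₁, γ₂)` -/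

/-- `φ(-0) = a`. The limit is taken along `ae volume`, so that it does not depend on the
representative of `φ`; for an element of a Sobolev space on `ℝ \ {0}` it is the usual limit of the
continuous representative. -/
def LimLeft (φ : ℝ → ℂ) (a : ℂ) : Prop := Tendsto φ (𝓝[<] 0 ⊓ ae volume) (𝓝 a)

/-- `φ(+0) = a`, see `LimLeft`. -/
def LimRight (φ : ℝ → ℂ) (a : ℂ) : Prop := Tendsto φ (𝓝[>] 0 ⊓ ae volume) (𝓝 a)

theorem tendsto_add_L2 {l : Filter ℝ} {f g : L2} {a b : ℂ}
    (hf : Tendsto (f : ℝ → ℂ) (l ⊓ ae volume) (𝓝 a))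
    (hg : Tendsto (g : ℝ → ℂ) (l ⊓ ae volume) (𝓝 b)) :
    Tendsto ((f + g : L2) : ℝ → ℂ) (l ⊓ ae volume) (𝓝 (a + b)) :=
  (hf.add hg).congr' ((Lp.coeFn_add f g).symm.filter_mono inf_le_right)

theorem tendsto_smul_L2 {l : Filter ℝ} {f : L2} {a : ℂ} (c : ℂ)
    (hf : Tendsto (f : ℝ → ℂ) (l ⊓ ae volume) (𝓝 a)) :
    Tendsto ((c • f : L2) : ℝ → ℂ) (l ⊓ ae volume) (𝓝 (c * a)) :=
  (hf.const_mul c).congr' ((Lp.coeFn_smul c f).symm.filter_mono inf_le_right)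

theorem tendsto_zero_L2 (l : Filter ℝ) :
    Tendsto ((0 : L2) : ℝ → ℂ) (l ⊓ ae volume) (𝓝 0) :=
  tendsto_const_nhds.congr'
    ((Lp.coeFn_zero ℂ 2 (volume : Measure ℝ)).symm.filter_mono inf_le_right)

/-- The functions that satisfy the interface conditions `φ(+0) = γ₁ φ(-0)` and
`φ'(+0) = γ₁⁻¹ φ'(-0) + γ₂ φ(-0)`. -/
def interfaceConditions (γ₁ γ₂ : ℝ) : Submodule ℂ L2 where
  carrier := {φ | ∃ φ₁ : L2, HasWeakDerivOn {0}ᶜ φ φ₁ ∧ ∃ m p m' p' : ℂ,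
    LimLeft φ m ∧ LimRight φ p ∧ LimLeft φ₁ m' ∧ LimRight φ₁ p' ∧
    p = γ₁ * m ∧ p' = (γ₁ : ℂ)⁻¹ * m' + γ₂ * m}
  zero_mem' := ⟨0, hasWeakDerivOn_zero _, 0, 0, 0, 0, tendsto_zero_L2 _, tendsto_zero_L2 _,
    tendsto_zero_L2 _, tendsto_zero_L2 _, by simp, by simp⟩
  add_mem' := by
    rintro a b ⟨a₁, ha, m, p, m', p', h1, h2, h3, h4, e1, e2⟩
      ⟨b₁, hb, n, q, n', q', k1, k2, k3, k4, f1, f2⟩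
    exact ⟨a₁ + b₁, ha.add hb, m + n, p + q, m' + n', p' + q', tendsto_add_L2 h1 k1,
      tendsto_add_L2 h2 k2, tendsto_add_L2 h3 k3, tendsto_add_L2 h4 k4,
      by rw [e1, f1]; ring, by rw [e2, f2]; ring⟩
  smul_mem' := by
    rintro c a ⟨a₁, ha, m, p, m', p', h1, h2, h3, h4, e1, e2⟩
    exact ⟨c • a₁, ha.smul c, c * m, c * p, c * m', c * p', tendsto_smul_L2 c h1,
      tendsto_smul_L2 c h2, tendsto_smul_L2 c h3, tendsto_smul_L2 c h4,
      by rw [e1]; ring, by rw [e2]; ring⟩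

/-- The operator `S(γ₁, γ₂)`: it acts as `φ ↦ -φ''` on the functions `φ ∈ W₂²(ℝ \ {0})` that
satisfy the interface conditions at the origin. -/
noncomputable def pointInteraction (γ₁ γ₂ : ℝ) : L2 →ₗ.[ℂ] L2 :=
  (negSecondDeriv {0}ᶜ isOpen_compl_singleton (by simp)).domRestrict (interfaceConditions γ₁ γ₂)

/-! ### Resolvents -/

/-- `z` is in the resolvent set of `A` and the bounded operator `R` is `(A - z)⁻¹`. -/
def IsResolvent (A : L2 →ₗ.[ℂ] L2) (z : ℂ) (R : L2 →L[ℂ] L2) : Prop :=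
  (∀ f : L2, ∃ h : R f ∈ A.domain, A ⟨R f, h⟩ - z • R f = f) ∧
    ∀ φ : A.domain, R (A φ - z • (φ : L2)) = φ

/-- The filter on the pairs `(ε, ν)` of positive numbers that describes
`ν → 0` and `ν / ε → ∞`. -/
noncomputable def regime : Filter (ℝ × ℝ) :=
  comap (fun p => p.2) (𝓝[>] 0) ⊓ comap (fun p => p.2 / p.1) atTop

end PointInteraction

open PointInteraction

namespace PointInteraction

/-! Write `z = k²` with `Im k > 0`, and let `Y` and `y` be the images of one `f` under the
resolvents of `S_{εν}` and `S`. Outside `[-ν, ν]` the potential vanishes, so `Y - y` solves `-w'' =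
k² w` there; being square integrable, it is a multiple of `e^{ikx}` on the right and of `e^{-ikx}`
on the left (`outer_difference`). Two numbers govern it outside, and inside `[-ν, ν]` uniform
boundedness suffices, at the cost of `√ν` in norm. What has to be shown is that `Y` almost satisfies
the interface conditions between `-ν` and `ν`.

Let `u` be the normalized half-bound state, `U(x) = u(x/ε)`, `ψ(x) = β ν⁻¹ Ψ(x/ν)` and `h = z Y +
f`. The Wronskian `U Y' - U' Y` has derivative `U (ψ Y - h)`: the singular potential cancels
(`TransferData.wronskian`). Since `U` is `1` left of `-ε` and `θ` right of `ε`, the Wronskian is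
`Y'` on the left and `θ Y'` on the right, which controls `Y'` off `[-ε, ε]`; on `[-ε, ε]` a Grönwall
estimate at scale `ε` has a uniform constant. Hence `Y ≈ U Y(-ν)` up to `O(ν)`, and in particular
`Y(ν) ≈ θ Y(-ν)`. Integrating the derivative of the Wronskian gives `θ Y'(ν) - Y'(-ν) ≈ Y(-ν) ∫ U²
ψ`; replacing `U²` by the step function with values `1` and `θ²` costs `ε/ν` and turns the integral
into `θ β ζ`. The source contributes `∫ |h| ≤ √(2ν) ‖h‖`, the other half of the rate.
`exists_transfer_bound` collects these estimates.

The interface conditions together with the outgoing relations `w' = ±ik w` form a linear system with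
determinant `ik(θ + θ⁻¹) - βζ`, nonzero because `k²` is not real. So approximate conditions give a
small difference (`exists_interface_stability`, `exists_comparison_bound`).

All resolvents exist with norm at most `|Im z|⁻¹`: symmetry gives the lower bound for `A - z`, and
surjectivity is explicit for the free operator and the point interaction and follows by finitely
many Neumann series for a bounded potential. The claims on half-bound states hold because a solution
is affine off `[-1, 1]`, so bounded means constant there, and because Cauchy data determine it. -/

/-! ### Primitives of locally integrable functions -/

/-- `F` is an indefinite integral of the locally integrable function `f`. -/
structure IsPrimitiveOf {E : Type*} [NormedAddCommGroup E] [NormedSpace ℝ E]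
    (F f : ℝ → E) : Prop where
  locallyIntegrable : LocallyIntegrable f
  integral_eq : ∀ a b, ∫ t in a..b, f t = F b - F a

section Primitive

variable {E : Type*} [NormedAddCommGroup E]

theorem intervalIntegrable_of_locallyIntegrable {f : ℝ → E} (hf : LocallyIntegrable f) (a b : ℝ) :
    IntervalIntegrable f volume a b :=
  intervalIntegrable_iff.mpr
    ((hf.integrableOn_isCompact isCompact_uIcc).mono_set uIoc_subset_uIcc)

theorem locallyIntegrable_of_intervalIntegrable {f : ℝ → E}
    (h : ∀ a b, IntervalIntegrable f volume a b) : LocallyIntegrable f := by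
  intro x
  refine ⟨Ioo (x - 1) (x + 1), Ioo_mem_nhds (by linarith) (by linarith), ?_⟩
  exact ((intervalIntegrable_iff_integrableOn_Ioc_of_le (by linarith)).1
    (h (x - 1) (x + 1))).mono_set Ioo_subset_Ioc_self

theorem locallyIntegrable_iff_intervalIntegrable {f : ℝ → E} :
    LocallyIntegrable f ↔ ∀ a b, IntervalIntegrable f volume a b :=
  ⟨fun h => intervalIntegrable_of_locallyIntegrable h, locallyIntegrable_of_intervalIntegrable⟩

variable [NormedSpace ℝ E]

namespace IsPrimitiveOf

variable {F G f g : ℝ → E}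

theorem intervalIntegrable (h : IsPrimitiveOf F f) (a b : ℝ) : IntervalIntegrable f volume a b :=
  intervalIntegrable_of_locallyIntegrable h.locallyIntegrable a b

theorem eq_add_integral (h : IsPrimitiveOf F f) (a x : ℝ) : F x = F a + ∫ t in a..x, f t := by
  rw [h.integral_eq]; abel

theorem continuous (h : IsPrimitiveOf F f) : Continuous F := by
  have : F = fun x => F 0 + ∫ t in (0 : ℝ)..x, f t := by
    ext x; exact h.eq_add_integral 0 x
  rw [this]
  exact continuous_const.add (intervalIntegral.continuous_primitive h.intervalIntegrable 0)

theorem of_locallyIntegrable (hf : LocallyIntegrable f) (c : E) (a : ℝ) :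
    IsPrimitiveOf (fun x => c + ∫ t in a..x, f t) f := by
  refine ⟨hf, fun x y => ?_⟩
  have h := intervalIntegrable_of_locallyIntegrable hf
  rw [add_sub_add_left_eq_sub, intervalIntegral.integral_interval_sub_left (h a y) (h a x)]

theorem congr_ae (h : IsPrimitiveOf F f) (hfg : f =ᵐ[volume] g) : IsPrimitiveOf F g := by
  refine ⟨?_, fun a b => ?_⟩
  · rw [locallyIntegrable_iff_intervalIntegrable]
    exact fun a b => (h.intervalIntegrable a b).congr_ae hfg.restrict
  · rw [← h.integral_eq a b]
    exact intervalIntegral.integral_congr_ae (by filter_upwards [hfg] with x hx _ using hx.symm)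

theorem add (hF : IsPrimitiveOf F f) (hG : IsPrimitiveOf G g) :
    IsPrimitiveOf (fun x => F x + G x) (fun x => f x + g x) := by
  refine ⟨hF.locallyIntegrable.add hG.locallyIntegrable, fun a b => ?_⟩
  rw [intervalIntegral.integral_add (hF.intervalIntegrable a b) (hG.intervalIntegrable a b),
    hF.integral_eq, hG.integral_eq]
  abel

theorem sub (hF : IsPrimitiveOf F f) (hG : IsPrimitiveOf G g) :
    IsPrimitiveOf (fun x => F x - G x) (fun x => f x - g x) := by
  refine ⟨hF.locallyIntegrable.sub hG.locallyIntegrable, fun a b => ?_⟩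
  rw [intervalIntegral.integral_sub (hF.intervalIntegrable a b) (hG.intervalIntegrable a b),
    hF.integral_eq, hG.integral_eq]
  abel

theorem const_smul {𝕜 : Type*} [NormedField 𝕜] [NormedSpace 𝕜 E] [SMulCommClass ℝ 𝕜 E]
    (c : 𝕜) (hF : IsPrimitiveOf F f) :
    IsPrimitiveOf (fun x => c • F x) (fun x => c • f x) := by
  refine ⟨?_, fun a b => ?_⟩
  · rw [locallyIntegrable_iff_intervalIntegrable]
    exact fun a b => (hF.intervalIntegrable a b).smul c
  · rw [intervalIntegral.integral_smul, hF.integral_eq, smul_sub]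

theorem neg (hF : IsPrimitiveOf F f) : IsPrimitiveOf (fun x => -F x) (fun x => -f x) := by
  simpa using hF.const_smul (-1 : ℝ)

theorem comp_continuousLinearMap {E' : Type*} [NormedAddCommGroup E'] [NormedSpace ℝ E']
    [CompleteSpace E] [CompleteSpace E']
    (L : E →L[ℝ] E') (hF : IsPrimitiveOf F f) :
    IsPrimitiveOf (fun x => L (F x)) (fun x => L (f x)) := by
  refine ⟨?_, fun a b => ?_⟩
  · rw [locallyIntegrable_iff_intervalIntegrable]
    intro a b
    have := hF.intervalIntegrable a b
    exact ⟨L.integrable_comp this.1, L.integrable_comp this.2⟩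
  · rw [L.intervalIntegral_comp_comm (hF.intervalIntegrable a b), hF.integral_eq, map_sub]

theorem comp_mul (hF : IsPrimitiveOf F f) {c : ℝ} (hc : c ≠ 0) :
    IsPrimitiveOf (fun x => F (c * x)) (fun x => c • f (c * x)) := by
  refine ⟨?_, fun a b => ?_⟩
  · rw [locallyIntegrable_iff_intervalIntegrable]
    intro a b
    have := (hF.intervalIntegrable (c * a) (c * b)).comp_mul_left (c := c)
    rw [mul_div_cancel_left₀ _ hc, mul_div_cancel_left₀ _ hc] at this
    exact this.smul c
  · rw [intervalIntegral.integral_smul, intervalIntegral.smul_integral_comp_mul_left,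
      hF.integral_eq]

theorem comp_neg (hF : IsPrimitiveOf F f) :
    IsPrimitiveOf (fun x => F (-x)) (fun x => -f (-x)) := by
  simpa using hF.comp_mul (c := -1) (by norm_num)

theorem norm_sub_le (hF : IsPrimitiveOf F f) {a b : ℝ} (hab : a ≤ b) :
    ‖F b - F a‖ ≤ ∫ t in a..b, ‖f t‖ := by
  rw [← hF.integral_eq]
  exact intervalIntegral.norm_integral_le_integral_norm hab

theorem eq_of_ae_eq_zero (hF : IsPrimitiveOf F f) {a b : ℝ} (hab : a ≤ b)
    (h : ∀ᵐ x, x ∈ Ioo a b → f x = 0) : F b = F a := by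
  have : ∫ t in a..b, f t = 0 := by
    rw [intervalIntegral.integral_of_le hab, integral_Ioc_eq_integral_Ioo]
    exact setIntegral_eq_zero_of_ae_eq_zero h
  rw [hF.integral_eq] at this
  exact sub_eq_zero.1 this

theorem of_hasDerivAt [CompleteSpace E] (h : ∀ x, HasDerivAt F (f x) x) (hf : Continuous f) :
    IsPrimitiveOf F f :=
  ⟨hf.locallyIntegrable, fun a b => intervalIntegral.integral_eq_sub_of_hasDerivAt
    (fun x _ => h x) (hf.intervalIntegrable a b)⟩

theorem ae_hasDerivAt [CompleteSpace E] (h : IsPrimitiveOf F f) :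
    ∀ᵐ x, HasDerivAt F (f x) x := by
  have : F = fun x => F 0 + ∫ t in (0 : ℝ)..x, f t := by
    ext x; exact h.eq_add_integral 0 x
  filter_upwards [LocallyIntegrable.ae_hasDerivAt_integral h.locallyIntegrable] with x hx
  rw [this]
  exact (hx 0).const_add _

/-- Increments of `F` are dominated by those of the primitive of `‖f‖`, whose absolute continuity is
known. -/
theorem absolutelyContinuousOnInterval (h : IsPrimitiveOf F f) (a b : ℝ) :
    AbsolutelyContinuousOnInterval F a b := by
  have h1 : IsPrimitiveOf (fun x => 0 + ∫ t in a..x, ‖f t‖) (fun x => ‖f x‖) :=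
    of_locallyIntegrable (locallyIntegrable_of_intervalIntegrable fun x y =>
      (h.intervalIntegrable x y).norm) 0 a
  have h2 := (h1.intervalIntegrable a b).absolutelyContinuousOnInterval_intervalIntegral
    (left_mem_uIcc : a ∈ uIcc a b)
  rw [absolutelyContinuousOnInterval_iff] at h2 ⊢
  intro ε hε
  obtain ⟨δ, hδ, H⟩ := h2 ε hε
  refine ⟨δ, hδ, fun I hI hs => lt_of_le_of_lt (Finset.sum_le_sum fun i _ => ?_) (H I hI hs)⟩
  have e := h1.integral_eq (I.2 i).2 (I.2 i).1
  simp only [zero_add] at e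
  rw [Real.dist_eq, ← e, dist_eq_norm, ← h.integral_eq]
  exact intervalIntegral.norm_integral_le_abs_integral_norm

/-- Both sides are absolutely continuous, and their difference has derivative zero almost
everywhere, hence is constant. No pointwise differentiability is needed, which suits merely bounded
potentials. -/
theorem smul {𝕜 : Type*} [NormedField 𝕜] [NormedAlgebra ℝ 𝕜] [CompleteSpace 𝕜]
    [CompleteSpace E] [NormedSpace 𝕜 E] [IsScalarTower ℝ 𝕜 E] {P p : ℝ → 𝕜}
    (hP : IsPrimitiveOf P p) (hF : IsPrimitiveOf F f) :
    IsPrimitiveOf (fun x => P x • F x) (fun x => P x • f x + p x • F x) := by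
  have hi : LocallyIntegrable (fun x => P x • f x + p x • F x) := by
    rw [locallyIntegrable_iff_intervalIntegrable]
    intro a b
    exact ((hF.intervalIntegrable a b).continuousOn_smul hP.continuous.continuousOn).add
      ((hP.intervalIntegrable a b).smul_continuousOn hF.continuous.continuousOn)
  have hQ := of_locallyIntegrable hi 0 0
  refine ⟨hi, fun a b => ?_⟩
  have hac : AbsolutelyContinuousOnInterval
      (fun x => P x • F x - (0 + ∫ t in (0 : ℝ)..x, (P t • f t + p t • F t))) a b :=
    ((hP.absolutelyContinuousOnInterval a b).fun_smul
      (hF.absolutelyContinuousOnInterval a b)).fun_sub (hQ.absolutelyContinuousOnInterval a b)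
  obtain ⟨C, hC⟩ := hac.const_of_ae_hasDerivAt_zero (by
    filter_upwards [hP.ae_hasDerivAt, hF.ae_hasDerivAt, hQ.ae_hasDerivAt] with x h1 h2 h3 _
    simpa using! (h1.fun_smul h2).fun_sub h3)
  have ea := hC a left_mem_uIcc
  have eb := hC b right_mem_uIcc
  rw [hQ.integral_eq]
  have := ea.trans eb.symm
  rw [sub_eq_sub_iff_add_eq_add] at this
  rw [sub_eq_sub_iff_add_eq_add, add_comm, ← this, add_comm]

theorem mul {𝕜 : Type*} [NormedField 𝕜] [NormedAlgebra ℝ 𝕜] [CompleteSpace 𝕜]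
    {P p Q q : ℝ → 𝕜} (hP : IsPrimitiveOf P p) (hQ : IsPrimitiveOf Q q) :
    IsPrimitiveOf (fun x => P x * Q x) (fun x => P x * q x + p x * Q x) := by
  simpa using hP.smul hQ

end IsPrimitiveOf

end Primitive

/-! ### Weak derivatives and primitives -/

section Weak

variable {E : Type*} [NormedAddCommGroup E] [NormedSpace ℝ E]

theorem exists_tsupport_subset_Ioo {τ : ℝ → ℝ} (hτ : HasCompactSupport τ) :
    ∃ N : ℝ, 0 < N ∧ tsupport τ ⊆ Ioo (-N) N := by
  obtain ⟨N, hN, h⟩ := hτ.isCompact.isBounded.subset_ball_lt 0 0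
  refine ⟨N, hN, ?_⟩
  rwa [Real.ball_eq_Ioo, zero_sub, zero_add] at h

/-- Integration by parts on `[-N, 0]` and on `[0, N]`; `h0` makes the two boundary terms at the
origin cancel. It holds when `l = r` (the whole line) and when `τ` vanishes at `0` (the punctured
line), so both kinds of operator are served at once. -/
theorem integral_deriv_smul_piecewise [CompleteSpace E] {φ φ₁ l l₁ r r₁ : ℝ → E}
    (hl : IsPrimitiveOf l l₁) (hr : IsPrimitiveOf r r₁)
    (el : ∀ᵐ x, x < 0 → φ x = l x) (er : ∀ᵐ x, 0 < x → φ x = r x)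
    (el₁ : ∀ᵐ x, x < 0 → φ₁ x = l₁ x) (er₁ : ∀ᵐ x, 0 < x → φ₁ x = r₁ x)
    {τ : ℝ → ℝ} (hτ : ContDiff ℝ ∞ τ) (hc : HasCompactSupport τ)
    (h0 : τ 0 • l 0 = τ 0 • r 0) :
    ∫ x, deriv τ x • φ x = -∫ x, τ x • φ₁ x := by
  obtain ⟨N, hN, hs⟩ := exists_tsupport_subset_Ioo hc
  have hτd : IsPrimitiveOf τ (deriv τ) :=
    .of_hasDerivAt (fun x => (hτ.differentiable (by simp) x).hasDerivAt)
      (hτ.continuous_deriv (by simp))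
  have hs1 : Function.support (fun x => deriv τ x • φ x) ⊆ Ioc (-N) N := by
    intro x hx
    refine Ioo_subset_Ioc_self (hs (support_deriv_subset ?_))
    intro h; exact hx (by simp [h])
  have hs2 : Function.support (fun x => τ x • φ₁ x) ⊆ Ioc (-N) N := by
    intro x hx
    refine Ioo_subset_Ioc_self (hs (subset_tsupport _ ?_))
    intro h; exact hx (by simp [h])
  have hz : ∀ x, x ∉ Ioo (-N) N → τ x = 0 := fun x hx => by
    by_contra h; exact hx (hs (subset_tsupport _ h))
  have hl' := hτd.smul hl
  have hr' := hτd.smul hr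
  have i1 : ∀ {F f : ℝ → E}, IsPrimitiveOf F f → ∀ a b,
      IntervalIntegrable (fun x => deriv τ x • F x) volume a b := fun h a b =>
    (hτd.intervalIntegrable a b).smul_continuousOn h.continuous.continuousOn
  have i2 : ∀ {F f : ℝ → E}, IsPrimitiveOf F f → ∀ a b,
      IntervalIntegrable (fun x => τ x • f x) volume a b := fun h a b =>
    (h.intervalIntegrable a b).continuousOn_smul hτ.continuous.continuousOn
  have nN : ∀ᵐ x : ℝ, x ≠ 0 := by simp [ae_iff]
  have cl : ∀ {σ : ℝ → ℝ} {f g : ℝ → E}, (∀ᵐ x, x < 0 → f x = g x) →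
      (fun x => σ x • g x) =ᵐ[volume.restrict (uIoc (-N) 0)] fun x => σ x • f x := by
    intro σ f g h
    rw [uIoc_of_le (by linarith)]
    refine (ae_restrict_iff' measurableSet_Ioc).2 ?_
    filter_upwards [h, nN] with x hx h0 hx'
    rw [hx (lt_of_le_of_ne hx'.2 h0)]
  have cr : ∀ {σ : ℝ → ℝ} {f g : ℝ → E}, (∀ᵐ x, 0 < x → f x = g x) →
      (fun x => σ x • g x) =ᵐ[volume.restrict (uIoc 0 N)] fun x => σ x • f x := by
    intro σ f g h
    rw [uIoc_of_le (by linarith)]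
    refine (ae_restrict_iff' measurableSet_Ioc).2 ?_
    filter_upwards [h] with x hx hx'
    rw [hx hx'.1]
  have ci : ∀ {f g : ℝ → E} {a b : ℝ}, f =ᵐ[volume.restrict (uIoc a b)] g →
      ∫ x in a..b, g x = ∫ x in a..b, f x := by
    intro f g a b h
    exact intervalIntegral.integral_congr_ae ((ae_restrict_iff' measurableSet_uIoc).1 h.symm)
  have il := hl'.integral_eq (-N) 0
  have ir := hr'.integral_eq 0 N
  rw [intervalIntegral.integral_add (i2 hl _ _) (i1 hl _ _), hz (-N) (by simp), zero_smul,
    sub_zero] at il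
  rw [intervalIntegral.integral_add (i2 hr _ _) (i1 hr _ _), hz N (by simp), zero_smul,
    zero_sub] at ir
  rw [← intervalIntegral.integral_eq_integral_of_support_subset hs1,
    ← intervalIntegral.integral_eq_integral_of_support_subset hs2,
    ← intervalIntegral.integral_add_adjacent_intervals ((i1 hl (-N) 0).congr_ae (cl el))
      ((i1 hr 0 N).congr_ae (cr er)),
    ← intervalIntegral.integral_add_adjacent_intervals ((i2 hl (-N) 0).congr_ae (cl el₁))
      ((i2 hr 0 N).congr_ae (cr er₁)), ci (cl el), ci (cr er), ci (cl el₁), ci (cr er₁)]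
  rw [eq_neg_iff_add_eq_zero]
  have := congrArg₂ (· + ·) il ir
  simp only [h0, add_neg_cancel] at this
  rw [← this]; abel

theorem IsPrimitiveOf.hasWeakDerivOn [CompleteSpace E] {F f : ℝ → E} (h : IsPrimitiveOf F f)
    (Ω : Set ℝ) : HasWeakDerivOn Ω F f :=
  ⟨h.continuous.locallyIntegrable.locallyIntegrableOn Ω,
    h.locallyIntegrable.locallyIntegrableOn Ω, fun τ hτ hc _ =>
      integral_deriv_smul_piecewise h h (by simp) (by simp) (by simp) (by simp) hτ hc rfl⟩

theorem integrable_smul_of_locallyIntegrableOn {Ω : Set ℝ} {f : ℝ → E}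
    (hf : LocallyIntegrableOn f Ω) {τ : ℝ → ℝ} (hτ : Continuous τ) (hc : HasCompactSupport τ)
    (hs : tsupport τ ⊆ Ω) : Integrable (fun x => τ x • f x) := by
  have h1 : IntegrableOn (fun x => τ x • f x) (tsupport τ) :=
    (hf.integrableOn_compact_subset hs hc).continuousOn_smul hτ.continuousOn hc
  refine (integrableOn_iff_integrable_of_support_subset fun x hx => subset_tsupport _ ?_).1 h1
  intro h; exact hx (by simp [h])

/-- A function with vanishing weak derivative on an open interval is constant. -/
theorem HasWeakDerivOn.ae_eq_const [CompleteSpace E] {I : Set ℝ} (hI : IsOpen I)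
    (hc : I.OrdConnected) {f g : ℝ → E} (h : HasWeakDerivOn I f g)
    (hg : ∀ᵐ x, x ∈ I → g x = 0) : ∃ c : E, ∀ᵐ x, x ∈ I → f x = c := by
  rcases I.eq_empty_or_nonempty with rfl | ⟨x₀, hx₀⟩
  · exact ⟨0, by simp⟩
  obtain ⟨δ, hδ, hb⟩ := Metric.isOpen_iff.1 hI x₀ hx₀
  let b : ContDiffBump x₀ := ⟨δ / 4, δ / 2, by positivity, by linarith⟩
  set ρ : ℝ → ℝ := b.normed volume with hρ
  have ρs : tsupport ρ ⊆ I := by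
    rw [hρ, b.tsupport_normed_eq]
    exact (Metric.closedBall_subset_ball (by change δ / 2 < δ; linarith)).trans hb
  have ρc : HasCompactSupport ρ := b.hasCompactSupport_normed
  have ρd : ContDiff ℝ ∞ ρ := b.contDiff_normed
  have ρ1 : ∫ x, ρ x = 1 := b.integral_normed
  refine ⟨∫ x, ρ x • f x, ?_⟩
  set c := ∫ x, ρ x • f x with hcdef
  have key := hI.ae_eq_zero_of_integral_contDiff_smul_eq_zero (f := fun x => f x - c)
    (h.1.sub ((locallyIntegrable_const c).locallyIntegrableOn I)) (fun τ τd τc τs => ?_)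
  · filter_upwards [key] with x hx hxI using sub_eq_zero.1 (hx hxI)
  have τi : Integrable τ := τd.continuous.integrable_of_hasCompactSupport τc
  have ρi : Integrable ρ := ρd.continuous.integrable_of_hasCompactSupport ρc
  -- Subtracting `m ρ` makes the integral zero, so the primitive `η` of `σ` is again a test
  -- function. Testing with `η` gives `∫ σ f = 0`, that is `∫ τ (f - c) = 0`.
  set m := ∫ x, τ x with hm
  set σ : ℝ → ℝ := fun x => τ x - m * ρ x with hσ
  have σd : ContDiff ℝ ∞ σ := τd.sub (contDiff_const.mul ρd)
  -- The point `x₀` only ensures that `K` has a least and a greatest element `A` and `B`.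
  -- Order-connectedness of `I` puts `[A, B]`, and with it the support of `η`, inside `I`.
  set K := tsupport τ ∪ tsupport ρ ∪ {x₀} with hK
  have Kc : IsCompact K := (τc.isCompact.union ρc.isCompact).union isCompact_singleton
  have KI : K ⊆ I := union_subset (union_subset τs ρs) (by simpa using hx₀)
  have Kn : K.Nonempty := ⟨x₀, by simp [hK]⟩
  obtain ⟨A, hA, hA'⟩ := Kc.exists_isLeast Kn
  obtain ⟨B, hB, hB'⟩ := Kc.exists_isGreatest Kn
  have σ0 : ∀ x, x ∉ K → σ x = 0 := by
    intro x hx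
    simp only [hK, mem_union, not_or] at hx
    simp [hσ, image_eq_zero_of_notMem_tsupport hx.1.1, image_eq_zero_of_notMem_tsupport hx.1.2]
  have AB : A ≤ B := hA' hB
  have σint : ∫ x, σ x = 0 := by
    rw [integral_sub τi (ρi.const_mul m), integral_const_mul, ρ1, mul_one, hm, sub_self]
  -- Interval integrals are over half-open intervals `(A - 1, x]`; starting at `A - 1` keeps the
  -- point `A` of `K` inside.
  set η : ℝ → ℝ := fun x => ∫ t in (A - 1)..x, σ t with hη
  have ηd : ∀ x, HasDerivAt η (σ x) x := fun x =>
    (σd.continuous.integral_hasStrictDerivAt (A - 1) x).hasDerivAt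
  have ηd' : deriv η = σ := funext fun x => (ηd x).deriv
  have ηc : ContDiff ℝ ∞ η := contDiff_infty_iff_deriv.2
    ⟨fun x => (ηd x).differentiableAt, by rw [ηd']; exact σd⟩
  have ηl : ∀ x, x < A → η x = 0 := by
    intro x hx
    refine (intervalIntegral.integral_congr (g := fun _ => 0) fun t ht => ?_).trans (by simp)
    refine σ0 t fun htK => ?_
    have := hA' htK
    rcases le_total (A - 1) x with h | h
    · rw [uIcc_of_le h] at ht; linarith [ht.2]
    · rw [uIcc_of_ge h] at ht; linarith [ht.2]
  have ηr : ∀ x, B < x → η x = 0 := by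
    intro x hx
    rw [← σint]
    refine intervalIntegral.integral_eq_integral_of_support_subset fun t ht => ?_
    have htK : t ∈ K := by by_contra hh; exact ht (σ0 t hh)
    exact ⟨by linarith [hA' htK], by linarith [hB' htK]⟩
  have ηs : tsupport η ⊆ Icc A B := by
    refine closure_minimal (fun x hx => ?_) isClosed_Icc
    by_contra hh
    rw [mem_Icc, not_and_or, not_le, not_le] at hh
    exact hx (hh.elim (ηl x) (ηr x))
  have ηI : tsupport η ⊆ I := ηs.trans (hc.out (KI hA) (KI hB))
  have ηcs : HasCompactSupport η := isCompact_Icc.of_isClosed_subset (isClosed_tsupport η) ηs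
  have e := h.2.2 η ηc ηcs ηI
  rw [ηd'] at e
  have e0 : ∫ x, η x • g x = 0 := by
    refine integral_eq_zero_of_ae ?_
    filter_upwards [hg] with x hx
    by_cases hxI : x ∈ I
    · simp [hx hxI]
    · simp [image_eq_zero_of_notMem_tsupport fun h' => hxI (ηI h')]
  rw [e0, neg_zero] at e
  have iτ := integrable_smul_of_locallyIntegrableOn h.1 τd.continuous τc τs
  have iρ := integrable_smul_of_locallyIntegrableOn h.1 ρd.continuous ρc ρs
  have e1 : ∫ x, σ x • f x = (∫ x, τ x • f x) - m • c := by
    rw [hcdef, ← integral_smul, ← integral_sub (g := fun x => m • ρ x • f x) iτ (iρ.smul m)]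
    refine integral_congr_ae (.of_forall fun x => ?_)
    simp only [hσ, sub_smul, mul_smul]
  have e2 : ∫ x, τ x • (f x - c) = (∫ x, τ x • f x) - m • c := by
    rw [hm, ← integral_smul_const, ← integral_sub iτ (τi.smul_const c)]
    simp only [smul_sub]
  rw [e2, ← e1, e]

/-- Subtracting a primitive of `g` leaves a function with weak derivative zero, which is constant on
`I`. -/
theorem HasWeakDerivOn.exists_primitive [CompleteSpace E] {I : Set ℝ} (hI : IsOpen I)
    (hc : I.OrdConnected) {f g : ℝ → E} (h : HasWeakDerivOn I f g) (hg : LocallyIntegrable g) :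
    ∃ F : ℝ → E, IsPrimitiveOf F g ∧ ∀ᵐ x, x ∈ I → f x = F x := by
  have hG := IsPrimitiveOf.of_locallyIntegrable hg 0 0
  have hw := hG.hasWeakDerivOn I
  have hd : HasWeakDerivOn I (fun x => f x - (0 + ∫ t in (0 : ℝ)..x, g t)) (fun _ => (0 : E)) := by
    refine ⟨h.1.sub hw.1, (locallyIntegrable_const (0 : E)).locallyIntegrableOn I, fun τ h1 h2 h3 => ?_⟩
    have hd : Continuous (deriv τ) := h1.continuous_deriv (by simp)
    have hs := (tsupport_deriv_subset (𝕜 := ℝ) (f := τ)).trans h3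
    have := integral_sub (integrable_smul_of_locallyIntegrableOn h.1 hd h2.deriv hs)
      (integrable_smul_of_locallyIntegrableOn hw.1 hd h2.deriv hs)
    rw [h.2.2 τ h1 h2 h3, hw.2.2 τ h1 h2 h3, sub_self] at this
    simpa [smul_sub] using this
  obtain ⟨c, hc⟩ := hd.ae_eq_const hI hc (by simp)
  refine ⟨fun x => c + ∫ t in (0 : ℝ)..x, g t, .of_locallyIntegrable hg c 0, ?_⟩
  filter_upwards [hc] with x hx hxI
  rw [← hx hxI]; simp

end Weak

/-! ### Representatives of Sobolev functions -/

theorem locallyIntegrable_L2 (f : L2) : LocallyIntegrable (f : ℝ → ℂ) :=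
  (Lp.memLp f).locallyIntegrable (by norm_num)

/-- On an open interval `I`, an element `φ` of `L²` with weak derivatives `φ₁`, `φ₂` in `L²`
coincides with a `C¹` function. -/
theorem exists_representative {I : Set ℝ} (hI : IsOpen I) (hc : I.OrdConnected) {φ φ₁ φ₂ : L2}
    (h₁ : HasWeakDerivOn I φ φ₁) (h₂ : HasWeakDerivOn I φ₁ φ₂) :
    ∃ r r₁ : ℝ → ℂ, IsPrimitiveOf r r₁ ∧ IsPrimitiveOf r₁ φ₂ ∧
      (∀ᵐ x, x ∈ I → φ x = r x) ∧ ∀ᵐ x, x ∈ I → φ₁ x = r₁ x := by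
  obtain ⟨r₁, hr₁, e₁⟩ := h₂.exists_primitive hI hc (locallyIntegrable_L2 _)
  have h₁' : HasWeakDerivOn I φ r₁ := by
    refine ⟨h₁.1, hr₁.continuous.locallyIntegrable.locallyIntegrableOn I, fun τ a b s => ?_⟩
    rw [h₁.2.2 τ a b s]
    congr 1
    refine integral_congr_ae ?_
    filter_upwards [e₁] with x hx
    by_cases hxI : x ∈ I
    · simp [hx hxI]
    · simp [image_eq_zero_of_notMem_tsupport fun h' => hxI (s h')]
  obtain ⟨r, hr, e⟩ := h₁'.exists_primitive hI hc hr₁.continuous.locallyIntegrable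
  exact ⟨r, r₁, hr, hr₁, e, e₁⟩

theorem HasWeakDerivOn.mono {E : Type*} [NormedAddCommGroup E] [NormedSpace ℝ E]
    {Ω Ω' : Set ℝ} {f g : ℝ → E} (h : HasWeakDerivOn Ω f g) (hs : Ω' ⊆ Ω) :
    HasWeakDerivOn Ω' f g :=
  ⟨h.1.mono_set hs, h.2.1.mono_set hs, fun τ a b s => h.2.2 τ a b (s.trans hs)⟩

/-! ### Grönwall estimates -/

/-- The right-hand side of the hypothesis is differentiable with derivative `L g`, at most `L` times
itself, so the differential form of Grönwall applies to it. -/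
theorem le_mul_exp_of_le_add_integral {g : ℝ → ℝ} (hg : Continuous g) {K L a b : ℝ} (hL : 0 ≤ L)
    (h : ∀ x ∈ Icc a b, g x ≤ K + L * ∫ t in a..x, g t) :
    ∀ x ∈ Icc a b, g x ≤ K * Real.exp (L * (x - a)) := by
  have hd : ∀ x, HasDerivAt (fun x => K + L * ∫ t in a..x, g t) (L * g x) x := fun x =>
    ((hg.integral_hasStrictDerivAt a x).hasDerivAt.const_mul L).const_add K
  have := le_gronwallBound_of_liminf_deriv_right_le (f := fun x => K + L * ∫ t in a..x, g t)
    (f' := fun x => L * g x) (δ := K) (K := L) (ε := 0) (a := a) (b := b)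
    (fun x _ => (hd x).continuousAt.continuousWithinAt)
    (fun x _ r hr => (hd x).hasDerivWithinAt.liminf_right_slope_le hr)
    (by simp) (fun x hx => by
      rw [add_zero]; exact mul_le_mul_of_nonneg_left (h x (Ico_subset_Icc_self hx)) hL)
  intro x hx
  have h1 := this x hx
  rw [gronwallBound_ε0] at h1
  exact (h x hx).trans h1

/-- The weight `ε` on the derivative balances a potential of size `M / ε²`: the system grows at rate
`(1 + M) / ε`, so over a length comparable to `ε` the factor does not depend on `ε`. -/
theorem norm_add_norm_le_of_second_order {E : Type*} [NormedAddCommGroup E] [NormedSpace ℝ E]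
    {p q s : ℝ → E} (hp : IsPrimitiveOf p q) (hq : IsPrimitiveOf q s) {a b ε M : ℝ} (hε : 0 < ε)
    (hM : 0 ≤ M) {k : ℝ → ℝ} (hk : IntervalIntegrable k volume a b) (hk0 : ∀ x, 0 ≤ k x)
    (hs : ∀ᵐ x, x ∈ Ioo a b → ‖s x‖ ≤ M / ε ^ 2 * ‖p x‖ + k x) :
    ∀ x ∈ Icc a b, ‖p x‖ + ε * ‖q x‖ ≤
      (‖p a‖ + ε * ‖q a‖ + ε * ∫ t in a..b, k t) * Real.exp ((1 + M) / ε * (x - a)) := by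
  have cp := hp.continuous
  have cq := hq.continuous
  refine le_mul_exp_of_le_add_integral (by fun_prop) (by positivity) fun x hx => ?_
  have hax := hx.1
  have h1 : ‖p x‖ ≤ ‖p a‖ + ∫ t in a..x, ‖q t‖ := by
    have := hp.norm_sub_le hax
    linarith [norm_sub_norm_le (p x) (p a)]
  have ik : IntervalIntegrable k volume a x := hk.mono_set (by
    rw [uIcc_of_le hax, uIcc_of_le (hax.trans hx.2)]; exact Icc_subset_Icc_right hx.2)
  have ip : IntervalIntegrable (fun t => M / ε ^ 2 * ‖p t‖) volume a x :=
    (Continuous.intervalIntegrable (by fun_prop) a x)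
  have h2 : ‖q x‖ ≤ ‖q a‖ + ∫ t in a..x, (M / ε ^ 2 * ‖p t‖ + k t) := by
    have e1 := hq.norm_sub_le hax
    have e2 : ∫ t in a..x, ‖s t‖ ≤ ∫ t in a..x, (M / ε ^ 2 * ‖p t‖ + k t) := by
      refine intervalIntegral.integral_mono_ae_restrict hax (hq.intervalIntegrable a x).norm
        (ip.add ik) ?_
      have nb : ∀ᵐ t : ℝ, t ≠ b := by simp [ae_iff]
      have na : ∀ᵐ t : ℝ, t ≠ a := by simp [ae_iff]
      refine (ae_restrict_iff' measurableSet_Icc).2 ?_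
      filter_upwards [hs, nb, na] with t ht h1 h2 h3
      exact ht ⟨lt_of_le_of_ne h3.1 (Ne.symm h2), lt_of_le_of_ne (h3.2.trans hx.2) h1⟩
    linarith [norm_sub_norm_le (q x) (q a)]
  rw [intervalIntegral.integral_add ip ik] at h2
  have h3 : ∫ t in a..x, k t ≤ ∫ t in a..b, k t :=
    intervalIntegral.integral_mono_interval le_rfl hax hx.2 (.of_forall hk0) hk
  have h4 : ε * ((∫ t in a..x, M / ε ^ 2 * ‖p t‖)) + ∫ t in a..x, ‖q t‖ ≤
      (1 + M) / ε * ∫ t in a..x, (‖p t‖ + ε * ‖q t‖) := by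
    rw [← intervalIntegral.integral_const_mul, ← intervalIntegral.integral_const_mul,
      ← intervalIntegral.integral_add]
    · refine intervalIntegral.integral_mono_on hax ?_ ?_ fun t _ => ?_
      · exact Continuous.intervalIntegrable (by fun_prop) a x
      · exact Continuous.intervalIntegrable (by fun_prop) a x
      · have : (1 + M) / ε * (‖p t‖ + ε * ‖q t‖) - (ε * (M / ε ^ 2 * ‖p t‖) + ‖q t‖) =
            1 / ε * ‖p t‖ + M * ‖q t‖ := by
          field_simp; ring
        have : 0 ≤ 1 / ε * ‖p t‖ + M * ‖q t‖ := by positivity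
        linarith
    · exact Continuous.intervalIntegrable (by fun_prop) a x
    · exact Continuous.intervalIntegrable (by fun_prop) a x
  have h5 := mul_le_mul_of_nonneg_left h2 hε.le
  have h6 := mul_le_mul_of_nonneg_left h3 hε.le
  linarith

/-! ### Half-bound states -/

/-- Left of `-1` the function is affine, and a bounded affine function on a half-line has slope
zero. -/
theorem eq_const_of_bounded_left {u u₁ w : ℝ → ℝ} (hu : IsPrimitiveOf u u₁)
    (hu₁ : IsPrimitiveOf u₁ w) (hw : ∀ x < -1, w x = 0) (hb : ∃ M : ℝ, ∀ x, |u x| ≤ M) :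
    ∀ x ≤ -1, u₁ x = 0 ∧ u x = u (-1) := by
  have h1 : ∀ x ≤ -1, u₁ x = u₁ (-1) := fun x hx =>
    (hu₁.eq_of_ae_eq_zero hx (.of_forall fun t ht => hw t ht.2)).symm
  have h2 : ∀ x ≤ -1, u (-1) - u x = (-1 - x) * u₁ (-1) := by
    intro x hx
    rw [← hu.integral_eq, intervalIntegral.integral_congr (g := fun _ => u₁ (-1)), 
      intervalIntegral.integral_const, smul_eq_mul]
    intro t ht
    rw [uIcc_of_le hx] at ht
    exact h1 t ht.2
  have h3 : u₁ (-1) = 0 := by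
    obtain ⟨M, hM⟩ := hb
    by_contra hne
    have hpos : 0 < |u₁ (-1)| := abs_pos.2 hne
    have hM0 : 0 ≤ M := (abs_nonneg _).trans (hM 0)
    -- Over this distance an affine function with slope `u₁ (-1)` changes by `2M + 1`, more than the
    -- bound `M` permits.
    have e := h2 (-1 - (2 * M + 1) / |u₁ (-1)|) (by
      have : 0 ≤ (2 * M + 1) / |u₁ (-1)| := by positivity
      linarith)
    have e' := congrArg abs e
    rw [abs_mul, sub_sub_cancel,
      abs_of_nonneg (show 0 ≤ (2 * M + 1) / |u₁ (-1)| by positivity),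
      div_mul_cancel₀ _ hpos.ne'] at e'
    have := abs_sub (u (-1)) (u (-1 - (2 * M + 1) / |u₁ (-1)|))
    linarith [hM (-1), hM (-1 - (2 * M + 1) / |u₁ (-1)|)]
  intro x hx
  refine ⟨(h1 x hx).trans h3, ?_⟩
  have := h2 x hx
  rw [h3, mul_zero] at this
  linarith

/-- Uniqueness for the Cauchy problem: the Grönwall bound with scale `1` and no source is zero for
zero data. -/
theorem eq_zero_of_cauchy_data {u u₁ w : ℝ → ℝ} (hu : IsPrimitiveOf u u₁)
    (hu₁ : IsPrimitiveOf u₁ w) {M a : ℝ} (hM : 0 ≤ M) (hw : ∀ x, |w x| ≤ M * |u x|)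
    (h0 : u a = 0) (h1 : u₁ a = 0) : ∀ x, a ≤ x → u x = 0 := by
  intro x hx
  have := norm_add_norm_le_of_second_order hu hu₁ (a := a) (b := x) one_pos hM (k := fun _ => 0)
    (by simp) (by simp) (.of_forall fun t _ => by simpa using hw t) x ⟨hx, le_rfl⟩
  simp only [h0, h1, norm_zero, mul_zero, add_zero, intervalIntegral.integral_zero, zero_mul,
    one_mul] at this
  exact norm_le_zero_iff.1 (by linarith [norm_nonneg (u₁ x)])

theorem IsPotential.exists_bound {Φ : ℝ → ℝ} (hΦ : IsPotential Φ) (α : ℝ) :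
    ∃ M : ℝ, 0 ≤ M ∧ ∀ x, |α * Φ x| ≤ M := by
  obtain ⟨M, hM⟩ := hΦ.bounded
  refine ⟨|α| * M, mul_nonneg (abs_nonneg _) ((abs_nonneg _).trans (hM 0)), fun x => ?_⟩
  rw [abs_mul]
  exact mul_le_mul_of_nonneg_left (hM x) (abs_nonneg _)

theorem IsPotential.eq_zero {Φ : ℝ → ℝ} (hΦ : IsPotential Φ) {x : ℝ} (hx : 1 < |x|) :
    Φ x = 0 := by
  by_contra h
  have := hΦ.support_subset h
  exact absurd (abs_le.2 ⟨this.1, this.2⟩) (not_le.2 hx)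

/-- Weak derivatives fix `u` and its derivative only almost everywhere; continuity of `u` upgrades
this to equality everywhere. -/
theorem IsHalfBoundState.exists_primitive {Φ : ℝ → ℝ} {α : ℝ} {u : ℝ → ℝ}
    (h : IsHalfBoundState Φ α u) :
    ∃ u₁ : ℝ → ℝ, IsPrimitiveOf u u₁ ∧ IsPrimitiveOf u₁ (fun x => α * Φ x * u x) := by
  obtain ⟨hc, -, -, u', h1, h2⟩ := h
  obtain ⟨u₁, hu₁, e₁⟩ := h2.exists_primitive isOpen_univ ordConnected_univ
    (locallyIntegrableOn_univ.1 h2.2.1)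
  have h3 : HasWeakDerivOn univ u u₁ := by
    refine ⟨h1.1, hu₁.continuous.locallyIntegrable.locallyIntegrableOn _, fun τ a b s => ?_⟩
    rw [h1.2.2 τ a b s]
    congr 1
    refine integral_congr_ae ?_
    filter_upwards [e₁] with x hx
    rw [hx (mem_univ x)]
  obtain ⟨r, hr, e⟩ := h3.exists_primitive isOpen_univ ordConnected_univ
    hu₁.continuous.locallyIntegrable
  have : u = r := (hc.ae_eq_iff_eq volume hr.continuous).1 (by
    filter_upwards [e] with x hx using hx (mem_univ x))
  exact ⟨u₁, this ▸ hr, hu₁⟩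

/-- The right end reduces to the left one by reflection. If `u` vanished at `-1` or at `1`, its
Cauchy data there would be zero and `u` would vanish identically. -/
theorem IsHalfBoundState.structure {Φ : ℝ → ℝ} (hΦ : IsPotential Φ) {α : ℝ} {u : ℝ → ℝ}
    (h : IsHalfBoundState Φ α u) :
    ∃ u₁ : ℝ → ℝ, IsPrimitiveOf u u₁ ∧ IsPrimitiveOf u₁ (fun x => α * Φ x * u x) ∧
      (∀ x ≤ -1, u₁ x = 0 ∧ u x = u (-1)) ∧ (∀ x, 1 ≤ x → u₁ x = 0 ∧ u x = u 1) ∧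
      u (-1) ≠ 0 ∧ u 1 ≠ 0 := by
  obtain ⟨u₁, hu, hu₁⟩ := h.exists_primitive
  obtain ⟨-, hb, ⟨x₀, hx₀⟩, -⟩ := h
  obtain ⟨M, hM0, hM⟩ := hΦ.exists_bound α
  have hv := hu.comp_neg
  have hv₁ : IsPrimitiveOf (fun x => -u₁ (-x)) (fun x => α * Φ (-x) * u (-x)) := by
    simpa using hu₁.comp_neg.neg
  have hl := eq_const_of_bounded_left hu hu₁ (fun x hx => by
    rw [hΦ.eq_zero (by rw [abs_of_neg (by linarith)]; linarith)]; simp) hb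
  have hr := eq_const_of_bounded_left hv hv₁ (fun x hx => by
    rw [hΦ.eq_zero (by rw [abs_of_pos (by linarith)]; linarith)]; simp)
    (hb.imp fun M hM x => hM (-x))
  have hr' : ∀ x, 1 ≤ x → u₁ x = 0 ∧ u x = u 1 := fun x hx => by
    simpa using hr (-x) (by linarith)
  refine ⟨u₁, hu, hu₁, hl, hr', fun h0 => ?_, fun h0 => ?_⟩
  · refine hx₀ ?_
    rcases le_total x₀ (-1) with hx | hx
    · rw [(hl x₀ hx).2, h0]
    · exact eq_zero_of_cauchy_data hu hu₁ hM0
        (fun x => by rw [abs_mul]; exact mul_le_mul_of_nonneg_right (hM x) (abs_nonneg _))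
        h0 (hl _ le_rfl).1 x₀ hx
  · refine hx₀ ?_
    rcases le_total 1 x₀ with hx | hx
    · rw [(hr' x₀ hx).2, h0]
    · have := eq_zero_of_cauchy_data (a := -1) hv hv₁ hM0
        (fun x => by rw [abs_mul]; exact mul_le_mul_of_nonneg_right (hM (-x)) (abs_nonneg _))
        (by simpa using h0) (by simpa using (hr' 1 le_rfl).1) (-x₀) (by linarith)
      simpa using this

theorem IsNormalizedHalfBoundState.ext {Φ : ℝ → ℝ} (hΦ : IsPotential Φ) {α : ℝ} {u v : ℝ → ℝ}
    (hu : IsNormalizedHalfBoundState Φ α u) (hv : IsNormalizedHalfBoundState Φ α v) : u = v := by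
  obtain ⟨u₁, pu, pu₁, hul, -⟩ := hu.1.structure hΦ
  obtain ⟨v₁, pv, pv₁, hvl, -⟩ := hv.1.structure hΦ
  obtain ⟨M, hM0, hM⟩ := hΦ.exists_bound α
  ext x
  rcases le_total x (-1) with hx | hx
  · rw [hu.2 x hx, hv.2 x hx]
  · refine sub_eq_zero.1 (eq_zero_of_cauchy_data (a := -1) (pu.sub pv) (pu₁.sub pv₁) hM0
      (fun x => ?_) ?_ ?_ x hx)
    · rw [← mul_sub, abs_mul]
      exact mul_le_mul_of_nonneg_right (hM x) (abs_nonneg _)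
    · simp [hu.2 _ le_rfl, hv.2 _ le_rfl]
    · simp [(hul _ le_rfl).1, (hvl _ le_rfl).1]

theorem existsUnique_normalized {Φ : ℝ → ℝ} (hΦ : IsPotential Φ) {α : ℝ}
    (hα : α ∈ resonantSet Φ) : ∃! u : ℝ → ℝ, IsNormalizedHalfBoundState Φ α u := by
  obtain ⟨u, hu⟩ := hα
  obtain ⟨u₁, pu, pu₁, hul, -, h0, -⟩ := hu.structure hΦ
  have hn : IsNormalizedHalfBoundState Φ α (fun x => (u (-1))⁻¹ * u x) := by
    refine ⟨⟨continuous_const.mul pu.continuous, ?_, ⟨-1, ?_⟩, fun x => (u (-1))⁻¹ * u₁ x,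
      ?_, ?_⟩, fun x hx => ?_⟩
    · obtain ⟨M, hM⟩ := hu.2.1
      exact ⟨|(u (-1))⁻¹| * M, fun x => by
        rw [abs_mul]; exact mul_le_mul_of_nonneg_left (hM x) (abs_nonneg _)⟩
    · simp [h0]
    · exact (pu.const_smul (u (-1))⁻¹).hasWeakDerivOn univ
    · have := (pu₁.const_smul (u (-1))⁻¹).hasWeakDerivOn univ
      simpa only [smul_eq_mul, mul_left_comm] using this
    · simp only [(hul x hx).2, inv_mul_cancel₀ h0]
  exact ⟨_, hn, fun v hv => hv.ext hΦ hn⟩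

/-! ### Square integrable functions -/

theorem norm_sq_L2 (f : L2) : ‖f‖ ^ 2 = ∫ x, ‖f x‖ ^ 2 := by
  have h : (inner ℂ f f : ℂ) = ((‖f‖ ^ 2 : ℝ) : ℂ) := by
    rw [inner_self_eq_norm_sq_to_K]; norm_cast
  rw [L2.inner_def] at h
  have h2 : ∫ x, (inner ℂ (f x) (f x) : ℂ) = ((∫ x, ‖f x‖ ^ 2 : ℝ) : ℂ) := by
    rw [← integral_complex_ofReal]
    congr 1; ext x
    rw [inner_self_eq_norm_sq_to_K]; norm_cast
  rw [h2] at h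
  exact_mod_cast h.symm

theorem integrable_norm_sq_L2 (f : L2) : Integrable (fun x => ‖f x‖ ^ 2) :=
  (memLp_two_iff_integrable_sq_norm (Lp.memLp f).1).1 (Lp.memLp f)

theorem setIntegral_norm_sq_le (f : L2) (s : Set ℝ) : ∫ x in s, ‖f x‖ ^ 2 ≤ ‖f‖ ^ 2 := by
  rw [norm_sq_L2]
  exact setIntegral_le_integral (integrable_norm_sq_L2 f) (.of_forall fun x => by positivity)

/-- Cauchy–Schwarz, read off from the nonnegative integral of `((b - a) ‖f‖ - m)²`. On intervals of
length of order `ν` it is the source of the `√ν` in the rate. -/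
theorem intervalIntegral_norm_le (f : L2) {a b : ℝ} (hab : a ≤ b) :
    ∫ x in a..b, ‖f x‖ ≤ √(b - a) * ‖f‖ := by
  rcases hab.eq_or_lt with rfl | hlt
  · simp
  have i1 : IntervalIntegrable (fun x => ‖f x‖) volume a b :=
    (intervalIntegrable_of_locallyIntegrable (locallyIntegrable_L2 f) a b).norm
  have i2 : IntervalIntegrable (fun x => ‖f x‖ ^ 2) volume a b :=
    (integrable_norm_sq_L2 f).intervalIntegrable
  set m := ∫ x in a..b, ‖f x‖ with hm
  set S := ∫ x in a..b, ‖f x‖ ^ 2 with hS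
  have hSle : S ≤ ‖f‖ ^ 2 := by
    rw [hS, intervalIntegral.integral_of_le hab]
    exact setIntegral_norm_sq_le f _
  have h0 : 0 ≤ ∫ x in a..b, ((b - a) * ‖f x‖ - m) ^ 2 :=
    intervalIntegral.integral_nonneg hab fun x _ => sq_nonneg _
  have h1 : ∫ x in a..b, ((b - a) * ‖f x‖ - m) ^ 2 =
      (b - a) ^ 2 * S - 2 * (b - a) * m * m + (b - a) * m ^ 2 := by
    have : ∀ x, ((b - a) * ‖f x‖ - m) ^ 2 =
        (b - a) ^ 2 * ‖f x‖ ^ 2 - 2 * (b - a) * m * ‖f x‖ + m ^ 2 := fun x => by ring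
    simp only [this]
    rw [intervalIntegral.integral_add ((i2.const_mul _).sub (i1.const_mul _)) (by simp),
      intervalIntegral.integral_sub (i2.const_mul _) (i1.const_mul _),
      intervalIntegral.integral_const_mul, intervalIntegral.integral_const_mul,
      intervalIntegral.integral_const, smul_eq_mul]
  rw [h1] at h0
  have hpos : 0 < b - a := by linarith
  have h2 : m ^ 2 ≤ (b - a) * S := by
    have : 0 ≤ (b - a) * ((b - a) * S - m ^ 2) := by linarith
    linarith [nonneg_of_mul_nonneg_right this hpos]
  have h3 : m ^ 2 ≤ (√(b - a) * ‖f‖) ^ 2 := by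
    rw [mul_pow, Real.sq_sqrt hpos.le]
    exact h2.trans (mul_le_mul_of_nonneg_left hSle hpos.le)
  exact (le_abs_self m).trans (abs_le_of_sq_le_sq h3 (by positivity))

theorem memLp_comp_neg {f : ℝ → ℂ} {a : ℝ} (hf : MemLp f 2 (volume.restrict (Iio (-a)))) :
    MemLp (fun x => f (-x)) 2 (volume.restrict (Ioi a)) := by
  have h := (Measure.measurePreserving_neg (volume : Measure ℝ)).restrict_preimage
    (measurableSet_Iio (a := -a))
  have hs : Neg.neg ⁻¹' Iio (-a) = Ioi a := by ext x; simp
  rw [hs] at h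
  exact hf.comp_measurePreserving h

/-! ### Second order equations on a half-line -/

/-- A bound for the Cauchy data at the left end of an interval of length one. -/
theorem norm_cauchy_data_le {p q s : ℝ → ℂ} (hp : IsPrimitiveOf p q) (hq : IsPrimitiveOf q s)
    (a : ℝ) :
    ‖p a‖ ≤ 4 * ((∫ x in a..a + 1, ‖p x‖) + ∫ x in a..a + 1, ‖s x‖) ∧
      ‖q a‖ ≤ 6 * ((∫ x in a..a + 1, ‖p x‖) + ∫ x in a..a + 1, ‖s x‖) := by
  have haa : a ≤ a + 1 := by linarith
  have cp := hp.continuous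
  have cq := hq.continuous
  set S := ∫ x in a..a + 1, ‖s x‖ with hS
  have hq' : ∀ x ∈ Icc a (a + 1), ‖q x - q a‖ ≤ S := fun x hx =>
    (hq.norm_sub_le hx.1).trans (intervalIntegral.integral_mono_interval le_rfl hx.1 hx.2
      (.of_forall fun t => norm_nonneg _) (hq.intervalIntegrable _ _).norm)
  have hS0 : 0 ≤ S := intervalIntegral.integral_nonneg haa fun x _ => norm_nonneg _
  have hR : ∀ x ∈ Icc a (a + 1), ‖p x - p a - (x - a : ℝ) * q a‖ ≤ S := by
    intro x hx
    have e : p x - p a - (x - a : ℝ) * q a = ∫ t in a..x, (q t - q a) := by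
      rw [intervalIntegral.integral_sub (cq.intervalIntegrable _ _) (by simp), hp.integral_eq,
        intervalIntegral.integral_const, Complex.real_smul]
    rw [e]
    refine (intervalIntegral.norm_integral_le_of_norm_le_const (C := S) fun t ht => ?_).trans ?_
    · rw [uIoc_of_le hx.1] at ht
      exact hq' t ⟨ht.1.le, ht.2.trans hx.2⟩
    · rw [abs_of_nonneg (by linarith [hx.1])]
      nlinarith [hx.1, hx.2]
  -- On the unit interval `p` is within `S` of its tangent line at `a`. Integrating that line
  -- against a linear weight isolates combinations of `p a` and `q a`.
  have key : ∀ c d C : ℝ, (∀ x ∈ Icc a (a + 1), |c + d * (x - a)| ≤ C) →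
      ‖((c + d / 2 : ℝ) : ℂ) * p a + ((c / 2 + d / 3 : ℝ) : ℂ) * q a‖ ≤
        C * ((∫ x in a..a + 1, ‖p x‖) + S) := by
    intro c d C hC
    have e : ((c + d / 2 : ℝ) : ℂ) * p a + ((c / 2 + d / 3 : ℝ) : ℂ) * q a =
        ∫ x in a..a + 1, ((c + d * (x - a) : ℝ) : ℂ) * (p a + (x - a : ℝ) * q a) := by
      rw [intervalIntegral.integral_eq_sub_of_hasDerivAt (f := fun x : ℝ =>
        ((c * (x - a) + d * (x - a) ^ 2 / 2 : ℝ) : ℂ) * p a +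
          ((c * (x - a) ^ 2 / 2 + d * (x - a) ^ 3 / 3 : ℝ) : ℂ) * q a)]
      · simp
      · intro x _
        have h1 : HasDerivAt (fun x : ℝ => c * (x - a) + d * (x - a) ^ 2 / 2)
            (c + d * (x - a)) x := by
          have h := (hasDerivAt_id' x).sub_const a
          refine ((h.const_mul c).fun_add (((h.fun_pow 2).const_mul d).div_const 2)).congr_deriv ?_
          push_cast; ring
        have h2 : HasDerivAt (fun x : ℝ => c * (x - a) ^ 2 / 2 + d * (x - a) ^ 3 / 3)
            ((c + d * (x - a)) * (x - a)) x := by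
          have h := (hasDerivAt_id' x).sub_const a
          refine ((((h.fun_pow 2).const_mul c).div_const 2).fun_add
            (((h.fun_pow 3).const_mul d).div_const 3)).congr_deriv ?_
          push_cast; ring
        refine ((h1.ofReal_comp.mul_const (p a)).fun_add
          (h2.ofReal_comp.mul_const (q a))).congr_deriv ?_
        push_cast; ring
      · exact Continuous.intervalIntegrable (by fun_prop) _ _
    rw [e]
    have hb : ∀ x ∈ Icc a (a + 1),
        ‖((c + d * (x - a) : ℝ) : ℂ) * (p a + (x - a : ℝ) * q a)‖ ≤ C * (‖p x‖ + S) := by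
      intro x hx
      rw [norm_mul, Complex.norm_real, Real.norm_eq_abs]
      refine mul_le_mul (hC x hx) ?_ (norm_nonneg _) ((abs_nonneg _).trans (hC x hx))
      have : p a + (x - a : ℝ) * q a = p x - (p x - p a - (x - a : ℝ) * q a) := by ring
      rw [this]
      exact (norm_sub_le _ _).trans (by linarith [hR x hx])
    refine (intervalIntegral.norm_integral_le_integral_norm haa).trans ?_
    refine (intervalIntegral.integral_mono_on haa ?_ ?_ hb).trans (le_of_eq ?_)
    · exact Continuous.intervalIntegrable (by fun_prop) _ _
    · exact Continuous.intervalIntegrable (by fun_prop) _ _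
    · rw [intervalIntegral.integral_const_mul, intervalIntegral.integral_add
        (cp.norm.intervalIntegrable _ _) (by simp)]
      simp
  constructor
  -- The weights `4 - 6t` and `-6 + 12t` are dual to `1` and `t` on `[0, 1]`; their maximal moduli
  -- are `4` and `6`.
  · have := key 4 (-6) 4 fun x hx => abs_le.2 ⟨by linarith [hx.2], by linarith [hx.1]⟩
    norm_num at this
    exact this
  · have := key (-6) 12 6 fun x hx => abs_le.2 ⟨by linarith [hx.1], by linarith [hx.2]⟩
    norm_num at this
    exact this

/-- An integrable derivative forces a limit at infinity, and integrability of `F` itself forces that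
limit to be zero. -/
theorem IsPrimitiveOf.tendsto_zero {F f : ℝ → ℂ} (h : IsPrimitiveOf F f) {a : ℝ}
    (hF : IntegrableOn F (Ioi a)) (hf : IntegrableOn f (Ioi a)) : Tendsto F atTop (𝓝 0) := by
  have h1 : Tendsto F atTop (𝓝 (F a + ∫ x in Ioi a, f x)) := by
    refine ((intervalIntegral_tendsto_integral_Ioi a hf tendsto_id).const_add (F a)).congr ?_
    intro x; exact (h.eq_add_integral a x).symm
  have h2 : F a + ∫ x in Ioi a, f x = 0 := by
    refine IntegrableAtFilter.eq_zero_of_tendsto (μ := volume) ⟨Ioi a, Ioi_mem_atTop _, hF⟩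
      (fun s hs => ?_) h1
    rcases mem_atTop_sets.1 hs with ⟨b, hb⟩
    rw [← top_le_iff, ← Real.volume_Ici (a := b)]
    exact measure_mono hb
  rwa [h2] at h1

theorem IsPrimitiveOf.integral_Ioi {F f : ℝ → ℂ} (h : IsPrimitiveOf F f) {a : ℝ}
    (hF : IntegrableOn F (Ioi a)) (hf : IntegrableOn f (Ioi a)) : ∫ x in Ioi a, f x = -F a := by
  have h1 := intervalIntegral_tendsto_integral_Ioi a hf tendsto_id
  have h2 : Tendsto (fun x => ∫ t in a..x, f t) atTop (𝓝 (0 - F a)) :=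
    ((h.tendsto_zero hF hf).sub_const (F a)).congr fun x => (h.integral_eq a x).symm
  rw [zero_sub] at h2
  exact tendsto_nhds_unique h1 h2

theorem IsPrimitiveOf.conj {F f : ℝ → ℂ} (h : IsPrimitiveOf F f) :
    IsPrimitiveOf (fun x => starRingEnd ℂ (F x)) (fun x => starRingEnd ℂ (f x)) :=
  h.comp_continuousLinearMap (Complex.conjCLE : ℂ →L[ℝ] ℂ)

theorem MemLp.conj {f : ℝ → ℂ} {μ : Measure ℝ} (h : MemLp f 2 μ) :
    MemLp (fun x => starRingEnd ℂ (f x)) 2 μ := h.star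

/-- Green's formula on a half-line. -/
theorem im_integral_Ioi_mul_conj {p q s : ℝ → ℂ} (hp : IsPrimitiveOf p q)
    (hq : IsPrimitiveOf q s) {a : ℝ} (mp : MemLp p 2 (volume.restrict (Ioi a)))
    (mq : MemLp q 2 (volume.restrict (Ioi a))) (ms : MemLp s 2 (volume.restrict (Ioi a))) :
    (∫ x in Ioi a, s x * starRingEnd ℂ (p x)).im = -(q a * starRingEnd ℂ (p a)).im := by
  have h := hq.mul hp.conj
  have i1 : IntegrableOn (fun x => q x * starRingEnd ℂ (q x)) (Ioi a) :=
    mq.integrable_mul (MemLp.conj mq)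
  have i2 : IntegrableOn (fun x => s x * starRingEnd ℂ (p x)) (Ioi a) :=
    ms.integrable_mul (MemLp.conj mp)
  have i3 : IntegrableOn (fun x => q x * starRingEnd ℂ (p x)) (Ioi a) :=
    mq.integrable_mul (MemLp.conj mp)
  have e := h.integral_Ioi i3 (i1.add i2)
  rw [integral_add i1 i2] at e
  have h0 : (∫ x in Ioi a, q x * starRingEnd ℂ (q x)).im = 0 := by
    simp only [Complex.mul_conj]
    rw [integral_complex_ofReal, Complex.ofReal_im]
  have := congrArg Complex.im e
  rw [Complex.add_im, h0, zero_add] at this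
  rw [this, Complex.neg_im]

theorem im_integral_Iio_mul_conj {p q s : ℝ → ℂ} (hp : IsPrimitiveOf p q)
    (hq : IsPrimitiveOf q s) {a : ℝ} (mp : MemLp p 2 (volume.restrict (Iio a)))
    (mq : MemLp q 2 (volume.restrict (Iio a))) (ms : MemLp s 2 (volume.restrict (Iio a))) :
    (∫ x in Iio a, s x * starRingEnd ℂ (p x)).im = (q a * starRingEnd ℂ (p a)).im := by
  have hq' : IsPrimitiveOf (fun x => -q (-x)) (fun x => s (-x)) := by simpa using hq.comp_neg.neg
  rw [← neg_neg a] at mp mq ms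
  have := im_integral_Ioi_mul_conj hp.comp_neg hq' (memLp_comp_neg mp) (memLp_comp_neg mq).neg
    (memLp_comp_neg ms)
  rw [integral_comp_neg_Ioi (-a) (fun x => s x * starRingEnd ℂ (p x)), neg_neg,
    integral_Iic_eq_integral_Iio] at this
  rw [this, neg_mul, Complex.neg_im, neg_neg]

/-- Multiplied by the integrating factor `exp (-κ (x - b))`, the function `g` has derivative zero.
-/
theorem IsPrimitiveOf.eq_exp_mul {g h : ℝ → ℂ} (hg : IsPrimitiveOf g h) {κ : ℂ} {b : ℝ}
    (e : ∀ᵐ x, b < x → h x = κ * g x) {x : ℝ} (hx : b ≤ x) :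
    g x = Complex.exp (κ * (x - b : ℝ)) * g b := by
  have hE : IsPrimitiveOf (fun x : ℝ => Complex.exp (-κ * (x - b : ℝ)))
      (fun x => Complex.exp (-κ * (x - b : ℝ)) * (-κ)) := by
    refine .of_hasDerivAt (fun x => ?_) (by fun_prop)
    have h1 : HasDerivAt (fun x : ℝ => -κ * ((x - b : ℝ) : ℂ)) (-κ) x := by
      simpa using ((hasDerivAt_id x).sub_const b).ofReal_comp.const_mul (-κ)
    exact h1.cexp
  have := (hE.mul hg).eq_of_ae_eq_zero hx (by
    filter_upwards [e] with t ht htm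
    rw [ht htm.1]; ring)
  simp only [sub_self, Complex.ofReal_zero, mul_zero, Complex.exp_zero, one_mul] at this
  rw [← this, ← mul_assoc, ← Complex.exp_add]
  simp

/-- Square integrable solutions of `-p'' = k² p` on a half-line are multiples of `e^{ikx}`. -/
theorem eq_exp_of_memLp {p q s : ℝ → ℂ} (hp : IsPrimitiveOf p q) (hq : IsPrimitiveOf q s)
    {k : ℂ} (hk : 0 < k.im) {b : ℝ} (mp : MemLp p 2 (volume.restrict (Ioi b)))
    (mq : MemLp q 2 (volume.restrict (Ioi b))) (e : ∀ᵐ x, b < x → s x = -k ^ 2 * p x) :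
    q b = Complex.I * k * p b ∧
      ∀ x, b ≤ x → p x = Complex.exp (Complex.I * k * (x - b : ℝ)) * p b := by
  -- The combination `w = q - ik p` satisfies `w' = -ik w`, so its modulus grows from `b` on. Square
  -- integrability then forces `w b = 0`, hence `w = 0` and `p' = ik p`.
  have hw := hq.sub (hp.const_smul (Complex.I * k))
  have ew : ∀ᵐ x, b < x → s x - (Complex.I * k) • q x =
      -(Complex.I * k) * (q x - (Complex.I * k) • p x) := by
    filter_upwards [e] with x hx hbx
    rw [hx hbx, smul_eq_mul, smul_eq_mul]
    linear_combination (-(k ^ 2 * p x)) * Complex.I_sq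
  have hwx : ∀ x, b ≤ x → _ := fun x hx => hw.eq_exp_mul ew hx
  have hw0 : q b - (Complex.I * k) • p b = 0 := by
    by_contra hne
    have mw : MemLp (fun x => q x - (Complex.I * k) • p x) 2 (volume.restrict (Ioi b)) :=
      mq.sub (mp.const_smul (Complex.I * k))
    have mc : MemLp (fun _ : ℝ => q b - (Complex.I * k) • p b) 2 (volume.restrict (Ioi b)) := by
      refine mw.mono aestronglyMeasurable_const ?_
      refine (ae_restrict_iff' measurableSet_Ioi).2 (.of_forall fun x hx => ?_)
      rw [hwx x (le_of_lt hx), norm_mul, Complex.norm_exp]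
      refine le_mul_of_one_le_left (norm_nonneg _) (Real.one_le_exp ?_)
      have : (-(Complex.I * k) * ((x - b : ℝ) : ℂ)).re = k.im * (x - b) := by
        simp [-Complex.ofReal_sub]
      rw [this]
      exact mul_nonneg hk.le (by linarith [mem_Ioi.1 hx])
    rw [memLp_const_iff (by norm_num) (by norm_num)] at mc
    rcases mc with h | h
    · exact hne h
    · simp at h
  refine ⟨sub_eq_zero.1 hw0, fun x hx => hp.eq_exp_mul (.of_forall fun x hx => ?_) hx⟩
  have := hwx x hx.le
  rw [hw0, mul_zero] at this
  exact sub_eq_zero.1 this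

theorem integral_norm_sq_exp_Ioi {k : ℂ} (hk : 0 < k.im) (b : ℝ) (c : ℂ) :
    ∫ x in Ioi b, ‖Complex.exp (Complex.I * k * (x - b : ℝ)) * c‖ ^ 2 =
      ‖c‖ ^ 2 / (2 * k.im) := by
  have h : ∀ x : ℝ, ‖Complex.exp (Complex.I * k * (x - b : ℝ)) * c‖ ^ 2 =
      ‖c‖ ^ 2 * Real.exp (2 * k.im * b) * Real.exp (-(2 * k.im) * x) := by
    intro x
    have : (Complex.I * k * ((x - b : ℝ) : ℂ)).re = -k.im * (x - b) := by
      simp [-Complex.ofReal_sub]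
    rw [norm_mul, Complex.norm_exp, this, mul_pow, ← Real.exp_nat_mul, mul_assoc, ← Real.exp_add,
      mul_comm]
    congr 2; push_cast; ring
  simp only [h]
  rw [integral_const_mul, integral_exp_mul_Ioi (by linarith), mul_assoc, neg_div_neg_eq,
    mul_div_assoc', ← Real.exp_add]
  simp; ring

/-! ### Resolvents of symmetric operators -/

section Abstract

variable {E : Type*} [NormedAddCommGroup E] [InnerProductSpace ℂ E]

/-- Used with `f = A a` for a symmetric `A`: in the pairing of `a` with `f - z a` only `z`
contributes an imaginary part. -/
theorem abs_im_mul_norm_le {a f : E} (h : (inner ℂ a f : ℂ).im = 0) (z : ℂ) :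
    |z.im| * ‖a‖ ≤ ‖f - z • a‖ := by
  rcases eq_or_ne a 0 with rfl | ha
  · simp
  have h1 : (inner ℂ a (f - z • a) : ℂ).im = -(z.im * ‖a‖ ^ 2) := by
    rw [inner_sub_right, inner_smul_right, inner_self_eq_norm_sq_to_K, Complex.sub_im, h,
      zero_sub, neg_inj]
    have : (((‖a‖ : ℂ)) ^ 2) = ((‖a‖ ^ 2 : ℝ) : ℂ) := by norm_cast
    change (z * (((‖a‖ : ℂ)) ^ 2)).im = _
    rw [this, Complex.im_mul_ofReal]
  have h2 : |z.im| * ‖a‖ ^ 2 ≤ ‖a‖ * ‖f - z • a‖ := by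
    calc |z.im| * ‖a‖ ^ 2 = |(inner ℂ a (f - z • a) : ℂ).im| := by
          rw [h1, abs_neg, abs_mul, abs_of_nonneg (sq_nonneg ‖a‖)]
      _ ≤ ‖(inner ℂ a (f - z • a) : ℂ)‖ := Complex.abs_im_le_norm _
      _ ≤ ‖a‖ * ‖f - z • a‖ := norm_inner_le_norm _ _
  have hpos : 0 < ‖a‖ := norm_pos_iff.2 ha
  refine le_of_mul_le_mul_left ?_ hpos
  calc ‖a‖ * (|z.im| * ‖a‖) = |z.im| * ‖a‖ ^ 2 := by ring
    _ ≤ _ := h2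

/-- The lower bound gives injectivity, which makes the chosen preimages linear in `f`, and it
becomes the norm bound of the inverse. -/
theorem exists_resolvent {A : E →ₗ.[ℂ] E} {z : ℂ} {c : ℝ} (hc : 0 < c)
    (hb : ∀ φ : A.domain, c * ‖(φ : E)‖ ≤ ‖A φ - z • (φ : E)‖)
    (hs : ∀ f : E, ∃ φ : A.domain, A φ - z • (φ : E) = f) :
    ∃ R : E →L[ℂ] E, (∀ f : E, ∃ h : R f ∈ A.domain, A ⟨R f, h⟩ - z • R f = f) ∧
      (∀ φ : A.domain, R (A φ - z • (φ : E)) = φ) ∧ ∀ f, ‖R f‖ ≤ c⁻¹ * ‖f‖ := by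
  choose S hS using hs
  have inj : ∀ φ ψ : A.domain, A φ - z • (φ : E) = A ψ - z • (ψ : E) → φ = ψ := by
    intro φ ψ h
    have h1 := hb (φ - ψ)
    have h2 : A (φ - ψ) - z • ((φ - ψ : A.domain) : E) = 0 := by
      rw [LinearPMap.map_sub, Submodule.coe_sub, smul_sub, sub_sub_sub_comm, h, sub_self]
    rw [h2, norm_zero] at h1
    have h3 : ‖((φ - ψ : A.domain) : E)‖ = 0 :=
      le_antisymm (nonpos_of_mul_nonpos_right h1 hc) (norm_nonneg _)
    have h4 : φ - ψ = 0 := Subtype.ext (norm_eq_zero.1 h3)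
    exact sub_eq_zero.1 h4
  let L : E →ₗ[ℂ] E :=
    { toFun := fun f => (S f : E)
      map_add' := fun f g => by
        rw [← Submodule.coe_add]
        congr 1
        apply inj
        rw [hS, LinearPMap.map_add, Submodule.coe_add, smul_add, add_sub_add_comm, hS, hS]
      map_smul' := fun a f => by
        rw [RingHom.id_apply, ← Submodule.coe_smul]
        congr 1
        apply inj
        rw [hS, LinearPMap.map_smul, Submodule.coe_smul, smul_comm z a, ← smul_sub, hS] }
  have hL : ∀ f, ‖L f‖ ≤ c⁻¹ * ‖f‖ := fun f => by
    have := hb (S f)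
    rw [hS] at this
    rw [inv_mul_eq_div, le_div_iff₀ hc, mul_comm]
    exact this
  refine ⟨L.mkContinuous c⁻¹ hL, fun f => ⟨(S f).2, hS f⟩, fun φ => ?_, hL⟩
  exact congrArg Subtype.val (inj _ _ (hS _))

/-- With `R = (A - z)⁻¹` one has `A + C - z = (1 + C R)(A - z)`, and `1 + C R` is invertible by a
Neumann series because `‖R‖ ≤ |Im z|⁻¹`. -/
theorem surjective_add_of_norm_lt [CompleteSpace E] {A : E →ₗ.[ℂ] E} {z : ℂ}
    (hA : ∀ φ : A.domain, (inner ℂ (φ : E) (A φ) : ℂ).im = 0)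
    (hs : ∀ f : E, ∃ φ : A.domain, A φ - z • (φ : E) = f) (C : E →L[ℂ] E)
    (hC : ‖C‖ < |z.im|) (f : E) : ∃ φ : A.domain, A φ + C φ - z • (φ : E) = f := by
  have hz : 0 < |z.im| := (norm_nonneg C).trans_lt hC
  obtain ⟨R, hR, -, hb⟩ := exists_resolvent hz (fun φ => abs_im_mul_norm_le (hA φ) z) hs
  have hn : ‖-(C * R)‖ < 1 := by
    rw [norm_neg]
    have h1 : ‖R‖ ≤ |z.im|⁻¹ := R.opNorm_le_bound (by positivity) hb
    calc ‖C * R‖ ≤ ‖C‖ * ‖R‖ := norm_mul_le _ _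
      _ ≤ ‖C‖ * |z.im|⁻¹ := mul_le_mul_of_nonneg_left h1 (norm_nonneg _)
      _ < |z.im| * |z.im|⁻¹ := mul_lt_mul_of_pos_right hC (by positivity)
      _ = 1 := mul_inv_cancel₀ hz.ne'
  obtain ⟨u, hu⟩ := isUnit_one_sub_of_norm_lt_one hn
  have hg : (↑u : E →L[ℂ] E) ((↑u⁻¹ : E →L[ℂ] E) f) = f := by
    rw [← mul_apply_eq_comp, Units.mul_inv, one_apply_eq_self]
  set g := (↑u⁻¹ : E →L[ℂ] E) f
  obtain ⟨hd, hg'⟩ := hR g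
  refine ⟨⟨R g, hd⟩, ?_⟩
  rw [hu] at hg
  simp only [sub_neg_eq_add, add_apply, one_apply_eq_self,
    mul_apply_eq_comp] at hg
  rw [← hg, add_sub_right_comm, hg', hg]

/-- `B` is added in `N` equal portions of norm less than `|Im z|`. Every intermediate operator is
symmetric, so its resolvent obeys the same bound and the portions need not shrink; thus `B` may be
arbitrarily large. -/
theorem surjective_add_symmetric [CompleteSpace E] {A : E →ₗ.[ℂ] E} {z : ℂ} (hz : z.im ≠ 0)
    (hA : ∀ φ : A.domain, (inner ℂ (φ : E) (A φ) : ℂ).im = 0)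
    (hs : ∀ f : E, ∃ φ : A.domain, A φ - z • (φ : E) = f) (B : E →L[ℂ] E)
    (hB : ∀ x, (inner ℂ x (B x) : ℂ).im = 0) (f : E) :
    ∃ φ : A.domain, A φ + B φ - z • (φ : E) = f := by
  obtain ⟨N, hN⟩ := exists_nat_gt (‖B‖ / |z.im|)
  have hz' : 0 < |z.im| := abs_pos.2 hz
  have hN0 : (0 : ℝ) < N := lt_of_le_of_lt (by positivity) hN
  set C : E →L[ℂ] E := ((N : ℝ)⁻¹ : ℝ) • B with hC
  have hCn : ‖C‖ < |z.im| := by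
    rw [hC, norm_smul, Real.norm_of_nonneg (by positivity), inv_mul_lt_iff₀ hN0]
    rwa [div_lt_iff₀ hz'] at hN
  have hCs : ∀ x, (inner ℂ x (C x) : ℂ).im = 0 := fun x => by
    rw [hC, smul_apply, inner_smul_right_eq_smul, Complex.smul_im, hB,
      smul_zero]
  have key : ∀ n : ℕ, ∀ f : E, ∃ φ : A.domain, A φ + (n : ℝ) • C φ - z • (φ : E) = f := by
    intro n
    induction n with
    | zero => simpa using hs
    | succ n ih =>
      intro f
      have hA' : ∀ φ : (((n : ℝ) • C : E →L[ℂ] E).toLinearMap +ᵥ A).domain,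
          (inner ℂ (φ : E) ((((n : ℝ) • C : E →L[ℂ] E).toLinearMap +ᵥ A) φ) : ℂ).im = 0 := by
        intro φ
        rw [LinearPMap.vadd_apply, inner_add_right, Complex.add_im, hA, add_zero]
        change (inner ℂ (φ : E) ((n : ℝ) • C φ) : ℂ).im = 0
        rw [inner_smul_right_eq_smul, Complex.smul_im, hCs, smul_zero]
      obtain ⟨φ, hφ⟩ := surjective_add_of_norm_lt hA' (fun f => by
        obtain ⟨φ, hφ⟩ := ih f
        refine ⟨φ, ?_⟩
        rw [LinearPMap.vadd_apply, ← hφ, add_comm (A φ)]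
        rfl) C hCn f
      refine ⟨φ, ?_⟩
      rw [← hφ, LinearPMap.vadd_apply, Nat.cast_succ, add_smul, one_smul, ← add_assoc,
        add_comm _ (A φ)]
      rfl
  obtain ⟨φ, hφ⟩ := key N f
  refine ⟨φ, ?_⟩
  rw [← hφ, hC, smul_apply, smul_smul, mul_inv_cancel₀ hN0.ne', one_smul]

end Abstract

/-! ### The first order equation on the line -/

/-- The solution is `g(x) = ∫_{-∞}^x e^{κ(x - t)} f(t) dt`. It is first shown to be bounded; an
energy estimate then makes it square integrable. -/
theorem exists_primitive_of_first_order {κ : ℂ} (hκ : κ.re < 0) {f : ℝ → ℂ}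
    (hf : MemLp f 2 volume) :
    ∃ g : ℝ → ℂ, IsPrimitiveOf g (fun x => κ * g x + f x) ∧ MemLp g 2 volume := by
  set a := -κ.re with ha
  have ha0 : 0 < a := by linarith
  have hf2 : Integrable (fun x => ‖f x‖ ^ 2) := (memLp_two_iff_integrable_sq_norm hf.1).1 hf
  set S := ∫ x, ‖f x‖ ^ 2 with hS
  have hexpn : ∀ x : ℝ, ‖Complex.exp (-κ * x)‖ ^ 2 = Real.exp (2 * a * x) := fun x => by
    rw [Complex.norm_exp, ← Real.exp_nat_mul]
    congr 1
    simp [ha]; ring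
  have hE : ∀ x, MemLp (fun t : ℝ => Complex.exp (-κ * t)) 2 (volume.restrict (Iic x)) := by
    intro x
    refine (memLp_two_iff_integrable_sq_norm (by fun_prop)).2 ?_
    simp only [hexpn]
    exact integrableOn_exp_mul_Iic (by positivity) x
  have hi : ∀ x, IntegrableOn (fun t : ℝ => Complex.exp (-κ * t) * f t) (Iic x) := fun x =>
    (hE x).integrable_mul (hf.restrict _)
  set G : ℝ → ℂ := fun x => ∫ t in Iic x, Complex.exp (-κ * t) * f t with hG
  have pG : IsPrimitiveOf G (fun t : ℝ => Complex.exp (-κ * t) * f t) := by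
    refine ⟨locallyIntegrable_of_intervalIntegrable fun x y => ?_, fun x y => ?_⟩
    · exact intervalIntegrable_iff.2 ((hi (max x y)).mono_set fun t ht => ht.2)
    · exact (intervalIntegral.integral_Iic_sub_Iic (hi x) (hi y)).symm
  have pE : IsPrimitiveOf (fun x : ℝ => Complex.exp (κ * x))
      (fun x => Complex.exp (κ * x) * κ) := by
    refine .of_hasDerivAt (fun x => ?_) (by fun_prop)
    have h1 : HasDerivAt (fun x : ℝ => κ * (x : ℂ)) κ x := by
      simpa using (hasDerivAt_id x).ofReal_comp.const_mul κ
    exact h1.cexp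
  set g : ℝ → ℂ := fun x => Complex.exp (κ * x) * G x with hg
  have pg : IsPrimitiveOf g (fun x => κ * g x + f x) := by
    refine (pE.mul pG).congr_ae (.of_forall fun x => ?_)
    simp only [hg]
    rw [← mul_assoc, ← Complex.exp_add]
    simp; ring
  -- From `2 |e^{κ(x-t)}| |f| ≤ |e^{κ(x-t)}|² + |f|²`, where the integral of the squared kernel is
  -- `1 / (2a)`.
  set K := (1 / (2 * a) + S) / 2 with hK
  have hgb : ∀ x, ‖g x‖ ≤ K := by
    intro x
    have e : g x = ∫ t in Iic x, Complex.exp (κ * x) * (Complex.exp (-κ * t) * f t) :=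
      (integral_const_mul _ _).symm
    rw [e]
    refine (norm_integral_le_integral_norm _).trans ?_
    have i1 : IntegrableOn (fun t => Real.exp (-(2 * a) * x) * Real.exp (2 * a * t)) (Iic x) :=
      (integrableOn_exp_mul_Iic (by positivity) x).const_mul _
    refine (setIntegral_mono (g := fun t => (Real.exp (-(2 * a) * x) * Real.exp (2 * a * t) +
      ‖f t‖ ^ 2) / 2) ((hi x).const_mul _).norm (Integrable.div_const (f := fun t =>
        Real.exp (-(2 * a) * x) * Real.exp (2 * a * t) + ‖f t‖ ^ 2)
        (Integrable.add i1 hf2.integrableOn) 2) fun t => ?_).trans ?_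
    · simp only
      rw [← mul_assoc, norm_mul, norm_mul, ← hexpn t]
      have e2 : ‖Complex.exp (κ * x)‖ ^ 2 = Real.exp (-(2 * a) * x) := by
        rw [Complex.norm_exp, ← Real.exp_nat_mul]
        congr 1
        simp [ha]; ring
      rw [← e2, ← mul_pow]
      linarith [two_mul_le_add_sq (‖Complex.exp (κ * x)‖ * ‖Complex.exp (-κ * t)‖) ‖f t‖]
    · rw [integral_div, integral_add i1 hf2.integrableOn, integral_const_mul,
        integral_exp_mul_Iic (by positivity), mul_div_assoc', ← Real.exp_add, hK]
      have : ∫ t in Iic x, ‖f t‖ ^ 2 ≤ S :=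
        setIntegral_le_integral hf2 (.of_forall fun t => by positivity)
      simp only [neg_mul, neg_add_cancel, Real.exp_zero]
      linarith
  refine ⟨g, pg, (memLp_two_iff_integrable_sq_norm pg.continuous.aestronglyMeasurable).2 ?_⟩
  -- The derivative of `|g|²` is at most `-a |g|² + a⁻¹ |f|²`. Integrated over `[-n, n]`, this
  -- bounds `∫ |g|²` uniformly in `n`, since the boundary term at `-n` is at most `K²`.
  have pN : IsPrimitiveOf (fun x => ‖g x‖ ^ 2)
      (fun x => -(2 * a) * ‖g x‖ ^ 2 + 2 * (f x * starRingEnd ℂ (g x)).re) := by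
    have := (pg.mul pg.conj).comp_continuousLinearMap (Complex.reCLM)
    simp only [Complex.mul_conj, Complex.reCLM_apply, Complex.ofReal_re,
      Complex.normSq_eq_norm_sq] at this
    refine this.congr_ae (.of_forall fun x => ?_)
    simp only [map_add, map_mul, Complex.add_re]
    rw [← Complex.normSq_eq_norm_sq, Complex.normSq_apply]
    simp [ha]; ring
  have cg := pg.continuous
  refine integrable_of_intervalIntegral_norm_bounded (a := fun n : ℕ => -(n : ℝ))
    (b := fun n : ℕ => (n : ℝ)) (l := atTop) ((K ^ 2 + S / a) / a) (fun n => ?_)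
    (tendsto_neg_atTop_atBot.comp tendsto_natCast_atTop_atTop) tendsto_natCast_atTop_atTop
    (.of_forall fun n => ?_)
  · exact (Continuous.integrableOn_Ioc (by fun_prop))
  · have hn : -(n : ℝ) ≤ n := by linarith [(Nat.cast_nonneg n : (0 : ℝ) ≤ n)]
    have e1 := pN.integral_eq (-n) n
    have i2 : IntervalIntegrable (fun x => ‖g x‖ ^ 2) volume (-n) n :=
      Continuous.intervalIntegrable (by fun_prop) _ _
    have i3 : IntervalIntegrable (fun x => ‖f x‖ ^ 2) volume (-n) n := hf2.intervalIntegrable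
    have e2 : ∫ x in (-n : ℝ)..n, (-(2 * a) * ‖g x‖ ^ 2 + 2 * (f x * starRingEnd ℂ (g x)).re) ≤
        ∫ x in (-n : ℝ)..n, (-a * ‖g x‖ ^ 2 + a⁻¹ * ‖f x‖ ^ 2) := by
      refine intervalIntegral.integral_mono_on hn (pN.intervalIntegrable _ _)
        ((i2.const_mul _).add (i3.const_mul _)) fun x _ => ?_
      have h1 : (f x * starRingEnd ℂ (g x)).re ≤ ‖f x‖ * ‖g x‖ := by
        refine (Complex.re_le_norm _).trans ?_
        rw [norm_mul, Complex.norm_conj]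
      have h2 : 2 * (‖f x‖ * ‖g x‖) ≤ a * ‖g x‖ ^ 2 + a⁻¹ * ‖f x‖ ^ 2 := by
        have : a * ‖g x‖ ^ 2 + a⁻¹ * ‖f x‖ ^ 2 - 2 * (‖f x‖ * ‖g x‖) =
            a⁻¹ * (a * ‖g x‖ - ‖f x‖) ^ 2 := by field_simp; ring
        have h3 : 0 ≤ a⁻¹ * (a * ‖g x‖ - ‖f x‖) ^ 2 := by positivity
        linarith
      linarith
    rw [e1, intervalIntegral.integral_add (i2.const_mul _) (i3.const_mul _),
      intervalIntegral.integral_const_mul, intervalIntegral.integral_const_mul] at e2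
    have e3 : ∫ x in (-n : ℝ)..n, ‖f x‖ ^ 2 ≤ S := by
      rw [intervalIntegral.integral_of_le hn]
      exact setIntegral_le_integral hf2 (.of_forall fun t => by positivity)
    have e4 : ‖g (-n)‖ ^ 2 ≤ K ^ 2 := by gcongr; exact hgb _
    have e5 : a⁻¹ * ∫ x in (-n : ℝ)..n, ‖f x‖ ^ 2 ≤ S / a := by
      rw [inv_mul_eq_div]; gcongr
    simp only [norm_pow, norm_norm]
    rw [le_div_iff₀ ha0]
    nlinarith [sq_nonneg ‖g n‖]

theorem exists_sqrt_im_pos {z : ℂ} (hz : z.im ≠ 0) : ∃ k : ℂ, k ^ 2 = z ∧ 0 < k.im := by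
  obtain ⟨k, hk⟩ := IsAlgClosed.exists_pow_nat_eq z (n := 2) (by norm_num)
  have h : k.im ≠ 0 := fun h => hz (by rw [← hk, sq, Complex.mul_im, h]; simp)
  rcases lt_or_gt_of_ne h with h | h
  · exact ⟨-k, by rw [neg_sq, hk], by simpa using h⟩
  · exact ⟨k, hk, h⟩

/-- The free resolvent equation `-p'' - k² p = f`. -/
theorem exists_free_solution {k : ℂ} (hk : 0 < k.im) {f : ℝ → ℂ} (hf : MemLp f 2 volume) :
    ∃ p q : ℝ → ℂ, IsPrimitiveOf p q ∧ IsPrimitiveOf q (fun x => -k ^ 2 * p x - f x) ∧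
      MemLp p 2 volume ∧ MemLp q 2 volume := by
  have hre : (Complex.I * k).re < 0 := by simpa using hk
  -- The operator `p'' + k² p` factors as `(d/dx + ik)(d/dx - ik)`. The outer factor is solved after
  -- the reflection `x ↦ -x`, which gives its exponent the decaying sign.
  obtain ⟨g, hg, mg⟩ := exists_primitive_of_first_order hre
    (hf.comp_measurePreserving (Measure.measurePreserving_neg volume))
  have mg' : MemLp (fun x => g (-x)) 2 volume :=
    mg.comp_measurePreserving (Measure.measurePreserving_neg volume)
  have hg' : IsPrimitiveOf (fun x => g (-x)) (fun x => -(Complex.I * k * g (-x) + f x)) := by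
    simpa using hg.comp_neg
  obtain ⟨p, hp, mp⟩ := exists_primitive_of_first_order hre mg'
  refine ⟨p, fun x => Complex.I * k * p x + g (-x), hp, ?_, mp, (mp.const_mul _).add mg'⟩
  refine ((hp.const_smul (Complex.I * k)).add hg').congr_ae (.of_forall fun x => ?_)
  simp only [smul_eq_mul]
  linear_combination k ^ 2 * p x * Complex.I_sq

/-! ### Domains of the operators -/

/-- `φ` coincides with `l` on the left and with `r` on the right half-line. -/
structure IsPiecewise (φ : L2) (l r : ℝ → ℂ) : Prop where
  left : ∀ᵐ x, x < 0 → φ x = l x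
  right : ∀ᵐ x, 0 < x → φ x = r x

namespace IsPiecewise

variable {φ φ₁ : L2} {l l₁ r r₁ : ℝ → ℂ}

theorem memLp_left (h : IsPiecewise φ l r) : MemLp l 2 (volume.restrict (Iio 0)) :=
  ((Lp.memLp φ).restrict _).ae_eq ((ae_restrict_iff' measurableSet_Iio).2 h.left)

theorem memLp_right (h : IsPiecewise φ l r) : MemLp r 2 (volume.restrict (Ioi 0)) :=
  ((Lp.memLp φ).restrict _).ae_eq ((ae_restrict_iff' measurableSet_Ioi).2 h.right)

theorem of_ae_eq {p : ℝ → ℂ} (h : ∀ᵐ x, φ x = p x) : IsPiecewise φ p p :=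
  ⟨h.mono fun _ hx _ => hx, h.mono fun _ hx _ => hx⟩

theorem hasWeakDerivOn (h : IsPiecewise φ l r) (h₁ : IsPiecewise φ₁ l₁ r₁)
    (hl : IsPrimitiveOf l l₁) (hr : IsPrimitiveOf r r₁) : HasWeakDerivOn {0}ᶜ φ φ₁ :=
  ⟨locallyIntegrableOn_L2 _ _, locallyIntegrableOn_L2 _ _, fun τ hτ hc hs =>
    integral_deriv_smul_piecewise hl hr h.left h.right h₁.left h₁.right hτ hc (by
      have : τ 0 = 0 := image_eq_zero_of_notMem_tsupport fun h0 => hs h0 rfl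
      rw [this, zero_smul, zero_smul])⟩

theorem limLeft (h : IsPiecewise φ l r) (hl : Continuous l) : LimLeft φ (l 0) := by
  refine ((hl.tendsto 0).mono_left (inf_le_left.trans nhdsWithin_le_nhds)).congr' ?_
  have h1 : ∀ᶠ x : ℝ in 𝓝[<] 0 ⊓ ae volume, x < 0 :=
    (eventually_mem_nhdsWithin).filter_mono inf_le_left
  filter_upwards [h1, h.left.filter_mono inf_le_right] with x hx hx' using (hx' hx).symm

theorem limRight (h : IsPiecewise φ l r) (hr : Continuous r) : LimRight φ (r 0) := by
  refine ((hr.tendsto 0).mono_left (inf_le_left.trans nhdsWithin_le_nhds)).congr' ?_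
  have h1 : ∀ᶠ x : ℝ in 𝓝[>] 0 ⊓ ae volume, 0 < x :=
    (eventually_mem_nhdsWithin).filter_mono inf_le_left
  filter_upwards [h1, h.right.filter_mono inf_le_right] with x hx hx' using (hx' hx).symm

end IsPiecewise

theorem hasWeakDerivOn_of_primitive {φ φ₁ : L2} {p q : ℝ → ℂ} (h : ∀ᵐ x, φ x = p x)
    (h₁ : ∀ᵐ x, φ₁ x = q x) (hp : IsPrimitiveOf p q) (Ω : Set ℝ) : HasWeakDerivOn Ω φ φ₁ :=
  ⟨locallyIntegrableOn_L2 _ _, locallyIntegrableOn_L2 _ _, fun _ hτ hc _ =>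
    integral_deriv_smul_piecewise hp hp (h.mono fun _ hx _ => hx) (h.mono fun _ hx _ => hx)
      (h₁.mono fun _ hx _ => hx) (h₁.mono fun _ hx _ => hx) hτ hc rfl⟩

/-- One-sided neighbourhoods of `0` have positive measure. This makes the limits in `LimRight`
unique. -/
instance neBot_nhdsGT_inf_ae : (𝓝[>] (0 : ℝ) ⊓ ae volume).NeBot := by
  refine inf_neBot_iff.2 fun {s} hs {t} ht => ?_
  obtain ⟨δ, hδ, hs'⟩ := mem_nhdsGT_iff_exists_Ioo_subset.1 hs
  by_contra hne
  have : Ioo 0 δ ⊆ tᶜ := fun x hx hxt => hne ⟨x, hs' hx, hxt⟩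
  have h0 := measure_mono_null this ht
  rw [Real.volume_Ioo, ENNReal.ofReal_eq_zero] at h0
  linarith [mem_Ioi.1 hδ]

instance neBot_nhdsLT_inf_ae : (𝓝[<] (0 : ℝ) ⊓ ae volume).NeBot := by
  refine inf_neBot_iff.2 fun {s} hs {t} ht => ?_
  obtain ⟨δ, hδ, hs'⟩ := mem_nhdsLT_iff_exists_Ioo_subset.1 hs
  by_contra hne
  have : Ioo δ 0 ⊆ tᶜ := fun x hx hxt => hne ⟨x, hs' hx, hxt⟩
  have h0 := measure_mono_null this ht
  rw [Real.volume_Ioo, ENNReal.ofReal_eq_zero] at h0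
  linarith [mem_Iio.1 hδ]

/-- Each half-line has its own representative, extended across the origin as a primitive of the same
`φ₂`; the values at `0` are then the one-sided limits in the interface conditions. -/
theorem exists_piecewise {φ φ₁ φ₂ : L2} (h₁ : HasWeakDerivOn {0}ᶜ φ φ₁)
    (h₂ : HasWeakDerivOn {0}ᶜ φ₁ φ₂) :
    ∃ l l₁ r r₁ : ℝ → ℂ, IsPrimitiveOf l l₁ ∧ IsPrimitiveOf l₁ φ₂ ∧ IsPrimitiveOf r r₁ ∧
      IsPrimitiveOf r₁ φ₂ ∧ IsPiecewise φ l r ∧ IsPiecewise φ₁ l₁ r₁ := by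
  have sl : Iio (0 : ℝ) ⊆ {0}ᶜ := fun x hx => ne_of_lt hx
  have sr : Ioi (0 : ℝ) ⊆ {0}ᶜ := fun x hx => ne_of_gt hx
  obtain ⟨l, l₁, a1, a2, a3, a4⟩ :=
    exists_representative isOpen_Iio ordConnected_Iio (h₁.mono sl) (h₂.mono sl)
  obtain ⟨r, r₁, b1, b2, b3, b4⟩ :=
    exists_representative isOpen_Ioi ordConnected_Ioi (h₁.mono sr) (h₂.mono sr)
  exact ⟨l, l₁, r, r₁, a1, a2, b1, b2, ⟨a3, b3⟩, ⟨a4, b4⟩⟩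

theorem inner_L2_eq (φ ψ : L2) :
    (inner ℂ φ ψ : ℂ) = ∫ x, ψ x * starRingEnd ℂ (φ x) := by
  rw [L2.inner_def]
  simp only [RCLike.inner_apply]

/-- Green's formula on both half-lines: symmetry of an operator reduces to the continuity of a
boundary form at `0`. -/
theorem im_inner_secondDeriv {φ φ₁ φ₂ : L2} {l l₁ r r₁ : ℝ → ℂ} (hl : IsPrimitiveOf l l₁)
    (hl₁ : IsPrimitiveOf l₁ φ₂) (hr : IsPrimitiveOf r r₁) (hr₁ : IsPrimitiveOf r₁ φ₂)
    (h : IsPiecewise φ l r) (h₁ : IsPiecewise φ₁ l₁ r₁) :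
    (inner ℂ φ φ₂ : ℂ).im =
      (l₁ 0 * starRingEnd ℂ (l 0)).im - (r₁ 0 * starRingEnd ℂ (r 0)).im := by
  have hi : Integrable (fun x => φ₂ x * starRingEnd ℂ (φ x)) :=
    (Lp.memLp φ₂).integrable_mul (MemLp.conj (Lp.memLp φ))
  have e1 := im_integral_Iio_mul_conj hl hl₁ h.memLp_left h₁.memLp_left ((Lp.memLp φ₂).restrict _)
  have e2 := im_integral_Ioi_mul_conj hr hr₁ h.memLp_right h₁.memLp_right
    ((Lp.memLp φ₂).restrict _)
  have c1 : ∫ x in Iio 0, φ₂ x * starRingEnd ℂ (φ x) =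
      ∫ x in Iio 0, φ₂ x * starRingEnd ℂ (l x) := by
    refine setIntegral_congr_ae measurableSet_Iio ?_
    filter_upwards [h.left] with x hx h0
    rw [hx h0]
  have c2 : ∫ x in Ioi 0, φ₂ x * starRingEnd ℂ (φ x) =
      ∫ x in Ioi 0, φ₂ x * starRingEnd ℂ (r x) := by
    refine setIntegral_congr_ae measurableSet_Ioi ?_
    filter_upwards [h.right] with x hx h0
    rw [hx h0]
  rw [inner_L2_eq, ← intervalIntegral.integral_Iio_add_Ici (b := 0) hi.integrableOn
    hi.integrableOn, integral_Ici_eq_integral_Ioi, c1, c2, Complex.add_im, e1, e2, sub_eq_add_neg]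

theorem negSecondDeriv_apply {Ω : Set ℝ} (hΩ : IsOpen Ω) (h0 : volume Ωᶜ = 0)
    (φ : (negSecondDeriv Ω hΩ h0).domain) {φ₁ φ₂ : L2} (h1 : HasWeakDerivOn Ω (φ : L2) φ₁)
    (h2 : HasWeakDerivOn Ω φ₁ φ₂) : negSecondDeriv Ω hΩ h0 φ = -φ₂ :=
  congrArg Neg.neg (secondDeriv_eq hΩ h0 φ h1 h2)

/-! ### The point interaction -/

theorem exists_of_mem_pointInteraction_domain {γ₁ γ₂ : ℝ}
    (φ : (pointInteraction γ₁ γ₂).domain) :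
    ∃ (φ₁ φ₂ : L2) (l l₁ r r₁ : ℝ → ℂ), IsPrimitiveOf l l₁ ∧ IsPrimitiveOf l₁ φ₂ ∧
      IsPrimitiveOf r r₁ ∧ IsPrimitiveOf r₁ φ₂ ∧ IsPiecewise φ l r ∧ IsPiecewise φ₁ l₁ r₁ ∧
      r 0 = γ₁ * l 0 ∧ r₁ 0 = (γ₁ : ℂ)⁻¹ * l₁ 0 + γ₂ * l 0 ∧
      pointInteraction γ₁ γ₂ φ = -φ₂ := by
  obtain ⟨φ₁, φ₂, h1, h2⟩ := φ.2.2
  obtain ⟨ψ, hψ, m, p, m', p', a1, a2, a3, a4, e1, e2⟩ := φ.2.1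
  obtain rfl : ψ = φ₁ := hψ.unique isOpen_compl_singleton (by simp) h1
  obtain ⟨l, l₁, r, r₁, hl, hl₁, hr, hr₁, hφ, hφ₁⟩ := exists_piecewise h1 h2
  obtain rfl := tendsto_nhds_unique a1 (hφ.limLeft hl.continuous)
  obtain rfl := tendsto_nhds_unique a2 (hφ.limRight hr.continuous)
  obtain rfl := tendsto_nhds_unique a3 (hφ₁.limLeft hl₁.continuous)
  obtain rfl := tendsto_nhds_unique a4 (hφ₁.limRight hr₁.continuous)
  exact ⟨ψ, φ₂, l, l₁, r, r₁, hl, hl₁, hr, hr₁, hφ, hφ₁, e1, e2,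
    negSecondDeriv_apply isOpen_compl_singleton (by simp) ⟨φ, φ.2.2⟩ h1 h2⟩

theorem mem_pointInteraction_domain {γ₁ γ₂ : ℝ} {φ φ₁ φ₂ : L2} {l l₁ l₂ r r₁ r₂ : ℝ → ℂ}
    (hl : IsPrimitiveOf l l₁) (hl₁ : IsPrimitiveOf l₁ l₂) (hr : IsPrimitiveOf r r₁)
    (hr₁ : IsPrimitiveOf r₁ r₂) (h : IsPiecewise φ l r) (h₁ : IsPiecewise φ₁ l₁ r₁)
    (h₂ : IsPiecewise φ₂ l₂ r₂) (e : r 0 = γ₁ * l 0)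
    (e₁ : r₁ 0 = (γ₁ : ℂ)⁻¹ * l₁ 0 + γ₂ * l 0) :
    ∃ hφ : φ ∈ (pointInteraction γ₁ γ₂).domain, pointInteraction γ₁ γ₂ ⟨φ, hφ⟩ = -φ₂ := by
  have w1 := h.hasWeakDerivOn h₁ hl hr
  have w2 := h₁.hasWeakDerivOn h₂ hl₁ hr₁
  have m2 : φ ∈ sobolevW22 {0}ᶜ := ⟨φ₁, φ₂, w1, w2⟩
  refine ⟨⟨⟨φ₁, w1, l 0, r 0, l₁ 0, r₁ 0, h.limLeft hl.continuous, h.limRight hr.continuous,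
    h₁.limLeft hl₁.continuous, h₁.limRight hr₁.continuous, e, e₁⟩, m2⟩, ?_⟩
  exact negSecondDeriv_apply isOpen_compl_singleton (by simp) ⟨φ, m2⟩ w1 w2

/-- The interface conditions alter the boundary form by `γ θ |l(0)|²`, which is real. -/
theorem im_inner_pointInteraction {θ : ℝ} (hθ : θ ≠ 0) (γ : ℝ)
    (φ : (pointInteraction θ γ).domain) :
    (inner ℂ (φ : L2) (pointInteraction θ γ φ) : ℂ).im = 0 := by
  obtain ⟨φ₁, φ₂, l, l₁, r, r₁, hl, hl₁, hr, hr₁, h, h₁, e, e₁, e2⟩ :=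
    exists_of_mem_pointInteraction_domain φ
  rw [e2, inner_neg_right, Complex.neg_im, im_inner_secondDeriv hl hl₁ hr hr₁ h h₁, e, e₁]
  have hθ' : (θ : ℂ) ≠ 0 := by exact_mod_cast hθ
  have : ((θ : ℂ)⁻¹ * l₁ 0 + γ * l 0) * starRingEnd ℂ (θ * l 0) =
      l₁ 0 * starRingEnd ℂ (l 0) + ((γ * θ * Complex.normSq (l 0) : ℝ) : ℂ) := by
    rw [map_mul, Complex.conj_ofReal]
    push_cast
    rw [← Complex.mul_conj]
    field_simp
  rw [this, Complex.add_im, Complex.ofReal_im, add_zero, sub_self, neg_zero]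

/-- This is the determinant met when outgoing exponentials are fitted to the interface conditions.
Its imaginary part is `Re k · (θ + θ⁻¹)`, where `Re k ≠ 0` as `k²` is not real, and `θ + θ⁻¹` has no
real zero. -/
theorem interface_det_ne_zero {k : ℂ} (hk : (k ^ 2).im ≠ 0) {θ : ℝ} (hθ : θ ≠ 0) (γ : ℝ) :
    Complex.I * k * (θ + (θ : ℂ)⁻¹) - γ ≠ 0 := by
  intro h
  have h1 := congrArg Complex.im h
  have e : Complex.I * k * (θ + (θ : ℂ)⁻¹) - γ =
      Complex.I * k * ((θ + θ⁻¹ : ℝ) : ℂ) - (γ : ℝ) := by push_cast; ring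
  rw [e] at h1
  simp only [Complex.sub_im, Complex.mul_im, Complex.I_re, Complex.I_im,
    Complex.ofReal_im, Complex.ofReal_re, Complex.zero_im] at h1
  have h2 : k.re ≠ 0 := fun h => hk (by rw [sq, Complex.mul_im, h]; ring)
  have h3 : θ + θ⁻¹ ≠ 0 := by
    have : θ + θ⁻¹ = (θ ^ 2 + 1) / θ := by field_simp
    rw [this]; positivity
  have h4 : k.re * (θ + θ⁻¹) = 0 := by linarith
  exact (mul_ne_zero h2 h3) h4

theorem memLp_exp_Ioi {k : ℂ} (hk : 0 < k.im) :
    MemLp (fun x : ℝ => Complex.exp (Complex.I * k * x)) 2 (volume.restrict (Ioi 0)) := by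
  refine (memLp_two_iff_integrable_sq_norm (by fun_prop)).2 ?_
  refine (integrableOn_exp_mul_Ioi (a := -(2 * k.im)) (by linarith) 0).congr
    (.of_forall fun x => ?_)
  simp only
  rw [Complex.norm_exp, ← Real.exp_nat_mul]
  congr 1
  simp; ring

theorem isPrimitiveOf_exp (κ c : ℂ) :
    IsPrimitiveOf (fun x : ℝ => c * Complex.exp (κ * x))
      (fun x => c * κ * Complex.exp (κ * x)) := by
  refine .of_hasDerivAt (fun x => ?_) (by fun_prop)
  have h1 : HasDerivAt (fun x : ℝ => κ * (x : ℂ)) κ x := by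
    simpa using (hasDerivAt_id x).ofReal_comp.const_mul κ
  refine (h1.cexp.const_mul c).congr_deriv (by ring)

theorem exists_isPiecewise {l r : ℝ → ℂ} (hl : MemLp l 2 (volume.restrict (Iio 0)))
    (hr : MemLp r 2 (volume.restrict (Ioi 0))) : ∃ φ : L2, IsPiecewise φ l r := by
  classical
  have hr' : MemLp r 2 (volume.restrict (Iio 0)ᶜ) := by
    rwa [compl_Iio, ← restrict_Ioi_eq_restrict_Ici]
  have h := MemLp.piecewise measurableSet_Iio hl hr'
  refine ⟨h.toLp, ?_, ?_⟩
  · filter_upwards [h.coeFn_toLp] with x hx h0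
    rw [hx, piecewise_eq_of_mem _ _ _ (mem_Iio.2 h0)]
  · filter_upwards [h.coeFn_toLp] with x hx h0
    rw [hx, piecewise_eq_of_notMem _ _ _ (by simpa using h0.le)]

/-- The free solution is corrected by `c e^{-ikx}` on the left and `d e^{ikx}` on the right; the
interface conditions become a linear system for `c` and `d`. -/
theorem surjective_pointInteraction {θ : ℝ} (hθ : θ ≠ 0) (γ : ℝ) {z : ℂ} (hz : z.im ≠ 0)
    (f : L2) : ∃ φ : (pointInteraction θ γ).domain,
      pointInteraction θ γ φ - z • (φ : L2) = f := by
  obtain ⟨k, rfl, hk⟩ := exists_sqrt_im_pos hz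
  obtain ⟨p, q, hp, hq, mp, mq⟩ := exists_free_solution hk (Lp.memLp f)
  have hΔ := interface_det_ne_zero hz hθ γ
  set Δ := Complex.I * k * (θ + (θ : ℂ)⁻¹) - γ with hΔd
  -- The first condition expresses `d` through `c`; inserted in the second, it leaves one equation
  -- for `c` with coefficient `Δ`.
  set c : ℂ := ((θ : ℂ)⁻¹ * q 0 - q 0 + γ * p 0 - Complex.I * k * (θ - 1) * p 0) / Δ with hc
  set d : ℂ := θ * c + (θ - 1) * p 0 with hd
  have eR : MemLp (fun x : ℝ => Complex.exp (Complex.I * k * x)) 2 (volume.restrict (Ioi 0)) :=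
    memLp_exp_Ioi hk
  have eL : MemLp (fun x : ℝ => Complex.exp (-(Complex.I * k) * x)) 2
      (volume.restrict (Iio 0)) := by
    have h := (Measure.measurePreserving_neg (volume : Measure ℝ)).restrict_preimage
      (measurableSet_Ioi (a := 0))
    have hs : Neg.neg ⁻¹' Ioi (0 : ℝ) = Iio 0 := by ext x; simp
    rw [hs] at h
    refine (eR.comp_measurePreserving h).ae_eq (.of_forall fun x => ?_)
    simp
  have pl := hp.add (isPrimitiveOf_exp (-(Complex.I * k)) c)
  have pl₁ := hq.add (isPrimitiveOf_exp (-(Complex.I * k)) (c * -(Complex.I * k)))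
  have pr := hp.add (isPrimitiveOf_exp (Complex.I * k) d)
  have pr₁ := hq.add (isPrimitiveOf_exp (Complex.I * k) (d * (Complex.I * k)))
  obtain ⟨φ, hφ⟩ := exists_isPiecewise (mp.restrict _ |>.add (eL.const_mul c))
    (mp.restrict _ |>.add (eR.const_mul d))
  obtain ⟨φ₁, hφ₁⟩ := exists_isPiecewise
    (mq.restrict _ |>.add (eL.const_mul (c * -(Complex.I * k))))
    (mq.restrict _ |>.add (eR.const_mul (d * (Complex.I * k))))
  have hcoe : ∀ᵐ x, (-(k ^ 2) • φ - f : L2) x = -k ^ 2 * φ x - f x := by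
    filter_upwards [Lp.coeFn_sub (-(k ^ 2) • φ) f, Lp.coeFn_smul (-(k ^ 2)) φ] with x h1 h2
    rw [h1, Pi.sub_apply, h2, Pi.smul_apply, smul_eq_mul]
  have key : ∃ hm : φ ∈ (pointInteraction θ γ).domain,
      pointInteraction θ γ ⟨φ, hm⟩ = -(-(k ^ 2) • φ - f) := by
    refine mem_pointInteraction_domain pl pl₁ pr pr₁ hφ hφ₁ ⟨?_, ?_⟩ ?_ ?_
    · filter_upwards [hcoe, hφ.left] with x h1 h2 h0
      rw [h1, h2 h0]
      simp only [Pi.add_apply]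
      linear_combination (-(c * k ^ 2 * Complex.exp (-(Complex.I * k) * x))) * Complex.I_sq
    · filter_upwards [hcoe, hφ.right] with x h1 h2 h0
      rw [h1, h2 h0]
      simp only [Pi.add_apply]
      linear_combination (-(d * k ^ 2 * Complex.exp (Complex.I * k * x))) * Complex.I_sq
    · simp [hd]; ring
    · have hθ' : (θ : ℂ) ≠ 0 := by exact_mod_cast hθ
      have hcΔ : c * Δ = (θ : ℂ)⁻¹ * q 0 - q 0 + γ * p 0 - Complex.I * k * (θ - 1) * p 0 :=
        div_mul_cancel₀ _ hΔ
      rw [hΔd] at hcΔ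
      simp only [Complex.ofReal_zero, mul_zero, Complex.exp_zero, mul_one, hd]
      linear_combination hcΔ
  obtain ⟨hm, e⟩ := key
  refine ⟨⟨φ, hm⟩, ?_⟩
  rw [e]
  simp

theorem exists_resolvent_pointInteraction {θ : ℝ} (hθ : θ ≠ 0) (γ : ℝ) {z : ℂ}
    (hz : z.im ≠ 0) :
    ∃ R : L2 →L[ℂ] L2, IsResolvent (pointInteraction θ γ) z R ∧
      ∀ f, ‖R f‖ ≤ |z.im|⁻¹ * ‖f‖ := by
  obtain ⟨R, h1, h2, h3⟩ := exists_resolvent (abs_pos.2 hz)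
    (fun φ => abs_im_mul_norm_le (im_inner_pointInteraction hθ γ φ) z)
    (surjective_pointInteraction hθ γ hz)
  exact ⟨R, ⟨h1, h2⟩, h3⟩

/-! ### The Schrödinger operators -/

theorem exists_of_mem_negSecondDeriv_domain
    (φ : (negSecondDeriv univ isOpen_univ (by simp)).domain) :
    ∃ (φ₁ φ₂ : L2) (p q : ℝ → ℂ), IsPrimitiveOf p q ∧ IsPrimitiveOf q φ₂ ∧
      (∀ᵐ x, (φ : L2) x = p x) ∧ (∀ᵐ x, φ₁ x = q x) ∧
      negSecondDeriv univ isOpen_univ (by simp) φ = -φ₂ := by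
  obtain ⟨φ₁, φ₂, h1, h2⟩ := φ.2
  obtain ⟨p, q, hp, hq, e, e₁⟩ := exists_representative isOpen_univ ordConnected_univ h1 h2
  exact ⟨φ₁, φ₂, p, q, hp, hq, e.mono fun x hx => hx (mem_univ x),
    e₁.mono fun x hx => hx (mem_univ x), negSecondDeriv_apply isOpen_univ (by simp) φ h1 h2⟩

theorem im_inner_negSecondDeriv (φ : (negSecondDeriv univ isOpen_univ (by simp)).domain) :
    (inner ℂ (φ : L2) (negSecondDeriv univ isOpen_univ (by simp) φ) : ℂ).im = 0 := by
  obtain ⟨φ₁, φ₂, p, q, hp, hq, e, e₁, e2⟩ := exists_of_mem_negSecondDeriv_domain φ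
  rw [e2, inner_neg_right, Complex.neg_im,
    im_inner_secondDeriv hp hq hp hq (.of_ae_eq e) (.of_ae_eq e₁), sub_self, neg_zero]

theorem surjective_negSecondDeriv {z : ℂ} (hz : z.im ≠ 0) (f : L2) :
    ∃ φ : (negSecondDeriv univ isOpen_univ (by simp)).domain,
      negSecondDeriv univ isOpen_univ (by simp) φ - z • (φ : L2) = f := by
  obtain ⟨k, rfl, hk⟩ := exists_sqrt_im_pos hz
  obtain ⟨p, q, hp, hq, mp, mq⟩ := exists_free_solution hk (Lp.memLp f)
  have w1 := hasWeakDerivOn_of_primitive mp.coeFn_toLp mq.coeFn_toLp hp univ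
  have w2 := hasWeakDerivOn_of_primitive (φ₁ := -(k ^ 2) • mp.toLp - f) mq.coeFn_toLp (by
    filter_upwards [Lp.coeFn_sub (-(k ^ 2) • mp.toLp) f, Lp.coeFn_smul (-(k ^ 2)) (mp.toLp p),
      mp.coeFn_toLp] with x h1 h2 h3
    rw [h1, Pi.sub_apply, h2, Pi.smul_apply, smul_eq_mul, h3]) hq univ
  refine ⟨⟨mp.toLp, _, _, w1, w2⟩, ?_⟩
  rw [negSecondDeriv_apply isOpen_univ (by simp) _ w1 w2]
  simp

theorem mulOp_coe {V : ℝ → ℝ} (hV : MemLp V ⊤ volume) (φ : L2) :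
    ∀ᵐ x, mulOp V hV φ x = V x * φ x := by
  filter_upwards [MemLp.coeFn_toLp ((Lp.memLp φ).smul hV :
    MemLp (V • (φ : ℝ → ℂ)) 2 volume)] with x hx
  change (((Lp.memLp φ).smul hV : MemLp (V • (φ : ℝ → ℂ)) 2 volume).toLp) x = _
  rw [hx, Pi.smul_apply', Complex.real_smul]

theorem im_inner_mulOp {V : ℝ → ℝ} (hV : MemLp V ⊤ volume) (φ : L2) :
    (inner ℂ φ (mulOp V hV φ) : ℂ).im = 0 := by
  have : (inner ℂ φ (mulOp V hV φ) : ℂ) = ∫ x, ((V x * Complex.normSq (φ x) : ℝ) : ℂ) := by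
    rw [inner_L2_eq]
    refine integral_congr_ae ?_
    filter_upwards [mulOp_coe hV φ] with x hx
    rw [hx, mul_assoc, Complex.mul_conj]; push_cast; rfl
  rw [this, integral_complex_ofReal, Complex.ofReal_im]

theorem twoScalePotential_bounded {Φ Ψ : ℝ → ℝ} (hΦ : IsPotential Φ) (hΨ : IsPotential Ψ)
    (α β ε ν : ℝ) : ∃ K : ℝ, ∀ x, |twoScalePotential Φ Ψ α β ε ν x| ≤ K := by
  obtain ⟨M, -, hM⟩ := hΦ.exists_bound (α / ε ^ 2)
  obtain ⟨N, -, hN⟩ := hΨ.exists_bound (β / ν)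
  exact ⟨M + N, fun x => (abs_add_le _ _).trans (add_le_add (hM _) (hN _))⟩

theorem schrodinger_apply {Φ Ψ : ℝ → ℝ} (hΦ : IsPotential Φ) (hΨ : IsPotential Ψ)
    (α β ε ν : ℝ) (φ : (schrodinger hΦ hΨ α β ε ν).domain) :
    schrodinger hΦ hΨ α β ε ν φ =
      mulOp _ (memLp_twoScalePotential hΦ hΨ α β ε ν) φ +
        negSecondDeriv univ isOpen_univ (by simp) φ := rfl

/-- The potential is a bounded symmetric perturbation of the free operator. The norm bound does not
see its size, so it is uniform in `ε` and `ν`, as the comparison requires. -/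
theorem exists_resolvent_schrodinger {Φ Ψ : ℝ → ℝ} (hΦ : IsPotential Φ) (hΨ : IsPotential Ψ)
    (α β ε ν : ℝ) {z : ℂ} (hz : z.im ≠ 0) :
    ∃ R : L2 →L[ℂ] L2, IsResolvent (schrodinger hΦ hΨ α β ε ν) z R ∧
      ∀ f, ‖R f‖ ≤ |z.im|⁻¹ * ‖f‖ := by
  have hV := memLp_twoScalePotential hΦ hΨ α β ε ν
  obtain ⟨K, hK⟩ := twoScalePotential_bounded hΦ hΨ α β ε ν
  have hb : ∀ φ : L2, ‖mulOp _ hV φ‖ ≤ K * ‖φ‖ := fun φ => by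
    refine Lp.norm_le_mul_norm_of_ae_le_mul ?_
    filter_upwards [mulOp_coe hV φ] with x hx
    rw [hx, norm_mul, Complex.norm_real]
    exact mul_le_mul_of_nonneg_right (hK x) (norm_nonneg _)
  have hs := surjective_add_symmetric hz im_inner_negSecondDeriv (surjective_negSecondDeriv hz)
    ((mulOp _ hV).mkContinuous K hb) (im_inner_mulOp hV)
  have hsym : ∀ φ : (schrodinger hΦ hΨ α β ε ν).domain,
      (inner ℂ (φ : L2) (schrodinger hΦ hΨ α β ε ν φ) : ℂ).im = 0 := fun φ => by
    rw [schrodinger_apply, inner_add_right, Complex.add_im, im_inner_mulOp hV,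
      zero_add]
    exact im_inner_negSecondDeriv φ
  obtain ⟨R, h1, h2, h3⟩ := exists_resolvent (A := schrodinger hΦ hΨ α β ε ν) (abs_pos.2 hz)
    (fun φ => abs_im_mul_norm_le (hsym φ) z) (fun f => by
      obtain ⟨φ, hφ⟩ := hs f
      refine ⟨φ, ?_⟩
      rw [← hφ, add_comm (negSecondDeriv _ _ _ φ)]
      rfl)
  exact ⟨R, ⟨h1, h2⟩, h3⟩

/-! ### Transfer across the support of the potential -/

/-- The setting of a solution `p` of `-p'' + (a + ψ) p = h` on `[-ν, ν]`, where `a` is concentrated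
on `[-ε, ε]` and has the half-bound state `U`. -/
structure TransferData (ε ν θ K L M : ℝ) (U U₁ a ψ : ℝ → ℝ) (p q s h : ℝ → ℂ) : Prop where
  pos : 0 < ε
  le : ε ≤ ν
  theta : θ ≠ 0
  one_le : 1 ≤ M
  nonneg : 0 ≤ L
  nonneg' : 0 ≤ K
  prim : IsPrimitiveOf U U₁
  prim₁ : IsPrimitiveOf U₁ (fun x => a x * U x)
  bound_a : ∀ x, |a x| ≤ K / ε ^ 2
  bound_U : ∀ x, |U x| ≤ M
  left : ∀ x ≤ -ε, U x = 1 ∧ U₁ x = 0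
  right : ∀ x, ε ≤ x → U x = θ ∧ U₁ x = 0
  int_ψ : LocallyIntegrable ψ
  bound_ψ : ∀ x, |ψ x| ≤ L / ν
  sol : IsPrimitiveOf p q
  sol₁ : IsPrimitiveOf q s
  int_h : LocallyIntegrable h
  eqn : ∀ᵐ x, s x = (a x + ψ x) • p x - h x

namespace TransferData

variable {ε ν θ K L M : ℝ} {U U₁ a ψ : ℝ → ℝ} {p q s h : ℝ → ℂ}

theorem nu_pos (D : TransferData ε ν θ K L M U U₁ a ψ p q s h) : 0 < ν := D.pos.trans_le D.le

/-- `U` solves the equation with potential `a`, so `a` drops out and nothing of size `ε⁻²` remains.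
-/
theorem wronskian (D : TransferData ε ν θ K L M U U₁ a ψ p q s h) :
    IsPrimitiveOf (fun x => U x • q x - U₁ x • p x) (fun x => U x • (ψ x • p x - h x)) := by
  refine ((D.prim.smul D.sol₁).sub (D.prim₁.smul D.sol)).congr_ae ?_
  filter_upwards [D.eqn] with x hx
  rw [hx]
  simp only [Complex.real_smul]
  push_cast; ring

theorem integrable_source (D : TransferData ε ν θ K L M U U₁ a ψ p q s h) (x y m : ℝ) :
    IntervalIntegrable (fun x => L / ν * m + ‖h x‖) volume x y :=
  (intervalIntegrable_const).add (intervalIntegrable_of_locallyIntegrable D.int_h x y).norm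

theorem integral_source_le (D : TransferData ε ν θ K L M U U₁ a ψ p q s h) {m : ℝ} (hm : 0 ≤ m)
    {x y : ℝ} (hx : -ν ≤ x) (hxy : x ≤ y) (hy : y ≤ ν) :
    ∫ t in x..y, (L / ν * m + ‖h t‖) ≤ 2 * L * m + ∫ t in (-ν)..ν, ‖h t‖ := by
  have hν := D.nu_pos
  have hL := D.nonneg
  refine (intervalIntegral.integral_mono_interval hx hxy hy
    (.of_forall fun t => by positivity) (D.integrable_source (-ν) ν m)).trans (le_of_eq ?_)
  rw [intervalIntegral.integral_add intervalIntegrable_const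
    (intervalIntegrable_of_locallyIntegrable D.int_h _ _).norm, intervalIntegral.integral_const,
    smul_eq_mul]
  congr 1
  field_simp; ring

theorem norm_wronskian_sub_le (D : TransferData ε ν θ K L M U U₁ a ψ p q s h) {m : ℝ}
    (hm : ∀ x ∈ Icc (-ν) ν, ‖p x‖ ≤ m) {x : ℝ} (hx : x ∈ Icc (-ν) ν) :
    ‖(U x • q x - U₁ x • p x) - q (-ν)‖ ≤ M * (2 * L * m + ∫ t in (-ν)..ν, ‖h t‖) := by
  have hν := D.nu_pos
  have hL := D.nonneg
  have hM := D.one_le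
  have hm0 : 0 ≤ m := (norm_nonneg _).trans (hm x hx)
  have e : (U x • q x - U₁ x • p x) - q (-ν) =
      (U x • q x - U₁ x • p x) - (U (-ν) • q (-ν) - U₁ (-ν) • p (-ν)) := by
    rw [(D.left (-ν) (neg_le_neg D.le)).1, (D.left (-ν) (neg_le_neg D.le)).2]; simp
  rw [e]
  refine (D.wronskian.norm_sub_le hx.1).trans ?_
  have h1 : ∫ t in (-ν)..x, ‖U t • (ψ t • p t - h t)‖ ≤
      ∫ t in (-ν)..x, M * (L / ν * m + ‖h t‖) := by
    refine intervalIntegral.integral_mono_on hx.1 (D.wronskian.intervalIntegrable _ _).norm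
      ((D.integrable_source _ _ m).const_mul M) fun t ht => ?_
    rw [norm_smul, Real.norm_eq_abs]
    refine mul_le_mul (D.bound_U t) ((norm_sub_le _ _).trans ?_) (norm_nonneg _) (by linarith)
    rw [norm_smul, Real.norm_eq_abs]
    have := mul_le_mul (D.bound_ψ t) (hm t ⟨ht.1, ht.2.trans hx.2⟩) (norm_nonneg _)
      (by positivity)
    linarith
  refine h1.trans ?_
  rw [intervalIntegral.integral_const_mul]
  exact mul_le_mul_of_nonneg_left (D.integral_source_le hm0 le_rfl hx.1 hx.2) (by linarith)

/-- The difference `P = p - U p(-ν)` vanishes at `-ν`. Off `[-ε, ε]` its derivative is the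
Wronskian, up to the factor `θ⁻¹` on the right; across `[-ε, ε]` the scaled Grönwall estimate
applies. -/
theorem norm_sub_smul_le (D : TransferData ε ν θ K L M U U₁ a ψ p q s h) {m : ℝ}
    (hm : ∀ x ∈ Icc (-ν) ν, ‖p x‖ ≤ m) {x : ℝ} (hx : x ∈ Icc (-ν) ν) :
    ‖p x - U x • p (-ν)‖ ≤ (3 * Real.exp (2 * (1 + K)) + |θ|⁻¹) * ν *
      (‖q (-ν)‖ + M * (2 * L * m + ∫ t in (-ν)..ν, ‖h t‖)) := by
  have hν := D.nu_pos
  have hε := D.pos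
  have hεν := D.le
  have hL := D.nonneg
  have hM := D.one_le
  have hK := D.nonneg'
  have hm0 : 0 ≤ m := (norm_nonneg _).trans (hm x hx)
  have hθ : 0 < |θ| := abs_pos.2 D.theta
  set H := ∫ t in (-ν)..ν, ‖h t‖ with hH
  have hH0 : 0 ≤ H := intervalIntegral.integral_nonneg (by linarith) fun t _ => norm_nonneg _
  set w := ‖q (-ν)‖ + M * (2 * L * m + H) with hw
  set c := p (-ν) with hc
  have hS0 : 0 ≤ 2 * L * m + H := by positivity
  have hSw : 2 * L * m + H ≤ w := by
    have := le_mul_of_one_le_left hS0 hM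
    linarith [norm_nonneg (q (-ν))]
  have hw0 : 0 ≤ w := hS0.trans hSw
  have hW : ∀ x ∈ Icc (-ν) ν, ‖U x • q x - U₁ x • p x‖ ≤ w := fun x hx => by
    have := D.norm_wronskian_sub_le hm hx
    have h2 := norm_le_norm_add_norm_sub' (U x • q x - U₁ x • p x) (q (-ν))
    linarith
  have hC : ∀ F f : ℝ → ℝ, IsPrimitiveOf F f →
      IsPrimitiveOf (fun x => F x • c) (fun x => f x • c) := fun F f hF =>
    hF.comp_continuousLinearMap ((ContinuousLinearMap.id ℝ ℝ).smulRight c)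
  have pP : IsPrimitiveOf (fun x => p x - U x • c) (fun x => q x - U₁ x • c) :=
    D.sol.sub (hC _ _ D.prim)
  have pQ : IsPrimitiveOf (fun x => q x - U₁ x • c) (fun x => s x - (a x * U x) • c) :=
    D.sol₁.sub (hC _ _ D.prim₁)
  have hP0 : p (-ν) - U (-ν) • c = 0 := by
    rw [(D.left (-ν) (by linarith)).1, one_smul, sub_self]
  -- the left part
  have qL : ∀ x ∈ Icc (-ν) (-ε), ‖q x - U₁ x • c‖ ≤ w := fun x hx => by
    have := hW x ⟨hx.1, by linarith [hx.2]⟩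
    rw [(D.left x hx.2).1, (D.left x hx.2).2] at this
    rw [(D.left x hx.2).2]
    simpa using this
  have PL : ∀ x ∈ Icc (-ν) (-ε), ‖p x - U x • c‖ ≤ ν * w := fun x hx => by
    have h1 := pP.integral_eq (-ν) x
    rw [hP0, sub_zero] at h1
    rw [← h1]
    refine (intervalIntegral.norm_integral_le_of_norm_le_const (C := w) fun t ht => ?_).trans ?_
    · rw [uIoc_of_le hx.1] at ht
      exact qL t ⟨ht.1.le, ht.2.trans hx.2⟩
    · rw [abs_of_nonneg (by linarith [hx.1]), mul_comm]
      exact mul_le_mul_of_nonneg_right (by linarith [hx.2]) hw0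
  -- the central part
  set E := Real.exp (2 * (1 + K)) with hE
  have hE1 : 1 ≤ E := Real.one_le_exp (by positivity)
  -- The factor `3` counts the value at `-ε`, `ε` times the derivative there, and `ε` times the
  -- integrated source, each at most `ν w`. The exponent is at most `(1 + K) / ε` times the length
  -- `2ε`.
  have PM : ∀ x ∈ Icc (-ε) ε, ‖p x - U x • c‖ ≤ 3 * E * ν * w := fun x hx => by
    have h1 := norm_add_norm_le_of_second_order pP pQ (a := -ε) (b := ε) hε hK
      (D.integrable_source _ _ m) (fun x => by positivity) (by
        filter_upwards [D.eqn] with t ht htm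
        have e : s t - (a t * U t) • c = a t • (p t - U t • c) + (ψ t • p t - h t) := by
          rw [ht]; simp only [Complex.real_smul]; push_cast; ring
        rw [e]
        refine (norm_add_le _ _).trans (add_le_add ?_ ((norm_sub_le _ _).trans ?_))
        · rw [norm_smul]
          exact mul_le_mul_of_nonneg_right (D.bound_a t) (norm_nonneg _)
        · rw [norm_smul]
          have := mul_le_mul (D.bound_ψ t) (hm t ⟨by linarith [htm.1], by linarith [htm.2]⟩)
            (norm_nonneg _) (by positivity)
          simpa using this) x hx
    have h2 := PL (-ε) ⟨by linarith, le_rfl⟩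
    have h3 := mul_le_mul hεν (qL (-ε) ⟨by linarith, le_rfl⟩) (norm_nonneg _) hν.le
    have h4 := mul_le_mul hεν ((D.integral_source_le hm0 (x := -ε) (y := ε) (by linarith)
      (by linarith) hεν).trans hSw) (intervalIntegral.integral_nonneg (by linarith)
        fun t _ => by positivity) hν.le
    have h5 : Real.exp ((1 + K) / ε * (x - -ε)) ≤ E := by
      refine Real.exp_le_exp.2 ?_
      rw [div_mul_eq_mul_div, div_le_iff₀ hε]
      nlinarith [hx.2]
    have h6 : (0 : ℝ) ≤ ε * ‖q x - U₁ x • c‖ := by positivity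
    calc ‖p x - U x • c‖ ≤ _ := le_trans (by linarith) h1
      _ ≤ (3 * ν * w) * E := by
        refine mul_le_mul (by linarith) h5 (Real.exp_pos _).le (by positivity)
      _ = 3 * E * ν * w := by ring
  -- the right part
  have qR : ∀ x ∈ Icc ε ν, ‖q x - U₁ x • c‖ ≤ |θ|⁻¹ * w := fun x hx => by
    have := hW x ⟨by linarith [hx.1], hx.2⟩
    rw [(D.right x hx.1).1, (D.right x hx.1).2, zero_smul, sub_zero, norm_smul,
      Real.norm_eq_abs] at this
    rw [(D.right x hx.1).2, zero_smul, sub_zero, inv_mul_eq_div, le_div_iff₀ hθ, mul_comm]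
    exact this
  have PR : ∀ x ∈ Icc ε ν, ‖p x - U x • c‖ ≤ 3 * E * ν * w + ν * (|θ|⁻¹ * w) := fun x hx => by
    have h1 := pP.integral_eq ε x
    have h2 : ‖∫ t in ε..x, (q t - U₁ t • c)‖ ≤ ν * (|θ|⁻¹ * w) := by
      refine (intervalIntegral.norm_integral_le_of_norm_le_const (C := |θ|⁻¹ * w)
        fun t ht => ?_).trans ?_
      · rw [uIoc_of_le hx.1] at ht
        exact qR t ⟨ht.1.le, ht.2.trans hx.2⟩
      · rw [abs_of_nonneg (sub_nonneg.2 hx.1), mul_comm]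
        exact mul_le_mul_of_nonneg_right (by linarith [hx.2]) (by positivity)
    rw [h1] at h2
    have h3 := PM ε ⟨by linarith, le_rfl⟩
    have h4 := norm_le_norm_add_norm_sub' (p x - U x • c) (p ε - U ε • c)
    linarith
  have hn : 0 ≤ ν * (|θ|⁻¹ * w) := by positivity
  have fin : ‖p x - U x • c‖ ≤ 3 * E * ν * w + ν * (|θ|⁻¹ * w) := by
    rcases le_total x (-ε) with h1 | h1
    · refine (PL x ⟨hx.1, h1⟩).trans ?_
      have : ν * w ≤ 3 * E * (ν * w) := le_mul_of_one_le_left (by positivity) (by linarith)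
      linarith
    · rcases le_total x ε with h2 | h2
      · exact (PM x ⟨h1, h2⟩).trans (by linarith)
      · exact PR x ⟨h2, hx.2⟩
  refine fin.trans (le_of_eq (by ring))

/-- `U²` differs from the step function with values `1` and `θ²` only on `[-ε, ε]`, where `|ψ| ≤ L /
ν`. This is where `ε/ν` enters the rate. -/
theorem abs_integral_sq_sub_le (D : TransferData ε ν θ K L M U U₁ a ψ p q s h) :
    |(∫ x in (-ν)..ν, U x ^ 2 * ψ x) -
      ((∫ x in (-ν)..0, ψ x) + θ ^ 2 * ∫ x in (0 : ℝ)..ν, ψ x)| ≤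
        4 * M ^ 2 * L * (ε / ν) := by
  have hν := D.nu_pos
  have hε := D.pos
  have hεν := D.le
  have hL := D.nonneg
  have iψ := intervalIntegrable_of_locallyIntegrable D.int_ψ
  have cU := D.prim.continuous
  have iU : ∀ x y, IntervalIntegrable (fun x => U x ^ 2 * ψ x) volume x y := fun x y =>
    (iψ x y).continuousOn_mul (by fun_prop)
  have hθM : |θ| ≤ M := by
    have := D.bound_U ε
    rwa [(D.right ε le_rfl).1] at this
  have sq_le : ∀ y : ℝ, |y| ≤ M → y ^ 2 ≤ M ^ 2 := fun y hy => sq_le_sq.2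
    (hy.trans (le_abs_self M))
  have hM1 : 1 ≤ M ^ 2 := one_le_pow₀ D.one_le
  have key : ∀ (κ : ℝ), 0 ≤ κ → κ ≤ M ^ 2 → ∀ x y : ℝ, x ≤ y → y - x ≤ ε →
      |∫ t in x..y, (U t ^ 2 - κ) * ψ t| ≤ 2 * M ^ 2 * L * (ε / ν) := by
    intro κ h0 h1 x y hxy hle
    have := intervalIntegral.norm_integral_le_of_norm_le_const (a := x) (b := y)
      (f := fun t => (U t ^ 2 - κ) * ψ t) (C := 2 * M ^ 2 * (L / ν)) (fun t _ => by
        rw [norm_mul]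
        refine mul_le_mul ?_ (D.bound_ψ t) (norm_nonneg _) (by positivity)
        have h2 := sq_le _ (D.bound_U t)
        rw [Real.norm_eq_abs, abs_le]
        constructor <;> nlinarith [sq_nonneg (U t)])
    rw [Real.norm_eq_abs] at this
    refine this.trans ?_
    rw [abs_of_nonneg (by linarith)]
    calc 2 * M ^ 2 * (L / ν) * (y - x) ≤ 2 * M ^ 2 * (L / ν) * ε :=
          mul_le_mul_of_nonneg_left hle (by positivity)
      _ = _ := by ring
  have e1 : (∫ x in (-ν)..0, U x ^ 2 * ψ x) - ∫ x in (-ν)..0, ψ x =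
      ∫ t in (-ε)..0, (U t ^ 2 - 1) * ψ t := by
    have iD : ∀ x y, IntervalIntegrable (fun t => (U t ^ 2 - 1) * ψ t) volume x y := fun x y =>
      (iψ x y).continuousOn_mul (by fun_prop)
    rw [← intervalIntegral.integral_sub (iU _ _) (iψ _ _)]
    have : ∀ t, U t ^ 2 * ψ t - ψ t = (U t ^ 2 - 1) * ψ t := fun t => by ring
    simp only [this]
    rw [← intervalIntegral.integral_add_adjacent_intervals (iD (-ν) (-ε)) (iD (-ε) 0),
      intervalIntegral.integral_congr (g := fun _ => 0), intervalIntegral.integral_zero, zero_add]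
    intro t ht
    rw [uIcc_of_le (by linarith)] at ht
    simp [(D.left t ht.2).1]
  have e2 : (∫ x in (0 : ℝ)..ν, U x ^ 2 * ψ x) - θ ^ 2 * ∫ x in (0 : ℝ)..ν, ψ x =
      ∫ t in (0 : ℝ)..ε, (U t ^ 2 - θ ^ 2) * ψ t := by
    have iD : ∀ x y, IntervalIntegrable (fun t => (U t ^ 2 - θ ^ 2) * ψ t) volume x y :=
      fun x y => (iψ x y).continuousOn_mul (by fun_prop)
    rw [← intervalIntegral.integral_const_mul,
      ← intervalIntegral.integral_sub (iU _ _) ((iψ _ _).const_mul _)]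
    have : ∀ t, U t ^ 2 * ψ t - θ ^ 2 * ψ t = (U t ^ 2 - θ ^ 2) * ψ t := fun t => by ring
    simp only [this]
    rw [← intervalIntegral.integral_add_adjacent_intervals (iD 0 ε) (iD ε ν)]
    rw [intervalIntegral.integral_congr (a := ε) (g := fun _ => 0),
      intervalIntegral.integral_zero, add_zero]
    intro t ht
    rw [uIcc_of_le (by linarith)] at ht
    simp [(D.right t ht.1).1]
  rw [← intervalIntegral.integral_add_adjacent_intervals (iU (-ν) 0) (iU 0 ν)]
  have e3 : ∀ x y x' y' : ℝ, (x + y) - (x' + y') = (x - x') + (y - y') := fun _ _ _ _ => by ring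
  rw [e3, e1, e2]
  refine (abs_add_le _ _).trans ?_
  have k1 := key 1 zero_le_one hM1 (-ε) 0 (by linarith) (by linarith)
  have k2 := key (θ ^ 2) (sq_nonneg _) (sq_le _ hθM) 0 ε hε.le (by linarith)
  linarith

/-- Between `-ν` and `ν` the Wronskian increases by exactly `θ q(ν) - q(-ν)`. Substituting `p = U
p(-ν) + P` in its derivative leaves `∫ U² ψ` as the main term. -/
theorem norm_deriv_sub_le (D : TransferData ε ν θ K L M U U₁ a ψ p q s h) {m₁ : ℝ}
    (hm : ∀ x ∈ Icc (-ν) ν, ‖p x - U x • p (-ν)‖ ≤ m₁) :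
    ‖θ • q ν - q (-ν) - ((∫ x in (-ν)..0, ψ x) + θ ^ 2 * ∫ x in (0 : ℝ)..ν, ψ x) • p (-ν)‖ ≤
      M * (2 * L * m₁ + ∫ t in (-ν)..ν, ‖h t‖) + 4 * M ^ 2 * L * (ε / ν) * ‖p (-ν)‖ := by
  have hν := D.nu_pos
  have hL := D.nonneg
  have hM := D.one_le
  have hεν := D.le
  have hm0 : 0 ≤ m₁ := (norm_nonneg _).trans (hm ν ⟨by linarith, le_rfl⟩)
  have iψ := intervalIntegrable_of_locallyIntegrable D.int_ψ
  have ih := intervalIntegrable_of_locallyIntegrable D.int_h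
  have cU := D.prim.continuous
  have cp := D.sol.continuous
  set c := p (-ν) with hc
  have i1 : ∀ x y, IntervalIntegrable (fun t => U t • (ψ t • (p t - U t • c) - h t))
      volume x y := fun x y => (((iψ x y).smul_continuousOn (by fun_prop)).sub
        (ih x y)).continuousOn_smul (by fun_prop)
  have i2 : ∀ x y, IntervalIntegrable (fun t => (U t ^ 2 * ψ t) • c) volume x y := fun x y =>
    ((iψ x y).continuousOn_mul (by fun_prop)).smul_continuousOn (by fun_prop)
  have e := D.wronskian.integral_eq (-ν) ν
  rw [(D.left (-ν) (by linarith)).1, (D.left (-ν) (by linarith)).2, (D.right ν hεν).1,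
    (D.right ν hεν).2] at e
  simp only [zero_smul, sub_zero, one_smul] at e
  have e1 : ∀ t, U t • (ψ t • p t - h t) =
      U t • (ψ t • (p t - U t • c) - h t) + (U t ^ 2 * ψ t) • c := fun t => by
    simp only [Complex.real_smul]; push_cast; ring
  simp only [e1] at e
  rw [intervalIntegral.integral_add (i1 _ _) (i2 _ _), intervalIntegral.integral_smul_const] at e
  rw [← e, add_sub_assoc, ← sub_smul]
  refine (norm_add_le _ _).trans (add_le_add ?_ ?_)
  · refine (intervalIntegral.norm_integral_le_integral_norm (by linarith)).trans ?_
    have h1 : ∫ t in (-ν)..ν, ‖U t • (ψ t • (p t - U t • c) - h t)‖ ≤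
        ∫ t in (-ν)..ν, M * (L / ν * m₁ + ‖h t‖) := by
      refine intervalIntegral.integral_mono_on (by linarith) (i1 _ _).norm
        ((D.integrable_source _ _ m₁).const_mul M) fun t ht => ?_
      rw [norm_smul, Real.norm_eq_abs]
      refine mul_le_mul (D.bound_U t) ((norm_sub_le _ _).trans ?_) (norm_nonneg _) (by linarith)
      rw [norm_smul, Real.norm_eq_abs]
      have := mul_le_mul (D.bound_ψ t) (hm t ht) (norm_nonneg _) (by positivity)
      linarith
    refine h1.trans ?_
    rw [intervalIntegral.integral_const_mul]
    exact mul_le_mul_of_nonneg_left (D.integral_source_le hm0 le_rfl (by linarith) le_rfl)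
      (by linarith)
  · rw [norm_smul]
    exact mul_le_mul_of_nonneg_right D.abs_integral_sq_sub_le (norm_nonneg _)

end TransferData

/-- Estimates for the transfer of Cauchy data from `-ν` to `ν`, with constants that depend only on
the bounds in `TransferData`. -/
theorem exists_transfer_bound (θ K L M : ℝ) : ∃ C δ : ℝ, 0 < C ∧ 0 < δ ∧
    ∀ (ε ν : ℝ) (U U₁ a ψ : ℝ → ℝ) (p q s h : ℝ → ℂ),
      TransferData ε ν θ K L M U U₁ a ψ p q s h → ν ≤ δ → ∀ H N : ℝ,
      ∫ t in (-ν)..ν, ‖h t‖ ≤ H → ‖p (-ν)‖ + ‖q (-ν)‖ + H ≤ N →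
      (∀ x ∈ Icc (-ν) ν, ‖p x‖ ≤ C * N) ∧ ‖p ν - θ • p (-ν)‖ ≤ C * (ν * N) ∧
      ‖θ • q ν - q (-ν) - ((∫ x in (-ν)..0, ψ x) + θ ^ 2 * ∫ x in (0 : ℝ)..ν, ψ x) • p (-ν)‖ ≤
        C * ((ν + ε / ν) * N + H) := by
  set C₁ := 3 * Real.exp (2 * (1 + K)) + |θ|⁻¹ with hC₁
  have hC₁0 : 0 < C₁ := by positivity
  -- The signs of `M` and `L` are known only once a `TransferData` is given, hence the absolute
  -- values.
  set C₂ := 2 * (|M| * (1 + C₁)) with hC₂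
  set C₃ := |M| * (2 * |L| * C₂ + 1) + 1 with hC₃
  set C₄ := 2 * |M| * |L| * C₁ * C₃ + |M| + 4 * |M| ^ 2 * |L| with hC₄
  have hC₂0 : 0 ≤ C₂ := by positivity
  have hC₃0 : 0 ≤ C₃ := by positivity
  have hC₄0 : 0 ≤ C₄ := by positivity
  -- The smallness of `ν` bounds the contribution of `m = max ‖p‖` to its own estimate by `m / 2`,
  -- which is then absorbed; this explains the factor `2` in `C₂`.
  refine ⟨C₂ + C₁ * C₃ + C₄ + 1, min 1 (1 / (4 * C₁ * |M| * |L| + 1)), by positivity,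
    by positivity, fun ε ν U U₁ a ψ p q s h D hνδ H₁ N hH₁ hN => ?_⟩
  have hν := D.nu_pos
  have hε := D.pos
  have hL := D.nonneg
  have hM := D.one_le
  have aM : |M| = M := abs_of_nonneg (by linarith)
  have aL : |L| = L := abs_of_nonneg hL
  rw [aM, aL] at hνδ
  rw [aM] at hC₂
  rw [aM, aL] at hC₃ hC₄
  have hν1 : ν ≤ 1 := hνδ.trans (min_le_left _ _)
  have hνs : ν * (4 * C₁ * M * L) ≤ 1 := by
    have h1 := hνδ.trans (min_le_right _ _)
    rw [le_div_iff₀ (by positivity)] at h1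
    linarith
  set H := ∫ t in (-ν)..ν, ‖h t‖ with hH
  have hH0 : 0 ≤ H := intervalIntegral.integral_nonneg (by linarith) fun t _ => norm_nonneg _
  have hc0 := norm_nonneg (p (-ν))
  have hb0 := norm_nonneg (q (-ν))
  have hN0 : 0 ≤ N := by linarith
  obtain ⟨x₀, hx₀, hmax⟩ := isCompact_Icc.exists_isMaxOn (⟨ν, by linarith, le_rfl⟩ :
    (Icc (-ν) ν).Nonempty) D.sol.continuous.norm.continuousOn
  set m := ‖p x₀‖ with hm
  have hmx : ∀ x ∈ Icc (-ν) ν, ‖p x‖ ≤ m := fun x hx => hmax hx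
  have hm0 : 0 ≤ m := norm_nonneg _
  have hP := fun x hx => D.norm_sub_smul_le hmx (x := x) hx
  rw [← hC₁, ← hH] at hP
  have hmN : m ≤ C₂ * N := by
    have h1 := hP x₀ hx₀
    have h2 : ‖U x₀ • p (-ν)‖ ≤ M * ‖p (-ν)‖ := by
      rw [norm_smul]; exact mul_le_mul_of_nonneg_right (D.bound_U x₀) hc0
    have h3 := norm_le_norm_add_norm_sub' (p x₀) (U x₀ • p (-ν))
    have h4 : C₁ * ν * (‖q (-ν)‖ + M * (2 * L * m + H)) =
        ν * (C₁ * (‖q (-ν)‖ + M * H)) + ν * (4 * C₁ * M * L) * (m / 2) := by ring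
    have h5 : ν * (4 * C₁ * M * L) * (m / 2) ≤ 1 * (m / 2) :=
      mul_le_mul_of_nonneg_right hνs (by positivity)
    have h6 : ν * (C₁ * (‖q (-ν)‖ + M * H)) ≤ 1 * (C₁ * (‖q (-ν)‖ + M * H)) :=
      mul_le_mul_of_nonneg_right hν1 (by positivity)
    have h7 : ‖q (-ν)‖ + M * H ≤ M * N := by
      have : ‖q (-ν)‖ ≤ M * ‖q (-ν)‖ := le_mul_of_one_le_left hb0 hM
      have : M * (‖q (-ν)‖ + H) ≤ M * N := mul_le_mul_of_nonneg_left (by linarith) (by linarith)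
      linarith
    have h8 : C₁ * (‖q (-ν)‖ + M * H) ≤ C₁ * (M * N) := mul_le_mul_of_nonneg_left h7 hC₁0.le
    have h9 : M * ‖p (-ν)‖ ≤ M * N := mul_le_mul_of_nonneg_left (by linarith) (by linarith)
    have : C₂ * N = 2 * (M * N + C₁ * (M * N)) := by rw [hC₂]; ring
    linarith
  set w := ‖q (-ν)‖ + M * (2 * L * m + H) with hw
  have hwN : w ≤ C₃ * N := by
    have h1 : M * (2 * L * m + H) ≤ M * (2 * L * (C₂ * N) + N) := by
      refine mul_le_mul_of_nonneg_left (add_le_add ?_ (by linarith)) (by linarith)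
      exact mul_le_mul_of_nonneg_left hmN (by positivity)
    have : C₃ * N = M * (2 * L * (C₂ * N) + N) + N := by rw [hC₃]; ring
    linarith
  have hPN : ∀ x ∈ Icc (-ν) ν, ‖p x - U x • p (-ν)‖ ≤ C₁ * C₃ * (ν * N) := fun x hx => by
    refine (hP x hx).trans ?_
    calc C₁ * ν * w ≤ C₁ * ν * (C₃ * N) := mul_le_mul_of_nonneg_left hwN (by positivity)
      _ = _ := by ring
  refine ⟨fun x hx => (hmx x hx).trans (hmN.trans ?_), ?_, ?_⟩
  · exact mul_le_mul_of_nonneg_right (by linarith [mul_nonneg hC₁0.le hC₃0]) hN0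
  · have := hPN ν ⟨by linarith, le_rfl⟩
    rw [(D.right ν D.le).1] at this
    exact this.trans (mul_le_mul_of_nonneg_right (by linarith) (by positivity))
  · refine (D.norm_deriv_sub_le hPN).trans ?_
    rw [← hH]
    have hr : 0 ≤ ε / ν := by positivity
    have h1 : 4 * M ^ 2 * L * (ε / ν) * ‖p (-ν)‖ ≤ 4 * M ^ 2 * L * (ε / ν * N) := by
      rw [mul_assoc]
      exact mul_le_mul_of_nonneg_left (mul_le_mul_of_nonneg_left (by linarith) hr) (by positivity)
    have h2 : M * (2 * L * (C₁ * C₃ * (ν * N)) + H) =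
      2 * M * L * C₁ * C₃ * (ν * N) + M * H := by ring
    have h3 : C₄ * ((ν + ε / ν) * N + H₁) ≤
        (C₂ + C₁ * C₃ + C₄ + 1) * ((ν + ε / ν) * N + H₁) := by
      refine mul_le_mul_of_nonneg_right ?_ (by have := hH0.trans hH₁; positivity)
      linarith [mul_nonneg hC₁0.le hC₃0]
    refine le_trans ?_ h3
    have hH₁0 := hH0.trans hH₁
    have t1 : 0 ≤ 2 * M * L * C₁ * C₃ * (ε / ν * N + H₁) := by positivity
    have t2 : 0 ≤ M * ((ν + ε / ν) * N) := by positivity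
    have t3 : 0 ≤ 4 * M ^ 2 * L * (ν * N + H₁) := by positivity
    have t4 : M * H ≤ M * H₁ := mul_le_mul_of_nonneg_left hH₁ (by linarith)
    rw [hC₄, h2]
    linarith

/-! ### Comparison of the resolvents -/

/-- Stability of the interface conditions for outgoing solutions. -/
theorem exists_interface_stability {k : ℂ} (hk : (k ^ 2).im ≠ 0) {θ : ℝ} (hθ : θ ≠ 0) (γ : ℝ) :
    ∃ C : ℝ, 0 < C ∧ ∀ (η : ℝ) (pR qR pL qL r r₁ l l₁ r0 r₁0 l0 l₁0 : ℂ),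
      ‖pR - θ • pL‖ ≤ η → ‖θ • qR - qL - (θ * γ) • pL‖ ≤ η →
      ‖l - l0‖ ≤ η → ‖l₁ - l₁0‖ ≤ η → ‖r - r0‖ ≤ η → ‖r₁ - r₁0‖ ≤ η →
      r0 = θ * l0 → r₁0 = (θ : ℂ)⁻¹ * l₁0 + γ * l0 →
      qR - r₁ = Complex.I * k * (pR - r) → -(qL - l₁) = Complex.I * k * (pL - l) →
      ‖pR - r‖ ≤ C * η ∧ ‖pL - l‖ ≤ C * η := by
  have hΔ := interface_det_ne_zero hk hθ γ
  set Δ := Complex.I * k * (θ + (θ : ℂ)⁻¹) - γ with hΔd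
  have hθ' : (θ : ℂ) ≠ 0 := by exact_mod_cast hθ
  have hT : (θ : ℂ) * Δ ≠ 0 := mul_ne_zero hθ' hΔ
  have hTn : 0 < ‖(θ : ℂ) * Δ‖ := norm_pos_iff.2 hT
  set C₁ := (2 + |θ * γ| + |θ| + |θ| * ‖k‖ * (2 + |θ|)) / ‖(θ : ℂ) * Δ‖ with hC₁
  have hC₁0 : 0 ≤ C₁ := by positivity
  refine ⟨|θ| * C₁ + (2 + |θ|) + C₁, by positivity, ?_⟩
  intro η pR qR pL qL r r₁ l l₁ r0 r₁0 l0 l₁0 h1 h2 h3 h4 h5 h6 h7 h8 h9 h10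
  have hη : 0 ≤ η := (norm_nonneg _).trans h1
  -- `e₁` and `e₂` are the residuals of the two interface conditions, the second multiplied by `θ`,
  -- for the differences of the two solutions.
  set e₁ : ℂ := (pR - θ • pL) + θ * (l - l0) - (r - r0) with he₁
  set e₂ : ℂ := (θ • qR - qL - (θ * γ) • pL) + (l₁ - l₁0) + ((θ * γ : ℝ) : ℂ) * (l - l0) -
    θ * (r₁ - r₁0) with he₂
  have b₁ : ‖e₁‖ ≤ (2 + |θ|) * η := by
    refine (norm_sub_le _ _).trans ((add_le_add_left (norm_add_le _ _) _).trans ?_)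
    rw [norm_mul, Complex.norm_real, Real.norm_eq_abs]
    have := mul_le_mul_of_nonneg_left h3 (abs_nonneg θ)
    linarith
  have b₂ : ‖e₂‖ ≤ (2 + |θ * γ| + |θ|) * η := by
    refine (norm_sub_le _ _).trans ((add_le_add_left ((norm_add_le _ _).trans
      (add_le_add_left (norm_add_le _ _) _)) _).trans ?_)
    rw [norm_mul, norm_mul, Complex.norm_real, Complex.norm_real, Real.norm_eq_abs,
      Real.norm_eq_abs]
    have t1 := mul_le_mul_of_nonneg_left h3 (abs_nonneg (θ * γ))
    have t2 := mul_le_mul_of_nonneg_left h6 (abs_nonneg θ)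
    linarith
  have eP : pR - r = θ * (pL - l) + e₁ := by
    rw [he₁, h7, Complex.real_smul]; ring
  -- The outgoing relations eliminate the derivatives and `eP` the right-hand value.
  have eM : (pL - l) * ((θ : ℂ) * Δ) = e₂ - θ * (Complex.I * k) * e₁ := by
    have a1 : (θ : ℂ) * (qR - r₁) = (qL - l₁) + θ * γ * (pL - l) + e₂ := by
      rw [he₂, h8, Complex.real_smul, Complex.real_smul]
      push_cast
      field_simp
      ring
    rw [h9, eP] at a1
    have a2 : qL - l₁ = -(Complex.I * k * (pL - l)) := by rw [← h10]; ring
    rw [a2] at a1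
    rw [hΔd]
    field_simp
    linear_combination a1
  have bM : ‖pL - l‖ ≤ C₁ * η := by
    have h := congrArg norm eM
    rw [norm_mul] at h
    have h' : ‖e₂ - θ * (Complex.I * k) * e₁‖ ≤
        (2 + |θ * γ| + |θ| + |θ| * ‖k‖ * (2 + |θ|)) * η := by
      refine (norm_sub_le _ _).trans ?_
      rw [norm_mul, norm_mul, norm_mul, Complex.norm_I, one_mul, Complex.norm_real,
        Real.norm_eq_abs]
      have := mul_le_mul_of_nonneg_left b₁ (mul_nonneg (abs_nonneg θ) (norm_nonneg k))
      linarith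
    rw [← h, ← le_div_iff₀ hTn] at h'
    refine h'.trans (le_of_eq ?_)
    rw [hC₁]; ring
  have bP : ‖pR - r‖ ≤ |θ| * (C₁ * η) + (2 + |θ|) * η := by
    rw [eP]
    refine (norm_add_le _ _).trans (add_le_add ?_ b₁)
    rw [norm_mul, Complex.norm_real, Real.norm_eq_abs]
    exact mul_le_mul_of_nonneg_left bM (abs_nonneg _)
  have t1 : 0 ≤ C₁ * η := by positivity
  have t2 : 0 ≤ |θ| * (C₁ * η) + (2 + |θ|) * η := by positivity
  constructor <;> linarith

theorem norm_data_right {p q s : ℝ → ℂ} (hp : IsPrimitiveOf p q) (hq : IsPrimitiveOf q s)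
    {φ χ : L2} {a : ℝ} (hφ : ∀ᵐ x, a < x → φ x = p x) (hχ : ∀ᵐ x, a < x → χ x = s x) :
    ‖p a‖ ≤ 6 * (‖φ‖ + ‖χ‖) ∧ ‖q a‖ ≤ 6 * (‖φ‖ + ‖χ‖) := by
  have key : ∀ {g : ℝ → ℂ} {ψ : L2}, (∀ᵐ x, a < x → ψ x = g x) →
      ∫ x in a..a + 1, ‖g x‖ ≤ ‖ψ‖ := by
    intro g ψ h
    have h1 := intervalIntegral_norm_le ψ (a := a) (b := a + 1) (by linarith)
    rw [add_sub_cancel_left, Real.sqrt_one, one_mul] at h1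
    refine le_trans (le_of_eq (intervalIntegral.integral_congr_ae ?_)) h1
    filter_upwards [h] with x hx hxm
    rw [uIoc_of_le (by linarith)] at hxm
    rw [hx hxm.1]
  obtain ⟨h1, h2⟩ := norm_cauchy_data_le hp hq a
  have k1 := key hφ
  have k2 := key hχ
  have := norm_nonneg φ
  have := norm_nonneg χ
  constructor <;> linarith

theorem norm_data_left {p q s : ℝ → ℂ} (hp : IsPrimitiveOf p q) (hq : IsPrimitiveOf q s)
    {φ χ : L2} {a : ℝ} (hφ : ∀ᵐ x, x < a → φ x = p x) (hχ : ∀ᵐ x, x < a → χ x = s x) :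
    ‖p a‖ ≤ 6 * (‖φ‖ + ‖χ‖) ∧ ‖q a‖ ≤ 6 * (‖φ‖ + ‖χ‖) := by
  have key : ∀ {g : ℝ → ℂ} {ψ : L2}, (∀ᵐ x, x < a → ψ x = g x) →
      ∫ x in (-a)..(-a + 1), ‖g (-x)‖ ≤ ‖ψ‖ := by
    intro g ψ h
    rw [intervalIntegral.integral_comp_neg (fun x => ‖g x‖), neg_neg]
    have h1 := intervalIntegral_norm_le ψ (a := -(-a + 1)) (b := a) (by linarith)
    have e : a - -(-a + 1) = 1 := by ring
    rw [e, Real.sqrt_one, one_mul] at h1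
    refine le_trans (le_of_eq (intervalIntegral.integral_congr_ae ?_)) h1
    have na : ∀ᵐ x : ℝ, x ≠ a := by simp [ae_iff]
    filter_upwards [h, na] with x hx hxa hxm
    rw [uIoc_of_le (by linarith)] at hxm
    rw [hx (lt_of_le_of_ne hxm.2 hxa)]
  have hq' : IsPrimitiveOf (fun x => -q (-x)) (fun x => s (-x)) := by simpa using hq.comp_neg.neg
  obtain ⟨h1, h2⟩ := norm_cauchy_data_le hp.comp_neg hq' (-a)
  have k1 := key hφ
  have k2 := key hχ
  simp only [neg_neg, norm_neg] at h1 h2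
  have := norm_nonneg φ
  have := norm_nonneg χ
  constructor <;> linarith

/-- The derivative moves by at most `∫ ‖s‖`, so it stays below `2B`, and `p` moves by at most `2Bν ≤
2√ν B`. -/
theorem norm_near_le {p q s : ℝ → ℂ} (hp : IsPrimitiveOf p q) (hq : IsPrimitiveOf q s)
    {ν B : ℝ} (hν : 0 ≤ ν) (hν1 : ν ≤ 1) (h0 : ‖p 0‖ ≤ B) (h1 : ‖q 0‖ ≤ B)
    (hs : ∫ x in (0 : ℝ)..ν, ‖s x‖ ≤ √ν * B) :
    ‖q ν - q 0‖ ≤ √ν * B ∧ ‖p ν - p 0‖ ≤ 2 * (√ν * B) ∧ ∀ x ∈ Icc 0 ν, ‖p x‖ ≤ 3 * B := by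
  have hB : 0 ≤ B := (norm_nonneg _).trans h0
  have hsq : √ν ≤ 1 := Real.sqrt_le_one.2 hν1
  have hνs : ν ≤ √ν := by
    nlinarith [Real.sq_sqrt hν, Real.sqrt_nonneg ν]
  have k1 : ∀ x ∈ Icc 0 ν, ‖q x - q 0‖ ≤ √ν * B := fun x hx =>
    (hq.norm_sub_le hx.1).trans ((intervalIntegral.integral_mono_interval le_rfl hx.1 hx.2
      (.of_forall fun t => norm_nonneg _) (hq.intervalIntegrable _ _).norm).trans hs)
  have k2 : ∀ x ∈ Icc 0 ν, ‖q x‖ ≤ 2 * B := fun x hx => by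
    have := norm_le_norm_add_norm_sub' (q x) (q 0)
    have := mul_le_mul_of_nonneg_right hsq hB
    linarith [k1 x hx]
  have k3 : ∀ x ∈ Icc 0 ν, ‖p x - p 0‖ ≤ 2 * B * x := fun x hx => by
    rw [← hp.integral_eq]
    refine (intervalIntegral.norm_integral_le_of_norm_le_const (C := 2 * B) fun t ht => ?_).trans
      (by rw [sub_zero, abs_of_nonneg hx.1])
    rw [uIoc_of_le hx.1] at ht
    exact k2 t ⟨ht.1.le, ht.2.trans hx.2⟩
  refine ⟨k1 ν ⟨hν, le_rfl⟩, (k3 ν ⟨hν, le_rfl⟩).trans ?_, fun x hx => ?_⟩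
  · have := mul_le_mul_of_nonneg_left hνs hB
    linarith
  · have := norm_le_norm_add_norm_sub' (p x) (p 0)
    have h3 := k3 x hx
    have : 2 * B * x ≤ 2 * B * 1 := mul_le_mul_of_nonneg_left (hx.2.trans hν1) (by positivity)
    linarith

/-- The difference of two solutions outside of the support of the potential. -/
theorem outer_difference {p q s r r₁ s' : ℝ → ℂ} (hp : IsPrimitiveOf p q)
    (hq : IsPrimitiveOf q s) (hr : IsPrimitiveOf r r₁) (hr₁ : IsPrimitiveOf r₁ s')
    {k : ℂ} (hk : 0 < k.im) {b : ℝ} (mp : MemLp p 2 (volume.restrict (Ioi b)))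
    (mq : MemLp q 2 (volume.restrict (Ioi b))) (mr : MemLp r 2 (volume.restrict (Ioi b)))
    (mr₁ : MemLp r₁ 2 (volume.restrict (Ioi b)))
    (e : ∀ᵐ x, b < x → s x - s' x = -k ^ 2 * (p x - r x)) :
    q b - r₁ b = Complex.I * k * (p b - r b) ∧
      ∫ x in Ioi b, ‖p x - r x‖ ^ 2 = ‖p b - r b‖ ^ 2 / (2 * k.im) := by
  obtain ⟨h1, h2⟩ := eq_exp_of_memLp (hp.sub hr) (hq.sub hr₁) hk (mp.sub mr) (mq.sub mr₁) e
  refine ⟨h1, ?_⟩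
  rw [← integral_norm_sq_exp_Ioi hk b]
  refine setIntegral_congr_fun measurableSet_Ioi fun x hx => ?_
  rw [h2 x (le_of_lt hx)]

theorem norm_sq_le_of_split (φ : L2) {ν A B C : ℝ} (hν : 0 ≤ ν)
    (hl : ∫ x in Iio (-ν), ‖φ x‖ ^ 2 ≤ A) (hr : ∫ x in Ioi ν, ‖φ x‖ ^ 2 ≤ C)
    (hm : ∀ᵐ x, x ∈ Icc (-ν) ν → ‖φ x‖ ≤ B) : ‖φ‖ ^ 2 ≤ A + 2 * ν * B ^ 2 + C := by
  have hi := integrable_norm_sq_L2 φ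
  rw [norm_sq_L2, ← intervalIntegral.integral_Iio_add_Ici (b := -ν) hi.integrableOn
    hi.integrableOn, integral_Ici_eq_integral_Ioi,
    ← intervalIntegral.integral_interval_add_Ioi (a := -ν) (b := ν) hi.integrableOn
      hi.integrableOn]
  have h2 : ∫ x in (-ν)..ν, ‖φ x‖ ^ 2 ≤ ∫ x in (-ν)..ν, B ^ 2 := by
    refine intervalIntegral.integral_mono_ae_restrict (by linarith) hi.intervalIntegrable
      intervalIntegrable_const ?_
    refine (ae_restrict_iff' measurableSet_Icc).2 ?_
    filter_upwards [hm] with x hx hxm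
    have := hx hxm
    gcongr
  rw [intervalIntegral.integral_const, smul_eq_mul] at h2
  linarith

/-- The support lies in `[-1, 1]`, so after rescaling `[-ν, ν]` captures the full half-line
integrals that enter `zeta`. -/
theorem integral_scaled_potential {Ψ : ℝ → ℝ} (hΨ : IsPotential Ψ) (β : ℝ) {ν : ℝ}
    (hν : 0 < ν) :
    ∫ x in (-ν)..0, β / ν * Ψ (x / ν) = β * ∫ t in Iio 0, Ψ t ∧
      ∫ x in (0 : ℝ)..ν, β / ν * Ψ (x / ν) = β * ∫ t in Ioi 0, Ψ t := by
  have hl : ∫ x in (-1 : ℝ)..0, Ψ x = ∫ t in Iio 0, Ψ t := by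
    rw [intervalIntegral.integral_of_le (by norm_num), ← integral_Icc_eq_integral_Ioc,
      ← integral_Iic_eq_integral_Iio]
    refine (setIntegral_eq_of_subset_of_forall_sdiff_eq_zero measurableSet_Iic
      (fun x hx => hx.2) fun x hx => ?_).symm
    by_contra h
    exact hx.2 ⟨(hΨ.support_subset h).1, hx.1⟩
  have hr : ∫ x in (0 : ℝ)..1, Ψ x = ∫ t in Ioi 0, Ψ t := by
    rw [intervalIntegral.integral_of_le (by norm_num)]
    refine (setIntegral_eq_of_subset_of_forall_sdiff_eq_zero measurableSet_Ioi
      (fun x hx => hx.1) fun x hx => ?_).symm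
    by_contra h
    exact hx.2 ⟨hx.1, (hΨ.support_subset h).2⟩
  rw [intervalIntegral.integral_const_mul, intervalIntegral.integral_const_mul,
    intervalIntegral.integral_comp_div (fun x => Ψ x) hν.ne',
    intervalIntegral.integral_comp_div (fun x => Ψ x) hν.ne', zero_div, neg_div, div_self hν.ne',
    hl, hr, smul_eq_mul, smul_eq_mul]
  constructor <;> field_simp

theorem ae_comp_neg {P : ℝ → Prop} (h : ∀ᵐ x, P x) : ∀ᵐ x, P (-x) :=
  (Measure.measurePreserving_neg (volume : Measure ℝ)).quasiMeasurePreserving.ae h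

theorem outer_right {Y Y₁ y y₁ : L2} {p q s r r₁ s' : ℝ → ℂ} (hp : IsPrimitiveOf p q)
    (hq : IsPrimitiveOf q s) (hr : IsPrimitiveOf r r₁) (hr₁ : IsPrimitiveOf r₁ s')
    {k : ℂ} (hk : 0 < k.im) {b : ℝ} (eY : ∀ᵐ x, b < x → Y x = p x)
    (eY₁ : ∀ᵐ x, b < x → Y₁ x = q x) (ey : ∀ᵐ x, b < x → y x = r x)
    (ey₁ : ∀ᵐ x, b < x → y₁ x = r₁ x)
    (e : ∀ᵐ x, b < x → s x - s' x = -k ^ 2 * (p x - r x)) :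
    q b - r₁ b = Complex.I * k * (p b - r b) ∧
      ∫ x in Ioi b, ‖(Y - y) x‖ ^ 2 = ‖p b - r b‖ ^ 2 / (2 * k.im) := by
  have m : ∀ {g : L2} {f : ℝ → ℂ}, (∀ᵐ x, b < x → g x = f x) →
      MemLp f 2 (volume.restrict (Ioi b)) := fun {g _} h =>
    ((Lp.memLp g).restrict _).ae_eq ((ae_restrict_iff' measurableSet_Ioi).2 h)
  obtain ⟨h1, h2⟩ := outer_difference hp hq hr hr₁ hk (m eY) (m eY₁) (m ey) (m ey₁) e
  refine ⟨h1, h2 ▸ setIntegral_congr_ae measurableSet_Ioi ?_⟩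
  filter_upwards [eY, ey, Lp.coeFn_sub Y y] with x h3 h4 h5 hx
  rw [h5, Pi.sub_apply, h3 hx, h4 hx]

theorem outer_left {Y Y₁ y y₁ : L2} {p q s l l₁ s' : ℝ → ℂ} (hp : IsPrimitiveOf p q)
    (hq : IsPrimitiveOf q s) (hl : IsPrimitiveOf l l₁) (hl₁ : IsPrimitiveOf l₁ s')
    {k : ℂ} (hk : 0 < k.im) {b : ℝ} (eY : ∀ᵐ x, x < -b → Y x = p x)
    (eY₁ : ∀ᵐ x, x < -b → Y₁ x = q x) (ey : ∀ᵐ x, x < -b → y x = l x)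
    (ey₁ : ∀ᵐ x, x < -b → y₁ x = l₁ x)
    (e : ∀ᵐ x, x < -b → s x - s' x = -k ^ 2 * (p x - l x)) :
    -(q (-b) - l₁ (-b)) = Complex.I * k * (p (-b) - l (-b)) ∧
      ∫ x in Iio (-b), ‖(Y - y) x‖ ^ 2 = ‖p (-b) - l (-b)‖ ^ 2 / (2 * k.im) := by
  have m : ∀ {g : L2} {f : ℝ → ℂ}, (∀ᵐ x, x < -b → g x = f x) →
      MemLp (fun x => f (-x)) 2 (volume.restrict (Ioi b)) := fun {g _} h =>
    memLp_comp_neg (((Lp.memLp g).restrict _).ae_eq ((ae_restrict_iff' measurableSet_Iio).2 h))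
  have hq' : IsPrimitiveOf (fun x => -q (-x)) (fun x => s (-x)) := by simpa using hq.comp_neg.neg
  have hl' : IsPrimitiveOf (fun x => -l₁ (-x)) (fun x => s' (-x)) := by
    simpa using hl₁.comp_neg.neg
  obtain ⟨h1, h2⟩ := outer_difference hp.comp_neg hq' hl.comp_neg hl' hk (m eY) (m eY₁).neg
    (m ey) (m ey₁).neg ((ae_comp_neg e).mono fun x hx hb => hx (neg_lt_neg hb))
  refine ⟨by rw [← h1]; ring, ?_⟩
  rw [← h2, integral_comp_neg_Ioi b (fun x => ‖p x - l x‖ ^ 2), integral_Iic_eq_integral_Iio]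
  refine setIntegral_congr_ae measurableSet_Iio ?_
  filter_upwards [eY, ey, Lp.coeFn_sub Y y] with x h3 h4 h5 hx
  rw [h5, Pi.sub_apply, h3 hx, h4 hx]

/-- A solution on the punctured line varies little near the origin. -/
theorem norm_near_zero_le {y φ : L2} {l l₁ r r₁ : ℝ → ℂ} (hl : IsPrimitiveOf l l₁)
    (hl₁ : IsPrimitiveOf l₁ φ) (hr : IsPrimitiveOf r r₁) (hr₁ : IsPrimitiveOf r₁ φ)
    (h : IsPiecewise y l r) {B : ℝ} (hB : 6 * (‖y‖ + ‖φ‖) ≤ B) {ν : ℝ} (hν : 0 ≤ ν)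
    (hν1 : ν ≤ 1) :
    (‖r₁ ν - r₁ 0‖ ≤ √ν * B ∧ ‖r ν - r 0‖ ≤ 2 * (√ν * B) ∧ ∀ x ∈ Icc 0 ν, ‖r x‖ ≤ 3 * B) ∧
    ‖l₁ (-ν) - l₁ 0‖ ≤ √ν * B ∧ ‖l (-ν) - l 0‖ ≤ 2 * (√ν * B) ∧
      ∀ x ∈ Icc 0 ν, ‖l (-x)‖ ≤ 3 * B := by
  have hy := norm_nonneg y
  have hφ := norm_nonneg φ
  obtain ⟨a1, a2⟩ := norm_data_right hr hr₁ h.right (.of_forall fun x _ => rfl)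
  obtain ⟨a3, a4⟩ := norm_data_left hl hl₁ h.left (.of_forall fun x _ => rfl)
  have hl' : IsPrimitiveOf (fun x => -l₁ (-x)) (fun x => φ (-x)) := by
    simpa using hl₁.comp_neg.neg
  refine ⟨norm_near_le hr hr₁ hν hν1 (a1.trans hB) (a2.trans hB) ?_, ?_⟩
  · have := intervalIntegral_norm_le φ hν
    rw [sub_zero] at this
    exact this.trans (by gcongr; linarith)
  · have := norm_near_le (B := B) hl.comp_neg hl' hν hν1 (by simpa using a3.trans hB)
      (by simpa using a4.trans hB) (by
        rw [intervalIntegral.integral_comp_neg (fun x => ‖φ x‖), neg_zero]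
        have := intervalIntegral_norm_le φ (neg_nonpos.2 hν)
        rw [zero_sub, neg_neg] at this
        exact this.trans (by gcongr; linarith))
    obtain ⟨b1, b2, b3⟩ := this
    simp only [neg_zero] at b1 b2
    exact ⟨by rw [← neg_sub_neg, norm_sub_rev]; exact b1, b2, b3⟩

theorem exists_comparison_bound {k : ℂ} (hk : 0 < k.im) (hk2 : (k ^ 2).im ≠ 0) {θ : ℝ}
    (hθ : θ ≠ 0) (γ K L M : ℝ) : ∃ C δ : ℝ, 0 < C ∧ 0 < δ ∧
    ∀ (ε ν : ℝ) (U U₁ a ψ : ℝ → ℝ) (p q s l l₁ r r₁ : ℝ → ℂ) (f Y Y₁ y y₁ φ : L2),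
      TransferData ε ν θ K L M U U₁ a ψ p q s (k ^ 2 • Y + f : L2) → ν ≤ δ →
      (∀ x, ν < |x| → a x + ψ x = 0) →
      (∫ x in (-ν)..0, ψ x) + θ ^ 2 * (∫ x in (0 : ℝ)..ν, ψ x) = θ * γ →
      (∀ᵐ x, Y x = p x) → (∀ᵐ x, Y₁ x = q x) →
      IsPrimitiveOf l l₁ → IsPrimitiveOf l₁ φ → IsPrimitiveOf r r₁ → IsPrimitiveOf r₁ φ →
      IsPiecewise y l r → IsPiecewise y₁ l₁ r₁ → r 0 = θ * l 0 →
      r₁ 0 = (θ : ℂ)⁻¹ * l₁ 0 + γ * l 0 → φ = -(k ^ 2 • y + f) →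
      ∀ B : ℝ, 6 * (‖Y‖ + ‖k ^ 2 • Y + f‖) ≤ B → 6 * (‖y‖ + ‖k ^ 2 • y + f‖) ≤ B →
      ‖Y - y‖ ≤ C * ((√ν + ε / ν) * B) := by
  obtain ⟨C₁, δ, hC₁, hδ, hT⟩ := exists_transfer_bound θ K L M
  obtain ⟨C₂, hC₂, hI⟩ := exists_interface_stability hk2 hθ γ
  -- The first term comes from the two outer exponentials, the second from the supremum on `[-ν, ν]`
  -- combined with `ν B² ≤ (ρ B)²`.
  refine ⟨√((C₂ * (6 * C₁ + 2)) ^ 2 / k.im + 2 * (4 * C₁ + 3) ^ 2), min δ 1,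
    Real.sqrt_pos.2 (by positivity), by positivity, ?_⟩
  intro ε ν U U₁ a ψ p q s l l₁ r r₁ f Y Y₁ y y₁ φ D hνδ hV hψ eY eY₁ hl hl₁ hr hr₁ hy hy₁
    i0 i1 hφ B hB hB'
  have hν := D.nu_pos
  have hε := D.pos
  have hν1 : ν ≤ 1 := hνδ.trans (min_le_right _ _)
  have hsq1 : √ν ≤ 1 := Real.sqrt_le_one.2 hν1
  have hsq0 := Real.sqrt_nonneg ν
  have hsq : √ν ^ 2 = ν := Real.sq_sqrt hν.le
  have hνs : ν ≤ √ν := by nlinarith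
  set g : L2 := k ^ 2 • Y + f with hg
  have hY0 := norm_nonneg Y
  have hg0 := norm_nonneg g
  have hB0 : 0 ≤ B := le_trans (by positivity) hB
  have hεν : 0 < ε / ν := div_pos hε hν
  set ρ := √ν + ε / ν with hρ
  have hρ0 : 0 ≤ ρ := by positivity
  have eqn : ∀ᵐ x, ν < |x| → s x = -g x := by
    filter_upwards [D.eqn] with x hx hxa
    rw [hx, hV x hxa, zero_smul, zero_sub]
  have eg : ∀ᵐ x, (-g : L2) x = -g x := Lp.coeFn_neg g
  -- the Schrödinger side
  obtain ⟨d0, d1⟩ := norm_data_left D.sol D.sol₁ (φ := Y) (χ := -g) (a := -ν)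
    (eY.mono fun x hx _ => hx) (by
      filter_upwards [eqn, eg] with x h1 h2 hx
      rw [h1 (by rw [lt_abs]; right; linarith), h2])
  rw [norm_neg] at d0 d1
  have hH : ∫ t in (-ν)..ν, ‖g t‖ ≤ 2 * (√ν * B) := by
    refine (intervalIntegral_norm_le g (by linarith)).trans ?_
    have h1 : √(ν - -ν) ≤ 2 * √ν := by
      rw [Real.sqrt_le_left (by positivity)]
      nlinarith
    calc √(ν - -ν) * ‖g‖ ≤ 2 * √ν * B := by gcongr; linarith
      _ = _ := by ring
  have hνB : √ν * B ≤ B := mul_le_of_le_one_left hB0 hsq1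
  -- `4B` consists of `B` for each Cauchy datum at `-ν` and `2B` for the source.
  obtain ⟨t1, t2, t3⟩ := hT ε ν U U₁ a ψ p q s g D (hνδ.trans (min_le_left _ _)) _ (4 * B) hH
    (by linarith)
  rw [hψ] at t3
  -- the point interaction side
  obtain ⟨⟨n1, n2, n3⟩, n4, n5, n6⟩ := norm_near_zero_le hl hl₁ hr hr₁ hy (B := B)
    (by rw [hφ, norm_neg]; exact hB') hν.le hν1
  have es : ∀ᵐ x, ν < |x| → s x - φ x = -k ^ 2 * (p x - y x) := by
    filter_upwards [eqn, eY, Lp.coeFn_neg (k ^ 2 • y + f), Lp.coeFn_add (k ^ 2 • y) f,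
      Lp.coeFn_smul (k ^ 2) y, Lp.coeFn_add (k ^ 2 • Y) f, Lp.coeFn_smul (k ^ 2) Y]
      with x h1 h2 h3 h4 h5 h6 h7 hx
    rw [h1 hx, hφ, h3, Pi.neg_apply, h4, Pi.add_apply, h5, h6, Pi.add_apply, h7, Pi.smul_apply,
      Pi.smul_apply, h2, smul_eq_mul, smul_eq_mul]
    ring
  obtain ⟨o1, o2⟩ := outer_right (Y := Y) (Y₁ := Y₁) (y := y) (y₁ := y₁) D.sol D.sol₁ hr hr₁ hk
    (b := ν) (eY.mono fun x hx _ => hx) (eY₁.mono fun x hx _ => hx)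
    (hy.right.mono fun x h hx => h (hν.trans hx)) (hy₁.right.mono fun x h hx => h (hν.trans hx))
    (by
      filter_upwards [es, hy.right] with x h1 h2 hx
      rw [h1 (by rw [lt_abs]; left; exact hx), h2 (hν.trans hx)])
  obtain ⟨o3, o4⟩ := outer_left (Y := Y) (Y₁ := Y₁) (y := y) (y₁ := y₁) D.sol D.sol₁ hl hl₁ hk
    (b := ν) (eY.mono fun x hx _ => hx) (eY₁.mono fun x hx _ => hx)
    (hy.left.mono fun x h hx => h (by linarith)) (hy₁.left.mono fun x h hx => h (by linarith))
    (by
      filter_upwards [es, hy.left] with x h1 h2 hx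
      rw [h1 (by rw [lt_abs]; right; linarith), h2 (by linarith)])
  have hρB : √ν * B ≤ ρ * B := by gcongr; linarith
  have hνB' : ν * B ≤ √ν * B := by gcongr
  have hCB : 0 ≤ C₁ * (ρ * B) := by positivity
  have hρB0 : 0 ≤ ρ * B := by positivity
  -- `6 C₁` covers the transfer errors (`4` from the data, `2` from the source) and `2` the
  -- variation of the limit solution between `0` and `±ν`.
  obtain ⟨c1, c2⟩ := hI ((6 * C₁ + 2) * (ρ * B)) (p ν) (q ν) (p (-ν)) (q (-ν)) (r ν) (r₁ ν)
    (l (-ν)) (l₁ (-ν)) (r 0) (r₁ 0) (l 0) (l₁ 0)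
    (t2.trans (by
      have := mul_le_mul_of_nonneg_left (hνB'.trans hρB) hC₁.le
      linarith))
    (t3.trans (by
      have h1 : (ν + ε / ν) * (4 * B) + 2 * (√ν * B) ≤ 6 * (ρ * B) := by
        have : (ν + ε / ν) * B ≤ ρ * B := mul_le_mul_of_nonneg_right (by linarith) hB0
        linarith
      have := mul_le_mul_of_nonneg_left h1 hC₁.le
      linarith))
    (by linarith) (by linarith) (by linarith) (by linarith) i0 i1 o1 o3
  -- the middle interval
  have hm : ∀ᵐ x, x ∈ Icc (-ν) ν → ‖(Y - y) x‖ ≤ (4 * C₁ + 3) * B := by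
    have h0 : ∀ᵐ x : ℝ, x ≠ 0 := by simp [ae_iff]
    filter_upwards [eY, hy.left, hy.right, Lp.coeFn_sub Y y, h0] with x h1 h2 h3 h4 h5 hx
    have hyx : ‖y x‖ ≤ 3 * B := by
      rcases lt_or_gt_of_ne h5 with h | h
      · rw [h2 h]
        simpa using n6 (-x) ⟨by linarith, by linarith [hx.1]⟩
      · rw [h3 h]
        exact n3 x ⟨h.le, hx.2⟩
    rw [h4, Pi.sub_apply, h1]
    have := t1 x hx
    exact (norm_sub_le _ _).trans (by linarith)
  have key := norm_sq_le_of_split (Y - y) hν.le o4.le o2.le hm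
  have hsq' : ∀ {w : ℂ}, ‖w‖ ≤ C₂ * ((6 * C₁ + 2) * (ρ * B)) →
      ‖w‖ ^ 2 / (2 * k.im) ≤ (C₂ * ((6 * C₁ + 2) * (ρ * B))) ^ 2 / (2 * k.im) := fun h => by
    gcongr
  have k1 := hsq' c1
  have k2 := hsq' c2
  have k3 : ν * B ^ 2 ≤ (ρ * B) ^ 2 := by
    calc ν * B ^ 2 = (√ν * B) ^ 2 := by rw [mul_pow, hsq]
      _ ≤ _ := by gcongr
  refine abs_le_of_sq_le_sq' ?_ (by positivity) |>.2
  rw [mul_pow, Real.sq_sqrt (by positivity)]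
  have k4 := mul_le_mul_of_nonneg_left k3 (by positivity : 0 ≤ 2 * (4 * C₁ + 3) ^ 2)
  have k5 : (C₂ * ((6 * C₁ + 2) * (ρ * B))) ^ 2 / (2 * k.im) +
      (C₂ * ((6 * C₁ + 2) * (ρ * B))) ^ 2 / (2 * k.im) =
      (C₂ * (6 * C₁ + 2)) ^ 2 / k.im * (ρ * B) ^ 2 := by
    field_simp; ring
  linarith

/-! ### Norm resolvent convergence -/

/-- Rescaling `u` to `u(x/ε)` keeps its bound and its end values, so `K`, `L` and `M` are
independent of `ε` and `ν`. -/
theorem IsNormalizedHalfBoundState.exists_transferData {Φ Ψ : ℝ → ℝ} (hΦ : IsPotential Φ)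
    (hΨ : IsPotential Ψ) {α : ℝ} (β : ℝ) {u : ℝ → ℝ} (hu : IsNormalizedHalfBoundState Φ α u) :
    ∃ K L M : ℝ, ∀ (ε ν : ℝ) (p q s h : ℝ → ℂ), 0 < ε → ε ≤ ν → IsPrimitiveOf p q →
      IsPrimitiveOf q s → LocallyIntegrable h →
      (∀ᵐ x, s x = twoScalePotential Φ Ψ α β ε ν x • p x - h x) →
      ∃ U U₁ : ℝ → ℝ, TransferData ε ν (u 1) K L M U U₁ (fun x => α / ε ^ 2 * Φ (x / ε))
        (fun x => β / ν * Ψ (x / ν)) p q s h := by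
  obtain ⟨u₁, pu, pu₁, hl, hr, -, h1⟩ := hu.1.structure hΦ
  obtain ⟨K, hK0, hK⟩ := hΦ.exists_bound α
  obtain ⟨L, hL0, hL⟩ := hΨ.exists_bound β
  obtain ⟨M, hM⟩ := hu.1.2.1
  refine ⟨K, L, max M 1, fun ε ν p q s h hε hεν hp hq hh he => ?_⟩
  have hν : 0 < ν := hε.trans_le hεν
  have bψ : ∀ x, |β / ν * Ψ (x / ν)| ≤ L / ν := fun x => by
    rw [div_mul_eq_mul_div, abs_div, abs_of_pos hν]
    gcongr
    exact hL _
  refine ⟨fun x => u (ε⁻¹ * x), fun x => ε⁻¹ • u₁ (ε⁻¹ * x), ?_⟩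
  exact
  { pos := hε
    le := hεν
    theta := h1
    one_le := le_max_right _ _
    nonneg := hL0
    nonneg' := hK0
    prim := pu.comp_mul (inv_ne_zero hε.ne')
    prim₁ := by
      have := (pu₁.comp_mul (inv_ne_zero hε.ne')).const_smul ε⁻¹
      refine this.congr_ae (.of_forall fun x => ?_)
      simp only [smul_eq_mul, div_eq_inv_mul]
      ring
    bound_a := fun x => by
      rw [div_mul_eq_mul_div, abs_div, abs_of_pos (by positivity : 0 < ε ^ 2)]
      gcongr
      exact hK _
    bound_U := fun x => (hM _).trans (le_max_left _ _)
    left := fun x hx => by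
      have hx' : ε⁻¹ * x ≤ -1 := by
        rw [inv_mul_le_iff₀ hε]; linarith
      exact ⟨hu.2 _ hx', by rw [(hl _ hx').1, smul_zero]⟩
    right := fun x hx => by
      have hx' : 1 ≤ ε⁻¹ * x := by
        rw [le_inv_mul_iff₀ hε]; linarith
      exact ⟨(hr _ hx').2, by rw [(hr _ hx').1, smul_zero]⟩
    int_ψ := (((hΨ.memLp_comp_div ν).const_mul (β / ν)).locallyIntegrable le_top)
    bound_ψ := bψ
    sol := hp
    sol₁ := hq
    int_h := hh
    eqn := he }

theorem twoScalePotential_eq_zero {Φ Ψ : ℝ → ℝ} (hΦ : IsPotential Φ) (hΨ : IsPotential Ψ)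
    (α β : ℝ) {ε ν x : ℝ} (hε : 0 < ε) (hεν : ε ≤ ν) (hx : ν < |x|) :
    twoScalePotential Φ Ψ α β ε ν x = 0 := by
  have hν := hε.trans_le hεν
  rw [twoScalePotential, hΦ.eq_zero, hΨ.eq_zero, mul_zero, mul_zero, add_zero]
  · rwa [abs_div, abs_of_pos hν, one_lt_div hν]
  · rw [abs_div, abs_of_pos hε, one_lt_div hε]
    exact hεν.trans_lt hx

/-- Functions in the range of the resolvent of a Schrödinger operator solve the equation. -/
theorem IsResolvent.exists_solution_schrodinger {Φ Ψ : ℝ → ℝ} {hΦ : IsPotential Φ}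
    {hΨ : IsPotential Ψ} {α β ε ν : ℝ} {z : ℂ} {R : L2 →L[ℂ] L2}
    (hR : IsResolvent (schrodinger hΦ hΨ α β ε ν) z R) (f : L2) :
    ∃ (φ₁ : L2) (p q s : ℝ → ℂ), IsPrimitiveOf p q ∧ IsPrimitiveOf q s ∧
      (∀ᵐ x, R f x = p x) ∧ (∀ᵐ x, φ₁ x = q x) ∧
      ∀ᵐ x, s x = twoScalePotential Φ Ψ α β ε ν x • p x - (z • R f + f : L2) x := by
  obtain ⟨hd, e⟩ := hR.1 f
  obtain ⟨φ₁, φ₂, p, q, hp, hq, ep, eq, e2⟩ :=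
    exists_of_mem_negSecondDeriv_domain (⟨R f, hd⟩ : (schrodinger hΦ hΨ α β ε ν).domain)
  refine ⟨φ₁, p, q, φ₂, hp, hq, ep, eq, ?_⟩
  rw [schrodinger_apply, e2] at e
  have e3 : φ₂ = mulOp _ (memLp_twoScalePotential hΦ hΨ α β ε ν) (R f) - (z • R f + f) := by
    nth_rewrite 3 [← e]
    abel
  rw [e3]
  filter_upwards [Lp.coeFn_sub (mulOp _ (memLp_twoScalePotential hΦ hΨ α β ε ν) (R f))
    (z • R f + f), mulOp_coe (memLp_twoScalePotential hΦ hΨ α β ε ν) (R f), ep] with x h1 h2 h3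
  rw [h1, Pi.sub_apply, h2, h3, Complex.real_smul]

theorem norm_data_bound {z : ℂ} {Y f : L2} {c : ℝ} (h : ‖Y‖ ≤ c * ‖f‖) :
    6 * (‖Y‖ + ‖z • Y + f‖) ≤ 6 * (c + ‖z‖ * c + 1) * ‖f‖ := by
  have h1 := norm_add_le (z • Y) f
  rw [norm_smul] at h1
  have := mul_le_mul_of_nonneg_left h (norm_nonneg z)
  linarith

/-- Both resolvents are bounded by `|Im z|⁻¹`, so the quantity `B` of the comparison can be a fixed
multiple of `‖f‖`. -/
theorem exists_resolvent_difference_bound {Φ Ψ : ℝ → ℝ} (hΦ : IsPotential Φ)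
    (hΨ : IsPotential Ψ) {α : ℝ} (β : ℝ) {u : ℝ → ℝ} (hu : IsNormalizedHalfBoundState Φ α u)
    (hθ : u 1 ≠ 0) {z : ℂ} (hz : z.im ≠ 0) {R₀ : L2 →L[ℂ] L2}
    (hR₀ : IsResolvent (pointInteraction (u 1) (β * zeta Ψ (u 1))) z R₀)
    (bR₀ : ∀ f, ‖R₀ f‖ ≤ |z.im|⁻¹ * ‖f‖) :
    ∃ C δ : ℝ, 0 < δ ∧ ∀ (ε ν : ℝ) (R : L2 →L[ℂ] L2), 0 < ε → ε ≤ ν → ν ≤ δ →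
      IsResolvent (schrodinger hΦ hΨ α β ε ν) z R → (∀ f, ‖R f‖ ≤ |z.im|⁻¹ * ‖f‖) →
      ‖R - R₀‖ ≤ C * (√ν + ε / ν) := by
  obtain ⟨k, rfl, hk⟩ := exists_sqrt_im_pos hz
  obtain ⟨K, L, M, hT⟩ := hu.exists_transferData hΦ hΨ β
  obtain ⟨C, δ, hC, hδ, hcmp⟩ := exists_comparison_bound hk hz hθ (β * zeta Ψ (u 1)) K L M
  set c := |(k ^ 2).im|⁻¹ with hc
  refine ⟨C * (6 * (c + ‖k ^ 2‖ * c + 1)), δ, hδ, fun ε ν R hε hεν hνδ hR bR => ?_⟩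
  have hν := hε.trans_le hεν
  refine ContinuousLinearMap.opNorm_le_bound _ (by positivity) fun f => ?_
  obtain ⟨Y₁, p, q, s, hp, hq, ep, eq, es⟩ := hR.exists_solution_schrodinger f
  obtain ⟨hd, e⟩ := hR₀.1 f
  obtain ⟨y₁, φ, l, l₁, r, r₁, hl, hl₁, hr, hr₁, hy, hy₁, i0, i1, e2⟩ :=
    exists_of_mem_pointInteraction_domain ⟨R₀ f, hd⟩
  have hφ : φ = -(k ^ 2 • R₀ f + f) := by
    rw [e2] at e
    nth_rewrite 2 [← e]
    abel
  obtain ⟨U, U₁, D⟩ := hT ε ν p q s _ hε hεν hp hq (locallyIntegrable_L2 _) es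
  have hψ := integral_scaled_potential hΨ β hν
  have := hcmp ε ν U U₁ _ _ p q s l l₁ r r₁ f (R f) Y₁ (R₀ f) y₁ φ D hνδ
    (fun x hx => twoScalePotential_eq_zero hΦ hΨ α β hε hεν hx)
    -- With `I₋` and `I₊` the half-line integrals of `Ψ`, this is `β I₋ + θ² β I₊ = θ β (θ I₊ + θ⁻¹
    -- I₋)`, the origin of `ζ`.
    (by rw [hψ.1, hψ.2, zeta]; field_simp; ring) ep eq hl hl₁ hr hr₁ hy hy₁ i0 i1 hφ _
    (norm_data_bound (bR f)) (norm_data_bound (bR₀ f))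
  rw [sub_apply]
  exact this.trans (le_of_eq (by ring))

theorem eventually_regime {δ : ℝ} (hδ : 0 < δ) :
    ∀ᶠ p in regime, 0 < p.1 ∧ p.1 ≤ p.2 ∧ p.2 ≤ δ := by
  have h1 : ∀ᶠ p : ℝ × ℝ in regime, p.2 ∈ Ioc 0 δ :=
    (tendsto_comap.eventually (Ioc_mem_nhdsGT hδ)).filter_mono inf_le_left
  have h2 : ∀ᶠ p : ℝ × ℝ in regime, 1 ≤ p.2 / p.1 :=
    (tendsto_comap.eventually (eventually_ge_atTop 1)).filter_mono inf_le_right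
  filter_upwards [h1, h2] with p hp hp'
  -- `regime` does not demand `ε > 0`; it follows from `ν > 0` and `ν/ε ≥ 1`, since for `ε = 0` the
  -- quotient is `0`.
  have : 0 < p.1 := by
    by_contra! h
    linarith [div_nonpos_of_nonneg_of_nonpos hp.1.le h]
  exact ⟨this, (one_le_div this).1 hp', hp.2⟩

theorem tendsto_regime :
    Tendsto (fun p : ℝ × ℝ => p.2 ^ (1 / 2 : ℝ) + p.1 / p.2) regime (𝓝 0) := by
  have h1 : Tendsto (fun p : ℝ × ℝ => p.2 ^ (1 / 2 : ℝ)) regime (𝓝 0) := by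
    have : Tendsto (fun x : ℝ => x ^ (1 / 2 : ℝ)) (𝓝[>] 0) (𝓝 0) := by
      have := (Real.continuousAt_rpow_const 0 (1 / 2 : ℝ) (Or.inr (by norm_num))).tendsto
      rw [Real.zero_rpow (by norm_num)] at this
      exact this.mono_left nhdsWithin_le_nhds
    exact this.comp (tendsto_comap.mono_left inf_le_left)
  have h2 : Tendsto (fun p : ℝ × ℝ => p.1 / p.2) regime (𝓝 0) := by
    have := tendsto_inv_atTop_zero.comp
      ((tendsto_comap (f := fun p : ℝ × ℝ => p.2 / p.1) (x := (atTop : Filter ℝ))).mono_left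
        (inf_le_right (a := comap (fun p : ℝ × ℝ => p.2) (𝓝[>] 0))))
    exact this.congr fun p => inv_div _ _
  simpa using h1.add h2

end PointInteraction

theorem mainTheorem1 (Φ Ψ : ℝ → ℝ) (hΦ : IsPotential Φ) (hΨ : IsPotential Ψ) (α β : ℝ)
    (hα : α ∈ resonantSet Φ) :
    (∃! u : ℝ → ℝ, IsNormalizedHalfBoundState Φ α u) ∧
    ∀ u : ℝ → ℝ, IsNormalizedHalfBoundState Φ α u →
      ∃ θ : ℝ, θ ≠ 0 ∧ (∀ x, 1 ≤ x → u x = θ) ∧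
        ∀ z : ℂ, z.im ≠ 0 →
          ∃ (R : ℝ × ℝ → L2 →L[ℂ] L2) (R₀ : L2 →L[ℂ] L2),
            (∀ ε ν : ℝ, 0 < ε → 0 < ν →
              IsResolvent (schrodinger hΦ hΨ α β ε ν) z (R (ε, ν))) ∧
            IsResolvent (pointInteraction θ (β * zeta Ψ θ)) z R₀ ∧
            Tendsto R regime (𝓝 R₀) ∧
            (fun p => R p - R₀) =O[regime] (fun p => p.2 ^ (1 / 2 : ℝ) + p.1 / p.2) := by
  refine ⟨existsUnique_normalized hΦ hα, fun u hu => ?_⟩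
  obtain ⟨_, -, -, -, hr, -, hθ⟩ := hu.1.structure hΦ
  refine ⟨u 1, hθ, fun x hx => (hr x hx).2, fun z hz => ?_⟩
  -- The potential is bounded for all real `ε` and `ν`, so `R` can be chosen on the whole plane
  -- without case distinction.
  choose R hR bR using fun p : ℝ × ℝ => exists_resolvent_schrodinger hΦ hΨ α β p.1 p.2 hz
  obtain ⟨R₀, hR₀, bR₀⟩ := exists_resolvent_pointInteraction hθ (β * zeta Ψ (u 1)) hz
  obtain ⟨C, δ, hδ, hC⟩ := exists_resolvent_difference_bound hΦ hΨ β hu hθ hz hR₀ bR₀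
  have hO : (fun p => R p - R₀) =O[regime] (fun p => p.2 ^ (1 / 2 : ℝ) + p.1 / p.2) := by
    refine Asymptotics.IsBigO.of_bound C ?_
    filter_upwards [eventually_regime hδ] with p hp
    have h2 : 0 < p.2 := hp.1.trans_le hp.2.1
    rw [← Real.sqrt_eq_rpow, Real.norm_of_nonneg
      (add_nonneg (Real.sqrt_nonneg _) (div_nonneg hp.1.le h2.le))]
    exact hC p.1 p.2 (R p) hp.1 hp.2.1 hp.2.2 (hR p) (bR p)
  exact ⟨R, R₀, fun ε ν _ _ => hR (ε, ν), hR₀,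
    tendsto_sub_nhds_zero_iff.1 (hO.trans_tendsto tendsto_regime), hO⟩
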